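/- Let $M$ be a smooth oriented $6$-manifold. For a $6$-dimensional oriented real vector space $V$ let $A^3_+(V)$ be the $\mathrm{GL}(V)$-orbit of $\mathrm{Re}\bigl((v^1+iv^2)\wedge(v^3+iv^4)\wedge(v^5+iv^6)\bigr)$, where $v^1,\dots,v^6$ is a basis of $V^*$. For $\phi\in A^3_+(V)$ there are a unique $\ast\phi\in A^3_+(V)$ and a unique complex structure $J_\phi$ on $V$ such that $\phi\wedge{\ast\phi}>0$ and $\phi+i\,{\ast\phi}$ is a $(3,0)$-form for $J_\phi$. Let $\varphi$ be a smooth $3$-form on $M$ that lies in $A^3_+(T_xM)$ for every $x\in M$, with associated $3$-form $\ast\varphi$ and almost complex structure $J_\varphi$, and suppose that $d(\ast\varphi)=0$. Write $d(\varphi+i\,{\ast\varphi})=\overline\beta\wedge(\varphi+i\,{\ast\varphi})+\pi$ with $\beta$ of type $(1,0)$ and $\pi$ of type $(2,2)$ with respect to $J_\varphi$. (Because $\ast\varphi$ is closed, $\beta=0$ and $\pi=d\varphi$ is real.) Call $\varphi$ *positive definite* if at each point $\pi$ is positive on all $J_\varphi$-complex subspaces of complex dimension $2$, and *positive indefinite*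 if at each point $\pi=\tfrac12\omega^2$ for some nondegenerate $J_\varphi$-Hermitian real $(1,1)$-form $\omega$ of signature $(1,2)$. For a $J$-linear local coframing $\alpha=(\alpha^1,\alpha^2,\alpha^3):TU\to\mathbb C^3$ of an almost complex structure $J$, let $N(\alpha):U\to M_{3\times3}(\mathbb C)$ be the matrix for which the $(0,2)$-part of $d\alpha$ is $N(\alpha)\,{}^t\bigl(\overline{\alpha^2\wedge\alpha^3},\overline{\alpha^3\wedge\alpha^1},\overline{\alpha^1\wedge\alpha^2}\bigr)$. Put $\rho(g)a=\det(\bar g)^{-1}g\,a\,{}^t\bar g$ for $g\in\mathrm{GL}(3,\mathbb C)$. Let $D=I_3$ in the case of a $\mathrm U(3)$-structure $(J,\eta)$ (that is, $J$ is a smooth almost complex structure and $\eta$ a smooth positive $(1,1)$-form) and $D=\mathrm{diag}(1,-1,-1)$ in the case of a $\mathrm U(1,2)$-structure (the same with $\eta$ a $(1,1)$-form of signature $(1,2)$). A $J$-linear local coframing is *unitary* if $\eta=\tfrac i2\sum_k D_{kk}\,\alpha^k\wedge\overline{\alpha^k}$. The structure $(J,\eta)$ is *strictly quasi-integrable* if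 $N(\alpha)=\lambda D$ for some function $\lambda:U\to\mathbb C$, for every local unitary coframing $\alpha$, and $N(\alpha)$ takes values in the $\rho$-orbit of $D$ for every local $J$-linear coframing $\alpha$ (so that $\lambda$ has no zeros). **Proposition (Quasi-integrability).** 1. If $\varphi$ is positive definite and $\eta_\varphi$ is the unique positive $(1,1)$-form with $d\varphi=2\,\eta_\varphi^2$, then $(J_\varphi,\eta_\varphi)$ is a $\mathrm U(3)$-structure satisfying $d\varphi=2\,\eta_\varphi^2$, and it is strictly quasi-integrable. 2. If $\varphi$ is positive indefinite and $\eta_\varphi$ is the unique $(1,1)$-form of signature $(1,2)$ with $d\varphi=2\,\eta_\varphi^2$, then $(J_\varphi,\eta_\varphi)$ is a $\mathrm U(1,2)$-structure satisfying $d\varphi=2\,\eta_\varphi^2$, and it is strictly quasi-integrable. -/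

import Mathlib

open scoped Manifold ContDiff Topology ComplexConjugate

noncomputable section

namespace QuasiInt

/-! ## Multilinear algebra on a real vector space -/

section LinearAlgebra

variable {V : Type*} [AddCommGroup V] [Module ℝ V]

/-- The wedge product of alternating forms with values in a commutative algebra, normalised by
`(a ∧ b)(v) = ∑ sign(σ) a(v_σ(1), …, v_σ(p)) b(v_σ(p+1), …, v_σ(p+q))`, the sum running over the
`(p, q)`-shuffles. -/
def wedge {A : Type*} [CommRing A] [Algebra ℝ A] {p q : ℕ}
    (a : V [⋀^Fin p]→ₗ[ℝ] A) (b : V [⋀^Fin q]→ₗ[ℝ] A) : V [⋀^Fin (p + q)]→ₗ[ℝ] A :=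
  ((LinearMap.mul' ℝ A).compAlternatingMap (a.domCoprod b)).domDomCongr finSumFinEquiv

theorem wedge_apply {A : Type*} [CommRing A] [Algebra ℝ A] {p q : ℕ}
    (a : V [⋀^Fin p]→ₗ[ℝ] A) (b : V [⋀^Fin q]→ₗ[ℝ] A) (u : Fin (p + q) → V) :
    (p.factorial * q.factorial) • wedge a b u =
      ∑ s : Equiv.Perm (Fin (p + q)), Equiv.Perm.sign s •
        (a (fun i => u (s (Fin.castAdd q i))) * b (fun j => u (s (Fin.natAdd p j)))) := by
  have h := MultilinearMap.domCoprod_alternization_eq (R' := ℝ) a b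
  have h2 := congrArg (fun F => (LinearMap.mul' ℝ A) (F (u ∘ finSumFinEquiv))) h
  simp only [Fintype.card_fin, AlternatingMap.smul_apply, map_nsmul] at h2
  have h3 : wedge a b u = (LinearMap.mul' ℝ A) ((a.domCoprod b) (u ∘ finSumFinEquiv)) := rfl
  rw [h3, ← h2, MultilinearMap.alternatization_apply, map_sum]
  refine Fintype.sum_equiv (Equiv.permCongr finSumFinEquiv) _ _ fun s => ?_
  rw [Equiv.Perm.sign_permCongr]
  rcases Int.units_eq_one_or (Equiv.Perm.sign s) with hs | hs <;>
  simp [hs, MultilinearMap.domCoprod_apply, Equiv.permCongr_apply, Function.comp_def]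

/-- The wedge product `c₁ ∧ ⋯ ∧ c_k` of complex-valued `1`-forms,
`(c₁ ∧ ⋯ ∧ c_k)(u₁, …, u_k) = det (c_i(u_j))`. -/
def wedgeOnes {k : ℕ} (c : Fin k → (V →ₗ[ℝ] ℂ)) : V [⋀^Fin k]→ₗ[ℝ] ℂ where
  toMultilinearMap :=
    ((Matrix.detRowAlternating (n := Fin k) (R := ℂ)).toMultilinearMap.restrictScalars
      ℝ).compLinearMap fun _ => LinearMap.pi c
  map_eq_zero_of_eq' _ _ _ h hij :=
    (Matrix.detRowAlternating (n := Fin k) (R := ℂ)).map_eq_zero_of_eq _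
      (congrArg (LinearMap.pi c) h) hij

theorem wedgeOnes_apply {k : ℕ} (c : Fin k → (V →ₗ[ℝ] ℂ)) (u : Fin k → V) :
    wedgeOnes c u = (Matrix.of fun i j => c i (u j)).det := by
  rw [← Matrix.det_transpose]
  rfl

/-- A real-valued form regarded as a complex-valued one. -/
def complexify {k : ℕ} (ξ : V [⋀^Fin k]→ₗ[ℝ] ℝ) : V [⋀^Fin k]→ₗ[ℝ] ℂ :=
  (Complex.ofRealCLM : ℝ →ₗ[ℝ] ℂ).compAlternatingMap ξ

/-- The complex conjugate of a complex-valued `1`-form. -/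
def conjOne (c : V →ₗ[ℝ] ℂ) : V →ₗ[ℝ] ℂ :=
  (Complex.conjCLE : ℂ →ₗ[ℝ] ℂ) ∘ₗ c

/-- The `i`-th component of a `ℂ³`-valued linear map. -/
def comp {n : ℕ} (α : V →ₗ[ℝ] (Fin n → ℂ)) (i : Fin n) : V →ₗ[ℝ] ℂ :=
  (LinearMap.proj i : (Fin n → ℂ) →ₗ[ℝ] ℂ) ∘ₗ α

/-- A complex-valued `1`-form is of type `(1,0)` if it is complex linear. -/
def IsOneZero (J : V →ₗ[ℝ] V) (c : V →ₗ[ℝ] ℂ) : Prop :=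
  ∀ v, c (J v) = Complex.I * c v

/-- `A^{p,q} = Λ^p(A^{1,0}) ⊗ Λ^q(A^{0,1})`, where `A^{0,1}` is the conjugate of `A^{1,0}`. -/
def typeSpace (J : V →ₗ[ℝ] V) (p q : ℕ) : Submodule ℂ (V [⋀^Fin (p + q)]→ₗ[ℝ] ℂ) :=
  Submodule.span ℂ
    {ξ | ∃ (a : Fin p → (V →ₗ[ℝ] ℂ)) (b : Fin q → (V →ₗ[ℝ] ℂ)),
      (∀ i, IsOneZero J (a i)) ∧ (∀ j, IsOneZero J (b j)) ∧
        ξ = wedgeOnes (Fin.append a (fun j => conjOne (b j)))}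

/-- The real-valued `(1,1)`-forms. -/
def IsReal11 (J : V →ₗ[ℝ] V) (η : V [⋀^Fin 2]→ₗ[ℝ] ℝ) : Prop :=
  complexify η ∈ typeSpace J 1 1

/-- The real-valued `(2,2)`-forms. -/
def IsReal22 (J : V →ₗ[ℝ] V) (π : V [⋀^Fin 4]→ₗ[ℝ] ℝ) : Prop :=
  complexify π ∈ typeSpace J 2 2

/-- The real `(1,1)`-forms that are positive on all complex lines. -/
def IsPos11 (J : V →ₗ[ℝ] V) (η : V [⋀^Fin 2]→ₗ[ℝ] ℝ) : Prop :=
  IsReal11 J η ∧ ∀ u, u ≠ 0 → 0 < η ![u, J u]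

/-- The real `(2,2)`-forms that are positive on all complex subspaces of complex dimension `2`,
with their complex orientation. -/
def IsPos22 (J : V →ₗ[ℝ] V) (π : V [⋀^Fin 4]→ₗ[ℝ] ℝ) : Prop :=
  IsReal22 J π ∧
    ∀ u v, LinearIndependent ℝ ![u, J u, v, J v] → 0 < π ![u, J u, v, J v]

/-- The signature of `ℂ³` with the Hermitian form `|z₁|² + |z₂|² + |z₃|²`. -/
def sigDef : Fin 3 → ℝ := ![1, 1, 1]

/-- The signature of `ℂ^{1,2}` with the Hermitian form `|z₁|² - |z₂|² - |z₃|²`. -/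
def sigIndef : Fin 3 → ℝ := ![1, -1, -1]

/-- `α : V → ℂ³` is a `J`-linear isomorphism. -/
def IsCoframe (J : V →ₗ[ℝ] V) (α : V →ₗ[ℝ] (Fin 3 → ℂ)) : Prop :=
  Function.Bijective α ∧ ∀ v, α (J v) = Complex.I • α v

/-- `α` is a `J`-linear isomorphism onto `ℂ³` with the Hermitian form of signature `ε`, unitary
in the sense that `η = (i/2) ∑ ε_k α^k ∧ conj(α^k)`. -/
def IsUnitaryCoframe (ε : Fin 3 → ℝ) (J : V →ₗ[ℝ] V) (η : V [⋀^Fin 2]→ₗ[ℝ] ℝ)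
    (α : V →ₗ[ℝ] (Fin 3 → ℂ)) : Prop :=
  IsCoframe J α ∧
    complexify η =
      ∑ k, (Complex.I / 2 * (ε k : ℂ)) • wedgeOnes ![comp α k, conjOne (comp α k)]

/-- The nondegenerate `J`-Hermitian forms of type `(1,2)`. -/
def IsHerm12 (J : V →ₗ[ℝ] V) (η : V [⋀^Fin 2]→ₗ[ℝ] ℝ) : Prop :=
  IsReal11 J η ∧ ∃ α, IsUnitaryCoframe sigIndef J η α

/-- The image of the Hermitian forms of type `(1,2)` under `ξ ↦ ξ² / 2`. -/
def IsHerm12Square (J : V →ₗ[ℝ] V) (π : V [⋀^Fin 4]→ₗ[ℝ] ℝ) : Prop :=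
  ∃ ξ, IsHerm12 J ξ ∧ π = (1 / 2 : ℝ) • wedge ξ ξ

/-- The `3`-forms linearly equivalent to
`Re((v¹ + i v²) ∧ (v³ + i v⁴) ∧ (v⁵ + i v⁶))`, where `v¹, …, v⁶` is a basis of the dual space;
the map `z = (v¹ + i v², v³ + i v⁴, v⁵ + i v⁶)` is then an isomorphism onto `ℂ³`, and every
such isomorphism has this form. -/
def IsPlusForm (φ : V [⋀^Fin 3]→ₗ[ℝ] ℝ) : Prop :=
  ∃ z : V ≃ₗ[ℝ] (Fin 3 → ℂ),
    ∀ u, φ u = (wedgeOnes (fun i => comp (z : V →ₗ[ℝ] (Fin 3 → ℂ)) i) u).re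

/-- `ψ` and `J` are the `3`-form and the complex structure associated to `φ` and to the
orientation `o`. -/
structure IsAssociated (o : Orientation ℝ V (Fin 6)) (φ ψ : V [⋀^Fin 3]→ₗ[ℝ] ℝ)
    (J : V →ₗ[ℝ] V) : Prop where
  plus : IsPlusForm ψ
  sq : ∀ v, J (J v) = -v
  pos : ∃ h : wedge φ ψ ≠ 0, rayOfNeZero ℝ (wedge φ ψ) h = o
  type30 : complexify φ + Complex.I • complexify ψ ∈ typeSpace J 3 0

variable [TopologicalSpace V]

/-- The pair `(∗φ, J_φ)`, unique for `φ` in the orbit `IsPlusForm` when `V` has dimension `6`. -/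
def starPair [ContinuousAdd V] [ContinuousConstSMul ℝ V]
    (o : Orientation ℝ V (Fin 6)) (φ : V [⋀^Fin 3]→L[ℝ] ℝ) :
    (V [⋀^Fin 3]→L[ℝ] ℝ) × (V →L[ℝ] V) :=
  Classical.epsilon fun p =>
    IsAssociated o φ.toAlternatingMap p.1.toAlternatingMap (p.2 : V →ₗ[ℝ] V)

/-- The `2`-form `η` in the class `C` with `π = 2 η²`, unique for `π` in the image if `C` is
`IsPos11 J` or `IsHerm12 J` and `V` has dimension `6`. -/
def rootForm (C : (V [⋀^Fin 2]→ₗ[ℝ] ℝ) → Prop)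
    (π : V [⋀^Fin 4]→ₗ[ℝ] ℝ) : V [⋀^Fin 2]→L[ℝ] ℝ :=
  Classical.epsilon fun η =>
    C η.toAlternatingMap ∧ π = (2 : ℝ) • wedge η.toAlternatingMap η.toAlternatingMap

/-- The complex-valued form `φ + i ψ`. -/
def complexForm {k : ℕ} (φ ψ : V [⋀^Fin k]→L[ℝ] ℝ) : V [⋀^Fin k]→L[ℝ] ℂ :=
  Complex.ofRealCLM.compContinuousAlternatingMap φ +
    Complex.I • Complex.ofRealCLM.compContinuousAlternatingMap ψ

/-- The representation `ρ(g)(a) = det(conj g)⁻¹ g a (conj g)ᵗ` of `GL(3, ℂ)`. -/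
def rho (g : GL (Fin 3) ℂ) (a : Matrix (Fin 3) (Fin 3) ℂ) : Matrix (Fin 3) (Fin 3) ℂ :=
  (conj (g : Matrix (Fin 3) (Fin 3) ℂ).det)⁻¹ •
    ((g : Matrix (Fin 3) (Fin 3) ℂ) * a * (g : Matrix (Fin 3) (Fin 3) ℂ).conjTranspose)

/-- The diagonal matrix with real entries `ε`. -/
def diagMat (ε : Fin 3 → ℝ) : Matrix (Fin 3) (Fin 3) ℂ :=
  Matrix.diagonal fun i => (ε i : ℂ)

end LinearAlgebra

/-! ## Differential forms on a 6-manifold -/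

/-- The model space of a `6`-manifold. -/
abbrev E6 : Type := EuclideanSpace ℝ (Fin 6)

section Manifold

variable {M : Type*} [TopologicalSpace M] [ChartedSpace E6 M]

/-- Differential `k`-forms on `M` with values in `F`, no regularity required. -/
abbrev DForm (M : Type*) [TopologicalSpace M] [ChartedSpace E6 M]
    (F : Type*) [NormedAddCommGroup F] [NormedSpace ℝ F] (k : ℕ) : Type _ :=
  ∀ x : M, TangentSpace (𝓡 6) x [⋀^Fin k]→L[ℝ] F

/-- Fields of endomorphisms of the tangent bundle, no regularity required. -/
abbrev EndField (M : Type*) [TopologicalSpace M] [ChartedSpace E6 M] : Type _ :=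
  ∀ x : M, TangentSpace (𝓡 6) x →L[ℝ] TangentSpace (𝓡 6) x

section Forms

variable {F : Type*} [NormedAddCommGroup F] [NormedSpace ℝ F] {k : ℕ}

/-- The form `ξ` in the preferred chart at `x₀`: its pullback by the inverse of the chart. -/
def inChart (ξ : DForm M F k) (x₀ : M) : E6 → E6 [⋀^Fin k]→L[ℝ] F := fun y =>
  (ξ ((extChartAt (𝓡 6) x₀).symm y)).compContinuousLinearMap
    (mfderiv 𝓘(ℝ, E6) (𝓡 6) (extChartAt (𝓡 6) x₀).symm y)

/-- `ξ` is smooth at `x`. -/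
def SmoothFormAt (ξ : DForm M F k) (x : M) : Prop :=
  ContDiffAt ℝ ∞ (inChart ξ x) (extChartAt (𝓡 6) x x)

/-- The exterior derivative, computed at `x` in the preferred chart at `x`. -/
def extD (ξ : DForm M F k) : DForm M F (k + 1) := fun x =>
  (extDeriv (inChart ξ x) (extChartAt (𝓡 6) x x)).compContinuousLinearMap
    (mfderiv (𝓡 6) 𝓘(ℝ, E6) (extChartAt (𝓡 6) x) x)

end Forms

/-- The field of endomorphisms `J` in the preferred chart at `x₀`. -/
def endInChart (J : EndField M) (x₀ : M) : E6 → E6 →L[ℝ] E6 := fun y =>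
  let x := (extChartAt (𝓡 6) x₀).symm y
  let A : E6 →L[ℝ] TangentSpace (𝓡 6) x :=
    mfderiv 𝓘(ℝ, E6) (𝓡 6) (extChartAt (𝓡 6) x₀).symm y
  let B : TangentSpace (𝓡 6) x →L[ℝ] E6 :=
    mfderiv (𝓡 6) 𝓘(ℝ, E6) (extChartAt (𝓡 6) x₀) x
  B.comp ((J x).comp A)

/-- The field of endomorphisms `J` is smooth at `x`. -/
def SmoothEndAt (J : EndField M) (x : M) : Prop :=
  ContDiffAt ℝ ∞ (endInChart J x) (extChartAt (𝓡 6) x x)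

/-- An orientation of `M`: an orientation of each tangent space, given near each point by a
smooth nowhere vanishing `6`-form. -/
structure ManifoldOrientation (M : Type*) [TopologicalSpace M] [ChartedSpace E6 M] where
  at_ : ∀ x : M, Orientation ℝ (TangentSpace (𝓡 6) x) (Fin 6)
  smooth' : ∀ x₀ : M, ∃ μ : DForm M ℝ 6, ∀ᶠ x in 𝓝 x₀, SmoothFormAt μ x ∧
    ∃ h : (μ x).toAlternatingMap ≠ 0, rayOfNeZero ℝ (μ x).toAlternatingMap h = at_ x

/-! ## Quasi-integrability -/

/-- A `ℂ³`-valued `1`-form, as a differential form. -/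
def oneForm (α : ∀ x : M, TangentSpace (𝓡 6) x →L[ℝ] (Fin 3 → ℂ)) : DForm M (Fin 3 → ℂ) 1 :=
  fun x => ContinuousAlternatingMap.ofSubsingleton ℝ _ _ (0 : Fin 1) (α x)

/-- `α` is a local `J`-linear coframing with domain the open set `U`. -/
def IsCoframing (J : EndField M) (U : Set M)
    (α : ∀ x : M, TangentSpace (𝓡 6) x →L[ℝ] (Fin 3 → ℂ)) : Prop :=
  IsOpen U ∧ ∀ x ∈ U, SmoothFormAt (oneForm α) x ∧
    IsCoframe (J x : TangentSpace (𝓡 6) x →ₗ[ℝ] TangentSpace (𝓡 6) x)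
      (α x : TangentSpace (𝓡 6) x →ₗ[ℝ] (Fin 3 → ℂ))

/-- `α` is a local `(J, η)`-unitary coframing with domain the open set `U`. -/
def IsUnitaryCoframing (ε : Fin 3 → ℝ) (J : EndField M) (η : DForm M ℝ 2) (U : Set M)
    (α : ∀ x : M, TangentSpace (𝓡 6) x →L[ℝ] (Fin 3 → ℂ)) : Prop :=
  IsCoframing J U α ∧ ∀ x ∈ U,
    IsUnitaryCoframe ε (J x : TangentSpace (𝓡 6) x →ₗ[ℝ] TangentSpace (𝓡 6) x)
      (η x).toAlternatingMap (α x : TangentSpace (𝓡 6) x →ₗ[ℝ] (Fin 3 → ℂ))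

/-- `N = N(α)` at `x`: the `(0,2)`-component of `dα^i` at `x` is
`N_{i1} conj(α² ∧ α³) + N_{i2} conj(α³ ∧ α¹) + N_{i3} conj(α¹ ∧ α²)`. (Here `j + 1` and `j + 2`
are computed modulo `3`.) -/
def IsNijenhuisMatrix (J : EndField M)
    (α : ∀ x : M, TangentSpace (𝓡 6) x →L[ℝ] (Fin 3 → ℂ)) (x : M)
    (N : Matrix (Fin 3) (Fin 3) ℂ) : Prop :=
  ∀ i : Fin 3,
    ∃ τ ∈ typeSpace (J x : TangentSpace (𝓡 6) x →ₗ[ℝ] TangentSpace (𝓡 6) x) 2 0 ⊔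
        typeSpace (J x : TangentSpace (𝓡 6) x →ₗ[ℝ] TangentSpace (𝓡 6) x) 1 1,
      (LinearMap.proj i : (Fin 3 → ℂ) →ₗ[ℝ] ℂ).compAlternatingMap
          (extD (oneForm α) x).toAlternatingMap =
        τ + ∑ j : Fin 3, N i j • wedgeOnes
          ![conjOne (comp (α x : TangentSpace (𝓡 6) x →ₗ[ℝ] (Fin 3 → ℂ)) (j + 1)),
            conjOne (comp (α x : TangentSpace (𝓡 6) x →ₗ[ℝ] (Fin 3 → ℂ)) (j + 2))]

/-- `J` is a (smooth) almost complex structure. -/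
def IsAlmostComplex (J : EndField M) : Prop :=
  ∀ x, SmoothEndAt J x ∧ ∀ v, J x (J x v) = -v

/-- `(J, η)` is a `U(3)`-structure. -/
def IsU3Structure (J : EndField M) (η : DForm M ℝ 2) : Prop :=
  IsAlmostComplex J ∧ ∀ x, SmoothFormAt η x ∧
    IsPos11 (J x : TangentSpace (𝓡 6) x →ₗ[ℝ] TangentSpace (𝓡 6) x) (η x).toAlternatingMap

/-- `(J, η)` is a `U(1,2)`-structure. -/
def IsU12Structure (J : EndField M) (η : DForm M ℝ 2) : Prop :=
  IsAlmostComplex J ∧ ∀ x, SmoothFormAt η x ∧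
    IsHerm12 (J x : TangentSpace (𝓡 6) x →ₗ[ℝ] TangentSpace (𝓡 6) x) (η x).toAlternatingMap

/-- `J` is strictly elliptically (`ε = sigDef`) or strictly hyperbolically (`ε = sigIndef`)
quasi-integrable: `N(α)` takes values in the `ρ`-orbit of `diag(ε)` for every local `J`-linear
coframing. -/
def IsStrictlyQIAlmostComplex (ε : Fin 3 → ℝ) (J : EndField M) : Prop :=
  ∀ U α, IsCoframing J U α → ∀ x ∈ U,
    ∃ g : GL (Fin 3) ℂ, IsNijenhuisMatrix J α x (rho g (diagMat ε))

/-- `(J, η)` is quasi-integrable: `N(α) = λ diag(ε)` for every local unitary coframing. -/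
def IsQIUnitary (ε : Fin 3 → ℝ) (J : EndField M) (η : DForm M ℝ 2) : Prop :=
  ∀ U α, IsUnitaryCoframing ε J η U α →
    ∃ l : M → ℂ, ∀ x ∈ U, IsNijenhuisMatrix J α x (l x • diagMat ε)

/-- `(J, η)` is strictly quasi-integrable: it is quasi-integrable and the underlying `J` is
strictly quasi-integrable; so the functions `λ` have no zeros. -/
def IsStrictlyQIUnitary (ε : Fin 3 → ℝ) (J : EndField M) (η : DForm M ℝ 2) : Prop :=
  IsQIUnitary ε J η ∧ IsStrictlyQIAlmostComplex ε J

/-! ## The structures induced by a 3-form -/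

/-- `φ` is a smooth `3`-form that is at each point linearly equivalent to
`Re((v¹ + i v²) ∧ (v³ + i v⁴) ∧ (v⁵ + i v⁶))`. -/
def IsPlus (φ : DForm M ℝ 3) : Prop :=
  ∀ x, SmoothFormAt φ x ∧ IsPlusForm (φ x).toAlternatingMap

/-- The form `∗φ`. -/
def starForm (o : ManifoldOrientation M) (φ : DForm M ℝ 3) : DForm M ℝ 3 :=
  fun x => (starPair (o.at_ x) (φ x)).1

/-- The almost complex structure `J_φ`. -/
def inducedJ (o : ManifoldOrientation M) (φ : DForm M ℝ 3) : EndField M :=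
  fun x => (starPair (o.at_ x) (φ x)).2

/-- The complex-valued form `φ + i ∗φ`. -/
def holForm (o : ManifoldOrientation M) (φ : DForm M ℝ 3) : DForm M ℂ 3 :=
  fun x => complexForm (φ x) (starForm o φ x)

/-- `π` is the `(2,2)`-form in the decomposition
`d(φ + i ∗φ) = conj(β) ∧ (φ + i ∗φ) + π` at `x`, with `β` of type `(1,0)`, and it is real. -/
def IsPiAt (o : ManifoldOrientation M) (φ : DForm M ℝ 3) (x : M)
    (π : TangentSpace (𝓡 6) x [⋀^Fin 4]→ₗ[ℝ] ℝ) : Prop :=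
  IsReal22 (inducedJ o φ x : TangentSpace (𝓡 6) x →ₗ[ℝ] TangentSpace (𝓡 6) x) π ∧
  ∃ β : TangentSpace (𝓡 6) x →ₗ[ℝ] ℂ,
    IsOneZero (inducedJ o φ x : TangentSpace (𝓡 6) x →ₗ[ℝ] TangentSpace (𝓡 6) x) β ∧
    (extD (holForm o φ) x).toAlternatingMap =
      (wedge (wedgeOnes ![conjOne β]) (holForm o φ x).toAlternatingMap :
        TangentSpace (𝓡 6) x [⋀^Fin 4]→ₗ[ℝ] ℂ) + complexify π

/-- `φ` is positive definite. -/
def IsPositiveDefinite (o : ManifoldOrientation M) (φ : DForm M ℝ 3) : Prop :=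
  ∀ x, ∃ π, IsPiAt o φ x π ∧
    IsPos22 (inducedJ o φ x : TangentSpace (𝓡 6) x →ₗ[ℝ] TangentSpace (𝓡 6) x) π

/-- `φ` is positive indefinite. -/
def IsPositiveIndefinite (o : ManifoldOrientation M) (φ : DForm M ℝ 3) : Prop :=
  ∀ x, ∃ π, IsPiAt o φ x π ∧
    IsHerm12Square (inducedJ o φ x : TangentSpace (𝓡 6) x →ₗ[ℝ] TangentSpace (𝓡 6) x) π

/-- The positive `(1,1)`-form `η_φ` with `dφ = 2 η_φ²`, for a positive definite `φ`. -/
def etaDef (o : ManifoldOrientation M) (φ : DForm M ℝ 3) : DForm M ℝ 2 := fun x =>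
  rootForm
    (IsPos11 (inducedJ o φ x : TangentSpace (𝓡 6) x →ₗ[ℝ] TangentSpace (𝓡 6) x))
    (extD φ x).toAlternatingMap

/-- The `(1,1)`-form `η_φ` of signature `(1,2)` with `dφ = 2 η_φ²`, for a positive indefinite
`φ`. -/
def etaIndef (o : ManifoldOrientation M) (φ : DForm M ℝ 3) : DForm M ℝ 2 := fun x =>
  rootForm
    (IsHerm12 (inducedJ o φ x : TangentSpace (𝓡 6) x →ₗ[ℝ] TangentSpace (𝓡 6) x))
    (extD φ x).toAlternatingMap

end Manifold

end QuasiInt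

end

noncomputable section

namespace QuasiInt

/-! ### Wedge products and complex multilinear evaluation -/

section MultilinearAlgebra

variable {V : Type*} [AddCommGroup V] [Module ℝ V]

/-! ### The wedge product -/

/-! Write Ω = φ + i ∗φ, and let D = diag(ε). As ∗φ is closed, dΩ = dφ is real. In dΩ = conj(β) ∧ Ω +
π with π real, the term conj(β) ∧ Ω is then real and of type (3,1), hence zero, so dφ = π
(`IsCoframe.eq_of_complexify_eq`).

Quasi-integrability compares (2,2)-parts. In a J-linear coframing, Ω = f α¹ ∧ α² ∧ α³ with f nowhere
zero. A (2,2)-component of dΩ arises only by replacing one α^a with the (0,2)-part of dα^a. So f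
N_{ab} is the coefficient of α^{a+1} ∧ α^{a+2} ∧ conj(α^{b+1} ∧ α^{b+2}) in dφ = 2η²
(`IsCoframe.coeff22_deriv`, indices mod 3). If α is unitary, the coefficient matrix of 2η² is the
cofactor matrix of D, which is D itself (`IsUnitaryCoframe.complexify_two_smul_wedge`), so N = f⁻¹
D. For any other coframing some hα is unitary at the point, and f N = adj(h) D adj(h)ᴴ
(`IsCoframe.coeff22_sum_basis22`). Rescaling adj(h) by a number found from a cube root absorbs f and
the determinant in ρ (`exists_rho_eq`). These arguments meet in `exists_nijenhuis_matrix`.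

The root η exists pointwise. In the definite case the coefficient matrix of π is positive on every
vector of ℂ³, because every vector is a cross product. Hence it is G Gᴴ, G is an adjugate adj(h),
and hα is unitary for a root (`IsCoframe.exists_unitary_of_isPos22`). In the indefinite case the
root is half of the given form.

Smoothness is the other half of the work, since ∗φ, J and η are chosen point by point. It comes from
identities that recover them algebraically. Hitchin's identity ι_vφ ∧ φ ∧ ζ = ½ ζ(Jv) φ ∧ ∗φ makes J
⊗ (φ ∧ ∗φ) smooth. As J² = -1, the square of the density φ ∧ ∗φ is smooth as well, and the
orientation fixes the sign of its root (`contDiffAt_wedgeVol`). Then ∗φ = -φ(J·,·,·). Similarly ι_vη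
∧ ζ ∧ dφ is ζ(v) times a nonvanishing density. So η is a scalar times the inverse of the pairing (ζ,
ξ) ↦ ζ ∧ ξ ∧ dφ, and the scalar is a square root of known sign (`contDiffAt_root`). -/

theorem alternatingMap_sum_apply {A : Type*} [AddCommGroup A] [Module ℝ A] {k : ℕ} {ι : Type*}
    (t : Finset ι) (f : ι → V [⋀^Fin k]→ₗ[ℝ] A) (u : Fin k → V) :
    (∑ i ∈ t, f i) u = ∑ i ∈ t, f i u := by
  classical
  induction t using Finset.induction_on with
  | empty => simp
  | insert i t hi ih => rw [Finset.sum_insert hi, Finset.sum_insert hi, AlternatingMap.add_apply, ih]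

/-- Since p! q! is invertible over ℝ, the sum over all permutations determines the product. The
algebraic rules for `wedge` then reduce to comparing such sums, without shuffles. -/
theorem wedge_ext {A : Type*} [CommRing A] [Algebra ℝ A] {p q : ℕ}
    {ξ : V [⋀^Fin (p + q)]→ₗ[ℝ] A} {a : V [⋀^Fin p]→ₗ[ℝ] A} {b : V [⋀^Fin q]→ₗ[ℝ] A}
    (h : ∀ u, (p.factorial * q.factorial) • ξ u =
      ∑ s : Equiv.Perm (Fin (p + q)), Equiv.Perm.sign s •
        (a (fun i => u (s (Fin.castAdd q i))) * b (fun j => u (s (Fin.natAdd p j))))) :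
    ξ = wedge a b := by
  ext u
  have h1 := (h u).trans (wedge_apply a b u).symm
  rw [← Nat.cast_smul_eq_nsmul ℝ, ← Nat.cast_smul_eq_nsmul ℝ] at h1
  refine smul_right_injective A (r := ((p.factorial * q.factorial : ℕ) : ℝ)) ?_ h1
  exact_mod_cast (Nat.mul_pos p.factorial_pos q.factorial_pos).ne'

section Bilinear

variable {A : Type*} [CommRing A] [Algebra ℝ A] {p q : ℕ}

theorem wedge_add_left (a a' : V [⋀^Fin p]→ₗ[ℝ] A) (b : V [⋀^Fin q]→ₗ[ℝ] A) :
    wedge (a + a') b = wedge a b + wedge a' b := by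
  refine (wedge_ext fun u => ?_).symm
  rw [AlternatingMap.add_apply, smul_add, wedge_apply, wedge_apply, ← Finset.sum_add_distrib]
  refine Finset.sum_congr rfl fun s _ => ?_
  rw [← smul_add, AlternatingMap.add_apply, add_mul]

theorem wedge_add_right (a : V [⋀^Fin p]→ₗ[ℝ] A) (b b' : V [⋀^Fin q]→ₗ[ℝ] A) :
    wedge a (b + b') = wedge a b + wedge a b' := by
  refine (wedge_ext fun u => ?_).symm
  rw [AlternatingMap.add_apply, smul_add, wedge_apply, wedge_apply, ← Finset.sum_add_distrib]
  refine Finset.sum_congr rfl fun s _ => ?_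
  rw [← smul_add, AlternatingMap.add_apply, mul_add]

theorem wedge_smul_left {R : Type*} [Monoid R] [DistribMulAction R A] [SMulCommClass ℝ R A]
    [IsScalarTower R A A] (c : R) (a : V [⋀^Fin p]→ₗ[ℝ] A)
    (b : V [⋀^Fin q]→ₗ[ℝ] A) : wedge (c • a) b = c • wedge a b := by
  refine (wedge_ext fun u => ?_).symm
  rw [AlternatingMap.smul_apply, smul_comm, wedge_apply, Finset.smul_sum]
  refine Finset.sum_congr rfl fun s _ => ?_
  rw [AlternatingMap.smul_apply, smul_mul_assoc]
  rcases Int.units_eq_one_or (Equiv.Perm.sign s) with hs | hs <;> simp [hs]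

theorem wedge_smul_right {R : Type*} [Monoid R] [DistribMulAction R A] [SMulCommClass ℝ R A]
    [SMulCommClass R A A] (c : R) (a : V [⋀^Fin p]→ₗ[ℝ] A)
    (b : V [⋀^Fin q]→ₗ[ℝ] A) : wedge a (c • b) = c • wedge a b := by
  refine (wedge_ext fun u => ?_).symm
  rw [AlternatingMap.smul_apply, smul_comm, wedge_apply, Finset.smul_sum]
  refine Finset.sum_congr rfl fun s _ => ?_
  rw [AlternatingMap.smul_apply, mul_smul_comm]
  rcases Int.units_eq_one_or (Equiv.Perm.sign s) with hs | hs <;> simp [hs]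

theorem wedge_sum_left {ι : Type*} (t : Finset ι) (a : ι → V [⋀^Fin p]→ₗ[ℝ] A)
    (b : V [⋀^Fin q]→ₗ[ℝ] A) : wedge (∑ i ∈ t, a i) b = ∑ i ∈ t, wedge (a i) b := by
  classical
  induction t using Finset.induction_on with
  | empty => simpa using wedge_smul_left (0 : ℝ) (0 : V [⋀^Fin p]→ₗ[ℝ] A) b
  | insert i t hi ih => rw [Finset.sum_insert hi, Finset.sum_insert hi, wedge_add_left, ih]

theorem wedge_sum_right {ι : Type*} (t : Finset ι) (a : V [⋀^Fin p]→ₗ[ℝ] A)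
    (b : ι → V [⋀^Fin q]→ₗ[ℝ] A) : wedge a (∑ i ∈ t, b i) = ∑ i ∈ t, wedge a (b i) := by
  classical
  induction t using Finset.induction_on with
  | empty => simpa using wedge_smul_right (0 : ℝ) a (0 : V [⋀^Fin q]→ₗ[ℝ] A)
  | insert i t hi ih => rw [Finset.sum_insert hi, Finset.sum_insert hi, wedge_add_right, ih]

theorem wedge_compLinearMap {W : Type*} [AddCommGroup W] [Module ℝ W] (f : W →ₗ[ℝ] V)
    (a : V [⋀^Fin p]→ₗ[ℝ] A) (b : V [⋀^Fin q]→ₗ[ℝ] A) :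
    wedge (a.compLinearMap f) (b.compLinearMap f) = (wedge a b).compLinearMap f := by
  refine (wedge_ext fun u => ?_).symm
  rw [AlternatingMap.compLinearMap_apply, wedge_apply]
  rfl

end Bilinear

theorem complexify_apply {k : ℕ} (ξ : V [⋀^Fin k]→ₗ[ℝ] ℝ) (u : Fin k → V) :
    complexify ξ u = (ξ u : ℂ) := rfl

theorem complexify_injective {k : ℕ} :
    Function.Injective (complexify : V [⋀^Fin k]→ₗ[ℝ] ℝ → V [⋀^Fin k]→ₗ[ℝ] ℂ) := by
  intro a b h
  ext u
  exact Complex.ofReal_injective (congrArg (fun F => F u) h)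

theorem complexify_smul {k : ℕ} (c : ℝ) (ξ : V [⋀^Fin k]→ₗ[ℝ] ℝ) :
    complexify (c • ξ) = (c : ℂ) • complexify ξ := by
  ext u
  simp [complexify_apply]

theorem complexify_sub {k : ℕ} (ξ ζ : V [⋀^Fin k]→ₗ[ℝ] ℝ) :
    complexify (ξ - ζ) = complexify ξ - complexify ζ := by
  ext u
  simp [complexify_apply]

theorem complexify_wedge {p q : ℕ} (a : V [⋀^Fin p]→ₗ[ℝ] ℝ) (b : V [⋀^Fin q]→ₗ[ℝ] ℝ) :
    complexify (wedge a b) = wedge (complexify a) (complexify b) := by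
  refine wedge_ext fun u => ?_
  have h := congrArg Complex.ofReal (wedge_apply a b u)
  rw [complexify_apply]
  rw [nsmul_eq_mul] at h ⊢
  rw [Complex.ofReal_mul, Complex.ofReal_natCast] at h
  rw [h, Complex.ofReal_sum]
  refine Finset.sum_congr rfl fun s _ => ?_
  rcases Int.units_eq_one_or (Equiv.Perm.sign s) with hs | hs <;> simp [hs, complexify_apply]

/-! ### Products of `1`-forms -/

/-- `(c₁, …, c_k) ↦ c₁ ∧ ⋯ ∧ c_k` as an alternating map. -/
def wedgeOnesAlt (V : Type*) [AddCommGroup V] [Module ℝ V] (k : ℕ) :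
    (V →ₗ[ℝ] ℂ) [⋀^Fin k]→ₗ[ℂ] (V [⋀^Fin k]→ₗ[ℝ] ℂ) where
  toFun := wedgeOnes
  map_update_add' c i x y := by
    ext u
    simp only [wedgeOnes_apply, AlternatingMap.add_apply]
    have := (Matrix.detRowAlternating (n := Fin k) (R := ℂ)).map_update_add
      (fun i j => c i (u j)) i (fun j => x (u j)) (fun j => y (u j))
    convert this using 2 <;>
    · first
      | congr 1; ext a b; rw [Matrix.of_apply, Function.update_apply, Function.update_apply]; split_ifs <;> rfl
  map_update_smul' c i r x := by
    ext u
    simp only [wedgeOnes_apply, AlternatingMap.smul_apply]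
    have := (Matrix.detRowAlternating (n := Fin k) (R := ℂ)).map_update_smul
      (fun i j => c i (u j)) i r (fun j => x (u j))
    convert this using 2 <;>
    · first
      | congr 1; ext a b; rw [Matrix.of_apply, Function.update_apply, Function.update_apply]; split_ifs <;> rfl
  map_eq_zero_of_eq' c i j h hij := by
    ext u
    rw [wedgeOnes_apply]
    exact Matrix.det_zero_of_row_eq hij (by ext a; simp [h])

theorem wedgeOnesAlt_apply {k : ℕ} (c : Fin k → (V →ₗ[ℝ] ℂ)) :
    wedgeOnesAlt V k c = wedgeOnes c := rfl

/-- The matrix of values factors through `C`, so this is multiplicativity of the determinant. -/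
theorem wedgeOnes_sum_smul {k : ℕ} (C : Matrix (Fin k) (Fin k) ℂ) (θ : Fin k → (V →ₗ[ℝ] ℂ)) :
    wedgeOnes (fun i => ∑ m, C i m • θ m) = C.det • wedgeOnes θ := by
  ext u
  rw [AlternatingMap.smul_apply, wedgeOnes_apply, wedgeOnes_apply, smul_eq_mul, ← Matrix.det_mul]
  congr 1
  ext i j
  simp [Matrix.mul_apply]

theorem wedgeOnes_compLinearMap {W : Type*} [AddCommGroup W] [Module ℝ W] {k : ℕ}
    (f : W →ₗ[ℝ] V) (c : Fin k → (V →ₗ[ℝ] ℂ)) :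
    (wedgeOnes c).compLinearMap f = wedgeOnes fun i => c i ∘ₗ f := by
  ext u
  simp [wedgeOnes_apply]

/-- A product of `1`-forms is the alternatization of a pure tensor, and `domCoprod` of two
alternatizations is the alternatization of the tensor product. -/
theorem wedge_wedgeOnes {p q : ℕ} (a : Fin p → (V →ₗ[ℝ] ℂ)) (b : Fin q → (V →ₗ[ℝ] ℂ)) :
    wedge (wedgeOnes a) (wedgeOnes b) = wedgeOnes (Fin.append a b) := by
  have key : ∀ {k : ℕ} (c : Fin k → (V →ₗ[ℝ] ℂ)),
      wedgeOnes c = MultilinearMap.alternatization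
        ((MultilinearMap.mkPiAlgebra ℝ (Fin k) ℂ).compLinearMap c) := by
    intro k c
    ext u
    rw [wedgeOnes_apply, ← Matrix.det_transpose, Matrix.det_apply,
      MultilinearMap.alternatization_apply]
    rfl
  rw [wedge, key a, key b, ← MultilinearMap.domCoprod_alternization, key]
  ext u
  simp only [AlternatingMap.domDomCongr_apply, LinearMap.compAlternatingMap_apply,
    MultilinearMap.alternatization_apply, map_sum]
  refine Fintype.sum_equiv (Equiv.permCongr finSumFinEquiv) _ _ fun s => ?_
  rw [Equiv.Perm.sign_permCongr]
  rcases Int.units_eq_one_or (Equiv.Perm.sign s) with hs | hs <;>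
  simp [hs, MultilinearMap.domCoprod_apply, Equiv.permCongr_apply, Function.comp_def,
    Fin.prod_univ_add]

theorem curryLeft_wedgeOnes_three (c : Fin 3 → (V →ₗ[ℝ] ℂ)) (v : V) :
    (wedgeOnes c).curryLeft v = ∑ a : Fin 3, c a v • wedgeOnes ![c (a + 1), c (a + 2)] := by
  ext u
  simp [wedgeOnes_apply, Matrix.det_fin_three, Matrix.det_fin_two, Fin.sum_univ_three]
  ring

theorem curryLeft_wedgeOnes_two (c d : V →ₗ[ℝ] ℂ) (v : V) :
    (wedgeOnes ![c, d]).curryLeft v = c v • wedgeOnes ![d] - d v • wedgeOnes ![c] := by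
  ext u
  simp [wedgeOnes_apply, Matrix.det_fin_two]
  ring

/-- The products of `1`-forms span the complex-valued forms. -/
theorem span_range_wedgeOnes [FiniteDimensional ℝ V] (k : ℕ) :
    Submodule.span ℂ (Set.range (wedgeOnes : (Fin k → (V →ₗ[ℝ] ℂ)) → _)) = ⊤ := by
  rw [eq_top_iff]
  rintro ξ -
  let b := Module.finBasis ℝ V
  let cf : Fin (Module.finrank ℝ V) → (V →ₗ[ℝ] ℂ) := fun i =>
    (Complex.ofRealCLM : ℝ →ₗ[ℝ] ℂ) ∘ₗ b.coord i
  -- The sum runs over all multi-indices rather than the increasing ones, whence the factor 1/k!.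
  have key : ξ = ∑ i : Fin k → Fin (Module.finrank ℝ V),
      (((k.factorial : ℂ))⁻¹ * ξ (fun j => b (i j))) • wedgeOnes (fun a => cf (i a)) := by
    ext v
    have h1 := congrArg (fun F => F v) (AlternatingMap.coe_alternatization ξ)
    simp only [MultilinearMap.alternatization_apply, AlternatingMap.smul_apply, Fintype.card_fin,
      nsmul_eq_mul] at h1
    have h2 : ∀ s : Equiv.Perm (Fin k), ξ (fun j => v (s j)) =
        ∑ i : Fin k → Fin (Module.finrank ℝ V), (∏ j, cf (i j) (v (s j))) *
          ξ (fun j => b (i j)) := by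
      intro s
      have : (fun j => v (s j)) = fun j => ∑ i, b.coord i (v (s j)) • b i := by
        funext j
        exact (b.sum_repr _).symm
      rw [this]
      have h3 := ξ.toMultilinearMap.map_sum (fun j i => b.coord i (v (s j)) • b i)
      simp only [AlternatingMap.coe_multilinearMap] at h3
      rw [h3]
      refine Finset.sum_congr rfl fun i _ => ?_
      have h4 := ξ.toMultilinearMap.map_smul_univ (fun j => b.coord (i j) (v (s j)))
        (fun j => b (i j))
      simp only [AlternatingMap.coe_multilinearMap] at h4
      rw [h4, Complex.real_smul, Complex.ofReal_prod]
      rfl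
    have h5 : (k.factorial : ℂ) * ξ v = ∑ i : Fin k → Fin (Module.finrank ℝ V),
        ξ (fun j => b (i j)) * wedgeOnes (fun a => cf (i a)) v := by
      rw [← h1]
      simp only [wedgeOnes_apply]
      simp_rw [← Matrix.det_transpose (Matrix.of _), Matrix.det_apply, Finset.mul_sum]
      rw [Finset.sum_comm]
      refine Finset.sum_congr rfl fun s _ => ?_
      rw [MultilinearMap.domDomCongr_apply, AlternatingMap.coe_multilinearMap, h2 s,
        Finset.smul_sum]
      refine Finset.sum_congr rfl fun i _ => ?_
      rw [mul_smul_comm, mul_comm]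
      rfl
    rw [alternatingMap_sum_apply]
    simp only [AlternatingMap.smul_apply, smul_eq_mul, mul_assoc]
    rw [← Finset.mul_sum, ← h5, inv_mul_cancel_left₀]
    exact_mod_cast k.factorial_ne_zero
  rw [key]
  exact Submodule.sum_mem _ fun i _ => Submodule.smul_mem _ _ (Submodule.subset_span ⟨_, rfl⟩)

/-! ### Evaluation on vectors of type `(1,0)` and `(0,1)` -/

/-- The value at `(v₁ + i w₁, …, v_k + i w_k)` of the complex multilinear extension of a form. -/
def complexEval {k : ℕ} (v w : Fin k → V) : (V [⋀^Fin k]→ₗ[ℝ] ℂ) →ₗ[ℂ] ℂ where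
  toFun ξ := ∑ s : Finset (Fin k), Complex.I ^ sᶜ.card * ξ (s.piecewise v w)
  map_add' ξ ζ := by simp [mul_add, Finset.sum_add_distrib]
  map_smul' c ξ := by
    simp only [AlternatingMap.smul_apply, smul_eq_mul, RingHom.id_apply, Finset.mul_sum]
    exact Finset.sum_congr rfl fun s _ => by ring

theorem complexEval_apply {k : ℕ} (v w : Fin k → V) (ξ : V [⋀^Fin k]→ₗ[ℝ] ℂ) :
    complexEval v w ξ = ∑ s : Finset (Fin k), Complex.I ^ sᶜ.card * ξ (s.piecewise v w) := rfl

/-- This is the expansion of a determinant whose columns are sums, with the factor i pulled out of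
the columns outside the subset. -/
theorem complexEval_wedgeOnes {k : ℕ} (v w : Fin k → V) (c : Fin k → (V →ₗ[ℝ] ℂ)) :
    complexEval v w (wedgeOnes c) =
      (Matrix.of fun i j => c i (v j) + Complex.I * c i (w j)).det := by
  have h := (Matrix.detRowAlternating (n := Fin k) (R := ℂ)).toMultilinearMap.map_add_univ
    (fun j i => c i (v j)) (fun j i => Complex.I * c i (w j))
  rw [← Matrix.det_transpose]
  refine Eq.trans ?_ h.symm
  rw [complexEval_apply]
  refine Finset.sum_congr rfl fun s _ => ?_
  have h2 := (Matrix.detRowAlternating (n := Fin k) (R := ℂ)).toMultilinearMap.map_piecewise_smul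
    (fun _ => Complex.I) (s.piecewise (fun j i => c i (v j)) (fun j i => c i (w j))) sᶜ
  rw [Finset.prod_const, smul_eq_mul] at h2
  have h3 : (sᶜ.piecewise (fun j => Complex.I •
        s.piecewise (fun j i => c i (v j)) (fun j i => c i (w j)) j)
        (s.piecewise (fun j i => c i (v j)) (fun j i => c i (w j)))) =
      s.piecewise (fun j i => c i (v j)) (fun j i => Complex.I * c i (w j)) := by
    ext j i
    by_cases hj : j ∈ s <;> simp [Finset.piecewise, hj]
  rw [h3] at h2
  rw [AlternatingMap.coe_multilinearMap] at h2 ⊢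
  rw [h2, wedgeOnes_apply, ← Matrix.det_transpose]
  congr 2
  ext j i
  by_cases hj : j ∈ s <;> simp [Finset.piecewise, hj]

/-- The values of a real form are real, so conjugation acts only on the powers of i, as negating `w`
does. -/
theorem conj_complexEval_complexify {k : ℕ} (v w : Fin k → V) (ξ : V [⋀^Fin k]→ₗ[ℝ] ℝ) :
    conj (complexEval v w (complexify ξ)) = complexEval v (-w) (complexify ξ) := by
  rw [complexEval_apply, complexEval_apply, map_sum]
  refine Finset.sum_congr rfl fun s _ => ?_
  have h2 := ξ.toMultilinearMap.map_piecewise_smul (fun _ => (-1 : ℝ)) (s.piecewise v w) sᶜ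
  rw [Finset.prod_const, smul_eq_mul] at h2
  have h3 : (sᶜ.piecewise (fun j => (-1 : ℝ) • s.piecewise v w j) (s.piecewise v w)) =
      s.piecewise v (-w) := by
    ext j
    by_cases hj : j ∈ s <;> simp [Finset.piecewise, hj]
  rw [h3] at h2
  simp only [AlternatingMap.coe_multilinearMap] at h2
  rw [complexify_apply, complexify_apply, h2]
  simp only [map_mul, map_pow, Complex.conj_I, Complex.conj_ofReal, Complex.ofReal_mul,
    Complex.ofReal_pow, Complex.ofReal_neg, Complex.ofReal_one]
  rw [neg_pow, mul_assoc, mul_left_comm]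

/-- The value of the complex multilinear extension of a form at the vectors
`(u_j - i s_j J u_j) / 2`, which are of type `(1,0)` if `s_j = 1` and `(0,1)` if `s_j = -1`. -/
def typeEval (J : V →ₗ[ℝ] V) {k : ℕ} (s : Fin k → ℝ) (u : Fin k → V) :
    (V [⋀^Fin k]→ₗ[ℝ] ℂ) →ₗ[ℂ] ℂ :=
  complexEval (fun j => (1 / 2 : ℝ) • u j) (fun j => (-(s j) / 2) • J (u j))

theorem typeEval_wedgeOnes (J : V →ₗ[ℝ] V) {k : ℕ} (s : Fin k → ℝ) (u : Fin k → V)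
    (c : Fin k → (V →ₗ[ℝ] ℂ)) :
    typeEval J s u (wedgeOnes c) =
      (Matrix.of fun i j => (c i (u j) - Complex.I * s j * c i (J (u j))) / 2).det := by
  rw [typeEval, complexEval_wedgeOnes]
  congr 1
  ext i j
  simp only [Matrix.of_apply, map_smul, Complex.real_smul]
  push_cast
  ring

/-- For a real form, conjugation exchanges (1,0)- and (0,1)-arguments; a real form with a
(3,1)-component thus also has a (1,3)-component. -/
theorem conj_typeEval_complexify (J : V →ₗ[ℝ] V) {k : ℕ} (s : Fin k → ℝ) (u : Fin k → V)
    (ξ : V [⋀^Fin k]→ₗ[ℝ] ℝ) :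
    conj (typeEval J s u (complexify ξ)) = typeEval J (-s) u (complexify ξ) := by
  rw [typeEval, conj_complexEval_complexify, typeEval]
  congr 2
  ext j
  simp [neg_div]

end MultilinearAlgebra

/-! ### Coframes and components by type -/

section Coframes

variable {V : Type*} [AddCommGroup V] [Module ℝ V]

theorem conjOne_apply (c : V →ₗ[ℝ] ℂ) (v : V) : conjOne c v = conj (c v) := rfl

theorem comp_apply {n : ℕ} (α : V →ₗ[ℝ] (Fin n → ℂ)) (i : Fin n) (v : V) :
    comp α i v = α v i := rfl

theorem conjOne_sum_smul {ι : Type*} (t : Finset ι) (a : ι → ℂ) (c : ι → (V →ₗ[ℝ] ℂ)) :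
    conjOne (∑ i ∈ t, a i • c i) = ∑ i ∈ t, conj (a i) • conjOne (c i) := by
  ext v
  simp [conjOne_apply]

/-! ### Expansions of products of `1`-forms -/

theorem wedgeOnes_two_expand (θ : Fin 3 → (V →ₗ[ℝ] ℂ)) (A B : Fin 3 → ℂ) :
    wedgeOnes ![∑ k, A k • θ k, ∑ k, B k • θ k] =
      ∑ a : Fin 3, (A (a + 1) * B (a + 2) - A (a + 2) * B (a + 1)) •
        wedgeOnes ![θ (a + 1), θ (a + 2)] := by
  ext u
  simp [wedgeOnes_apply, Matrix.det_fin_two, Fin.sum_univ_three]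
  ring

theorem wedgeOnes_four_apply (a b c d : V →ₗ[ℝ] ℂ) (u : Fin 4 → V) :
    wedgeOnes ![a, b, c, d] u =
      (a (u 0) * b (u 1) - a (u 1) * b (u 0)) * (c (u 2) * d (u 3) - c (u 3) * d (u 2)) -
      (a (u 0) * b (u 2) - a (u 2) * b (u 0)) * (c (u 1) * d (u 3) - c (u 3) * d (u 1)) +
      (a (u 0) * b (u 3) - a (u 3) * b (u 0)) * (c (u 1) * d (u 2) - c (u 2) * d (u 1)) +
      (a (u 1) * b (u 2) - a (u 2) * b (u 1)) * (c (u 0) * d (u 3) - c (u 3) * d (u 0)) -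
      (a (u 1) * b (u 3) - a (u 3) * b (u 1)) * (c (u 0) * d (u 2) - c (u 2) * d (u 0)) +
      (a (u 2) * b (u 3) - a (u 3) * b (u 2)) * (c (u 0) * d (u 1) - c (u 1) * d (u 0)) := by
  rw [wedgeOnes_apply]
  simp [Matrix.det_succ_row_zero, Fin.sum_univ_succ, Fin.succAbove]
  ring

theorem wedgeOnes_four_expand (θ : Fin 3 → (V →ₗ[ℝ] ℂ)) (A B : Fin 3 → ℂ) (c d : V →ₗ[ℝ] ℂ) :
    wedgeOnes ![∑ k, A k • θ k, ∑ k, B k • θ k, c, d] =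
      ∑ a : Fin 3, (A (a + 1) * B (a + 2) - A (a + 2) * B (a + 1)) •
        wedgeOnes ![θ (a + 1), θ (a + 2), c, d] := by
  ext u
  simp [wedgeOnes_four_apply, Fin.sum_univ_three]
  ring

theorem wedgeOnes_four_swap (a b c d : V →ₗ[ℝ] ℂ) :
    wedgeOnes ![a, b, c, d] = wedgeOnes ![c, d, a, b] := by
  ext u
  rw [wedgeOnes_four_apply, wedgeOnes_four_apply]
  ring

theorem append_two_two {X : Type*} (a b : Fin 2 → X) :
    Fin.append a b = ![a 0, a 1, b 0, b 1] := by
  ext i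
  fin_cases i <;> rfl

theorem append_one_one {X : Type*} (a b : Fin 1 → X) : Fin.append a b = ![a 0, b 0] := by
  ext i
  fin_cases i <;> rfl

theorem append_two_zero {X : Type*} (a : Fin 2 → X) (b : Fin 0 → X) :
    Fin.append a b = ![a 0, a 1] := by
  ext i
  fin_cases i <;> rfl

theorem append_three_zero {X : Type*} (a : Fin 3 → X) (b : Fin 0 → X) :
    Fin.append a b = a := by
  ext i
  fin_cases i <;> rfl

/-! ### Coframes -/

section Coframe

variable {J : V →ₗ[ℝ] V} {α : V →ₗ[ℝ] (Fin 3 → ℂ)}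

theorem IsCoframe.comp_J (hα : IsCoframe J α) (i : Fin 3) : IsOneZero J (comp α i) := fun v => by
  simp [comp_apply, hα.2 v]

/-- The basis of type `(1,0)` dual to a coframe. -/
def IsCoframe.frame (hα : IsCoframe J α) (k : Fin 3) : V := (hα.1.2 (Pi.single k 1)).choose

theorem IsCoframe.apply_frame (hα : IsCoframe J α) (k : Fin 3) :
    α (hα.frame k) = Pi.single k 1 := (hα.1.2 (Pi.single k 1)).choose_spec

theorem IsCoframe.comp_frame (hα : IsCoframe J α) (i k : Fin 3) :
    comp α i (hα.frame k) = if i = k then 1 else 0 := by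
  rw [comp_apply, hα.apply_frame, Pi.single_apply]

theorem IsCoframe.J_J (hα : IsCoframe J α) (v : V) : J (J v) = -v := by
  apply hα.1.1
  rw [hα.2, hα.2, smul_smul, Complex.I_mul_I, map_neg, neg_one_smul]

theorem IsCoframe.sum_frame (hα : IsCoframe J α) (u : V) :
    u = ∑ k, ((comp α k u).re • hα.frame k + (comp α k u).im • J (hα.frame k)) := by
  apply hα.1.1
  rw [map_sum]
  ext i
  have : ∀ k, α ((comp α k u).re • hα.frame k + (comp α k u).im • J (hα.frame k)) i =
      if i = k then α u i else 0 := by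
    intro k
    rw [map_add, map_smul, map_smul, hα.2, hα.apply_frame]
    simp only [Pi.add_apply, Pi.smul_apply, Pi.single_apply, comp_apply]
    split_ifs with h
    · subst h
      simp only [smul_eq_mul, Complex.real_smul, mul_one]
      exact Complex.re_add_im _
    · simp
  rw [Finset.sum_apply, Finset.sum_congr rfl fun k _ => this k, Finset.sum_ite_eq, if_pos (Finset.mem_univ i)]

theorem IsCoframe.eq_sum_of_isOneZero (hα : IsCoframe J α) {c : V →ₗ[ℝ] ℂ} (hc : IsOneZero J c) :
    c = ∑ k, c (hα.frame k) • comp α k := by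
  ext u
  conv_lhs => rw [hα.sum_frame u]
  rw [map_sum, LinearMap.sum_apply]
  refine Finset.sum_congr rfl fun k _ => ?_
  rw [map_add, map_smul, map_smul, hc, LinearMap.smul_apply]
  simp only [Complex.real_smul, smul_eq_mul]
  conv_rhs => rw [← Complex.re_add_im (comp α k u)]
  ring

theorem IsCoframe.conjOne_eq_sum (hα : IsCoframe J α) {c : V →ₗ[ℝ] ℂ} (hc : IsOneZero J c) :
    conjOne c = ∑ k, conj (c (hα.frame k)) • conjOne (comp α k) := by
  conv_lhs => rw [hα.eq_sum_of_isOneZero hc]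
  rw [conjOne_sum_smul]

theorem IsCoframe.finiteDimensional (hα : IsCoframe J α) : FiniteDimensional ℝ V :=
  (LinearEquiv.ofBijective α hα.1).symm.finiteDimensional

/-- The value of the complex linear extension of a `1`-form on a vector of pure type. -/
theorem IsOneZero.typeEntry {c : V →ₗ[ℝ] ℂ} (hc : IsOneZero J c) (s : ℝ) (u : V) :
    (c u - Complex.I * s * c (J u)) / 2 = (1 + s) / 2 * c u := by
  rw [hc u]
  linear_combination (-(s : ℂ) / 2 * c u) * Complex.I_sq

theorem IsOneZero.typeEntry_conjOne {c : V →ₗ[ℝ] ℂ} (hc : IsOneZero J c) (s : ℝ) (u : V) :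
    (conjOne c u - Complex.I * s * conjOne c (J u)) / 2 = (1 - s) / 2 * conj (c u) := by
  rw [conjOne_apply, conjOne_apply, hc u, map_mul, Complex.conj_I]
  linear_combination ((s : ℂ) / 2 * conj (c u)) * Complex.I_sq

/-- The `(1,0)`-part of a `1`-form. -/
def partOneZero (J : V →ₗ[ℝ] V) (c : V →ₗ[ℝ] ℂ) : V →ₗ[ℝ] ℂ :=
  (1 / 2 : ℂ) • (c - Complex.I • (c ∘ₗ J))

/-- The conjugate of the `(0,1)`-part of a `1`-form. -/
def partZeroOne (J : V →ₗ[ℝ] V) (c : V →ₗ[ℝ] ℂ) : V →ₗ[ℝ] ℂ :=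
  partOneZero J (conjOne c)

theorem isOneZero_partOneZero (hJ : ∀ v, J (J v) = -v) (c : V →ₗ[ℝ] ℂ) :
    IsOneZero J (partOneZero J c) := by
  intro v
  simp [partOneZero, hJ]
  linear_combination ((1 / 2 : ℂ) * c (J v)) * Complex.I_sq

theorem eq_parts (J : V →ₗ[ℝ] V) (c : V →ₗ[ℝ] ℂ) :
    c = partOneZero J c + conjOne (partZeroOne J c) := by
  ext v
  simp [partOneZero, partZeroOne, conjOne_apply, Complex.conj_ofNat]
  ring

/-- A nonzero value of the determinant gives three vectors whose images span ℂ³ over ℂ. This yields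
surjectivity, and equality of real dimensions yields injectivity. -/
theorem isCoframe_of_wedgeOnes_ne_zero (hV : Module.finrank ℝ V = 6)
    {a : Fin 3 → (V →ₗ[ℝ] ℂ)} (ha : ∀ i, IsOneZero J (a i)) (h0 : wedgeOnes a ≠ 0) :
    IsCoframe J (LinearMap.pi a) := by
  have hfin : FiniteDimensional ℝ V := Module.finite_of_finrank_pos (by omega)
  have hlin : ∀ v, LinearMap.pi a (J v) = Complex.I • LinearMap.pi a v := fun v => by
    ext i
    simp [ha i v]
  obtain ⟨u, hu⟩ : ∃ u, wedgeOnes a u ≠ 0 := by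
    by_contra! h
    exact h0 (by ext u; exact h u)
  rw [wedgeOnes_apply] at hu
  set M : Matrix (Fin 3) (Fin 3) ℂ := Matrix.of fun i j => a i (u j)
  have hsurj : Function.Surjective (LinearMap.pi a) := by
    intro z
    obtain ⟨x, hx⟩ : ∃ x, M.mulVec x = z :=
      ⟨M⁻¹.mulVec z, by rw [Matrix.mulVec_mulVec, Matrix.mul_nonsing_inv _ hu.isUnit, Matrix.one_mulVec]⟩
    -- The combination with complex coefficients x_j, where i acts on `V` as `J`.
    refine ⟨∑ j, ((x j).re • u j + (x j).im • J (u j)), ?_⟩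
    rw [← hx]
    ext i
    simp only [LinearMap.pi_apply, map_sum, map_add, map_smul, Matrix.mulVec, dotProduct]
    refine Finset.sum_congr rfl fun j _ => ?_
    rw [ha i]
    simp only [M, Matrix.of_apply, Complex.real_smul]
    conv_rhs => rw [← Complex.re_add_im (x j)]
    ring
  refine ⟨⟨?_, hsurj⟩, hlin⟩
  rw [LinearMap.injective_iff_surjective_of_finrank_eq_finrank]
  · exact hsurj
  · rw [hV, Module.finrank_pi_fintype]
    simp [Complex.finrank_real_complex]

/-! ### Forms of type `(3,0)` -/

theorem IsCoframe.wedgeOnes_of_isOneZero (hα : IsCoframe J α) {a : Fin 3 → (V →ₗ[ℝ] ℂ)}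
    (ha : ∀ i, IsOneZero J (a i)) :
    wedgeOnes a = (Matrix.of fun i k => a i (hα.frame k)).det • wedgeOnes (comp α) := by
  rw [← wedgeOnes_sum_smul]
  congr 1
  funext i
  exact hα.eq_sum_of_isOneZero (ha i)

theorem IsCoframe.exists_eq_smul_of_mem_typeSpace (hα : IsCoframe J α)
    {ξ : V [⋀^Fin 3]→ₗ[ℝ] ℂ} (hξ : ξ ∈ typeSpace J 3 0) : ∃ f : ℂ, ξ = f • wedgeOnes (comp α) := by
  have : typeSpace J 3 0 ≤ Submodule.span ℂ {(wedgeOnes (comp α) : V [⋀^Fin 3]→ₗ[ℝ] ℂ)} := by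
    refine Submodule.span_le.2 ?_
    rintro _ ⟨a, b, ha, -, rfl⟩
    rw [append_three_zero, hα.wedgeOnes_of_isOneZero ha]
    exact Submodule.smul_mem _ _ (Submodule.mem_span_singleton_self _)
  obtain ⟨f, hf⟩ := Submodule.mem_span_singleton.1 (this hξ)
  exact ⟨f, hf.symm⟩

/-- If a nonzero (3,0)-form exists, some generator of the type space is nonzero, and its factors
form a coframe. -/
theorem exists_coframe_of_mem_typeSpace (hV : Module.finrank ℝ V = 6)
    {ξ : V [⋀^Fin 3]→ₗ[ℝ] ℂ} (hξ : ξ ∈ typeSpace J 3 0) (h0 : ξ ≠ 0) :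
    ∃ (α : V →ₗ[ℝ] (Fin 3 → ℂ)) (f : ℂ), IsCoframe J α ∧ f ≠ 0 ∧ ξ = f • wedgeOnes (comp α) := by
  by_contra! H
  have : typeSpace J 3 0 ≤ ⊥ := by
    refine Submodule.span_le.2 ?_
    rintro _ ⟨a, b, ha, -, rfl⟩
    rw [append_three_zero]
    by_contra h
    have hα := isCoframe_of_wedgeOnes_ne_zero hV ha h
    obtain ⟨f, hf⟩ := hα.exists_eq_smul_of_mem_typeSpace hξ
    exact H _ f hα (fun hf0 => h0 (by rw [hf, hf0, zero_smul])) hf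
  exact h0 (this hξ)

/-! ### Forms of type `(0,2)` -/

/-- The components of the `(0,2)`-part of a `2`-form. -/
def IsCoframe.coeff02 (hα : IsCoframe J α) (j : Fin 3) : (V [⋀^Fin 2]→ₗ[ℝ] ℂ) →ₗ[ℂ] ℂ :=
  typeEval J ![-1, -1] ![hα.frame (j + 1), hα.frame (j + 2)]

theorem typeEval_wedgeOnes_two (J : V →ₗ[ℝ] V) (s : Fin 2 → ℝ) (u : Fin 2 → V)
    (c d : V →ₗ[ℝ] ℂ) : typeEval J s u (wedgeOnes ![c, d]) =
      (c (u 0) - Complex.I * s 0 * c (J (u 0))) / 2 * ((d (u 1) - Complex.I * s 1 * d (J (u 1))) / 2) -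
      (c (u 1) - Complex.I * s 1 * c (J (u 1))) / 2 *
        ((d (u 0) - Complex.I * s 0 * d (J (u 0))) / 2) := by
  simp [typeEval_wedgeOnes, Matrix.det_fin_two]

/-- By linearity it suffices to treat products c ∧ d. Splitting both factors into types leaves one
term of type (0,2), which is the one that the coefficients `coeff02` reproduce. -/
theorem IsCoframe.sub_sum_coeff02_mem (hα : IsCoframe J α) (ξ : V [⋀^Fin 2]→ₗ[ℝ] ℂ) :
    ξ - ∑ j : Fin 3, hα.coeff02 j ξ • wedgeOnes ![conjOne (comp α (j + 1)),
      conjOne (comp α (j + 2))] ∈ typeSpace J 2 0 ⊔ typeSpace J 1 1 := by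
  have := hα.finiteDimensional
  have hξ : ξ ∈ Submodule.span ℂ (Set.range (wedgeOnes : (Fin 2 → (V →ₗ[ℝ] ℂ)) → _)) := by
    rw [span_range_wedgeOnes]; trivial
  induction hξ using Submodule.span_induction with
  | zero => simp
  | add x y _ _ hx hy =>
    have := Submodule.add_mem _ hx hy
    convert this using 1
    simp only [map_add, add_smul, Finset.sum_add_distrib]
    abel
  | smul c x _ hx =>
    have := Submodule.smul_mem _ c hx
    convert this using 1
    simp only [map_smul, smul_eq_mul, mul_smul, smul_sub, Finset.smul_sum]
  | mem x hx =>
    obtain ⟨c, rfl⟩ := hx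
    obtain ⟨c, d, rfl⟩ : ∃ a b, c = ![a, b] := ⟨c 0, c 1, by ext i; fin_cases i <;> rfl⟩
    have hc := isOneZero_partOneZero hα.J_J c
    have hc' : IsOneZero J (partZeroOne J c) := isOneZero_partOneZero hα.J_J (conjOne c)
    have hd := isOneZero_partOneZero hα.J_J d
    have hd' : IsOneZero J (partZeroOne J d) := isOneZero_partOneZero hα.J_J (conjOne d)
    have e1 : wedgeOnes ![c, d] = wedgeOnes ![partOneZero J c, partOneZero J d] +
        (wedgeOnes ![partOneZero J c, conjOne (partZeroOne J d)] -
          wedgeOnes ![partOneZero J d, conjOne (partZeroOne J c)]) +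
        wedgeOnes ![conjOne (partZeroOne J c), conjOne (partZeroOne J d)] := by
      conv_lhs => rw [eq_parts J c, eq_parts J d]
      ext u
      simp [wedgeOnes_apply, Matrix.det_fin_two]
      ring
    have e2 : ∑ j : Fin 3, hα.coeff02 j (wedgeOnes ![c, d]) •
        wedgeOnes ![conjOne (comp α (j + 1)), conjOne (comp α (j + 2))] =
        wedgeOnes ![conjOne (partZeroOne J c), conjOne (partZeroOne J d)] := by
      rw [hα.conjOne_eq_sum hc', hα.conjOne_eq_sum hd', wedgeOnes_two_expand]
      refine Finset.sum_congr rfl fun j _ => ?_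
      congr 1
      rw [IsCoframe.coeff02, typeEval_wedgeOnes_two]
      simp [partOneZero, partZeroOne, conjOne_apply, Complex.conj_ofNat]
      ring
    rw [e2, e1, add_sub_cancel_right]
    refine Submodule.add_mem_sup ?_ (Submodule.sub_mem _ ?_ ?_)
    · exact Submodule.subset_span ⟨![partOneZero J c, partOneZero J d], Fin.elim0,
        fun i => by fin_cases i <;> assumption, fun j => j.elim0, by rw [append_two_zero]; rfl⟩
    · exact Submodule.subset_span ⟨![partOneZero J c], ![partZeroOne J d],
        fun i => by fin_cases i; assumption, fun i => by fin_cases i; assumption,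
        by rw [append_one_one]; rfl⟩
    · exact Submodule.subset_span ⟨![partOneZero J d], ![partZeroOne J c],
        fun i => by fin_cases i; assumption, fun i => by fin_cases i; assumption,
        by rw [append_one_one]; rfl⟩

/-! ### Forms of type `(1,1)` -/

theorem IsCoframe.exists_eq_sum_of_mem_typeSpace_one_one (hα : IsCoframe J α)
    {ξ : V [⋀^Fin 2]→ₗ[ℝ] ℂ} (hξ : ξ ∈ typeSpace J 1 1) : ∃ Q : Matrix (Fin 3) (Fin 3) ℂ,
      ξ = ∑ j, ∑ k, Q j k • wedgeOnes ![comp α j, conjOne (comp α k)] := by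
  have : typeSpace J 1 1 ≤ Submodule.span ℂ (Set.range fun p : Fin 3 × Fin 3 =>
      wedgeOnes ![comp α p.1, conjOne (comp α p.2)]) := by
    refine Submodule.span_le.2 ?_
    rintro _ ⟨a, b, ha, hb, rfl⟩
    rw [append_one_one]
    have : wedgeOnes ![a 0, conjOne (b 0)] = ∑ p : Fin 3 × Fin 3,
        (a 0 (hα.frame p.1) * conj (b 0 (hα.frame p.2))) •
          wedgeOnes ![comp α p.1, conjOne (comp α p.2)] := by
      conv_lhs => rw [hα.conjOne_eq_sum (hb 0), hα.eq_sum_of_isOneZero (ha 0)]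
      rw [Fintype.sum_prod_type]
      ext u
      simp [wedgeOnes_apply, Matrix.det_fin_two, Fin.sum_univ_three]
      ring
    rw [this]
    exact Submodule.sum_mem _ fun p _ => Submodule.smul_mem _ _ (Submodule.subset_span ⟨p, rfl⟩)
  obtain ⟨q, hq⟩ := (Submodule.mem_span_range_iff_exists_fun ℂ).1 (this hξ)
  exact ⟨fun j k => q (j, k), by rw [← hq, Fintype.sum_prod_type]⟩

/-! ### Forms of type `(2,2)` -/

/-- The forms `α^{a+1} ∧ α^{a+2} ∧ conj(α^{b+1}) ∧ conj(α^{b+2})` spanning `A^{2,2}`. -/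
def basis22 (α : V →ₗ[ℝ] (Fin 3 → ℂ)) (a b : Fin 3) : V [⋀^Fin 4]→ₗ[ℝ] ℂ :=
  wedgeOnes ![comp α (a + 1), comp α (a + 2), conjOne (comp α (b + 1)), conjOne (comp α (b + 2))]

/-- The components of the `(2,2)`-part of a `4`-form. -/
def IsCoframe.coeff22 (hα : IsCoframe J α) (a b : Fin 3) : (V [⋀^Fin 4]→ₗ[ℝ] ℂ) →ₗ[ℂ] ℂ :=
  typeEval J ![1, 1, -1, -1]
    ![hα.frame (a + 1), hα.frame (a + 2), hα.frame (b + 1), hα.frame (b + 2)]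

theorem typeEval_wedgeOnes_four (J : V →ₗ[ℝ] V) (s : Fin 4 → ℝ) (u : Fin 4 → V)
    (c : Fin 4 → (V →ₗ[ℝ] ℂ)) (e : Matrix (Fin 4) (Fin 4) ℂ)
    (he : ∀ i j, (c i (u j) - Complex.I * s j * c i (J (u j))) / 2 = e i j) :
    typeEval J s u (wedgeOnes c) =
      (e 0 0 * e 1 1 - e 0 1 * e 1 0) * (e 2 2 * e 3 3 - e 2 3 * e 3 2) -
      (e 0 0 * e 1 2 - e 0 2 * e 1 0) * (e 2 1 * e 3 3 - e 2 3 * e 3 1) +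
      (e 0 0 * e 1 3 - e 0 3 * e 1 0) * (e 2 1 * e 3 2 - e 2 2 * e 3 1) +
      (e 0 1 * e 1 2 - e 0 2 * e 1 1) * (e 2 0 * e 3 3 - e 2 3 * e 3 0) -
      (e 0 1 * e 1 3 - e 0 3 * e 1 1) * (e 2 0 * e 3 2 - e 2 2 * e 3 0) +
      (e 0 2 * e 1 3 - e 0 3 * e 1 2) * (e 2 0 * e 3 1 - e 2 1 * e 3 0) := by
  rw [typeEval_wedgeOnes]
  have : (Matrix.of fun i j => (c i (u j) - Complex.I * s j * c i (J (u j))) / 2) = e := by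
    ext i j
    exact he i j
  rw [this]
  simp [Matrix.det_succ_row_zero, Fin.sum_univ_succ, Fin.succAbove]
  ring

/-- On two (1,0)- and two (0,1)-vectors the 4 × 4 determinant is block diagonal. -/
theorem IsCoframe.coeff22_wedgeOnes (hα : IsCoframe J α) (a b : Fin 3) {c d c' d' : V →ₗ[ℝ] ℂ}
    (hc : IsOneZero J c) (hd : IsOneZero J d) (hc' : IsOneZero J c') (hd' : IsOneZero J d') :
    hα.coeff22 a b (wedgeOnes ![c, d, conjOne c', conjOne d']) =
      (c (hα.frame (a + 1)) * d (hα.frame (a + 2)) - c (hα.frame (a + 2)) * d (hα.frame (a + 1))) *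
      conj (c' (hα.frame (b + 1)) * d' (hα.frame (b + 2)) -
        c' (hα.frame (b + 2)) * d' (hα.frame (b + 1))) := by
  rw [IsCoframe.coeff22, typeEval_wedgeOnes_four J _ _ _ _ fun i j => rfl]
  simp only [Matrix.cons_val, hc.typeEntry, hd.typeEntry, hc'.typeEntry_conjOne,
    hd'.typeEntry_conjOne]
  simp

theorem IsCoframe.eq_sum_coeff22 (hα : IsCoframe J α) {ξ : V [⋀^Fin 4]→ₗ[ℝ] ℂ}
    (hξ : ξ ∈ typeSpace J 2 2) : ξ = ∑ a, ∑ b, hα.coeff22 a b ξ • basis22 α a b := by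
  induction hξ using Submodule.span_induction with
  | zero => simp
  | add x y _ _ hx hy =>
    simp only [map_add, add_smul, Finset.sum_add_distrib]
    rw [← hx, ← hy]
  | smul c x _ hx =>
    simp only [map_smul, smul_eq_mul, mul_smul, ← Finset.smul_sum]
    rw [← hx]
  | mem x hx =>
    obtain ⟨a, b, ha, hb, rfl⟩ := hx
    rw [append_two_two]
    simp only [hα.coeff22_wedgeOnes _ _ (ha 0) (ha 1) (hb 0) (hb 1)]
    conv_lhs =>
      rw [hα.conjOne_eq_sum (hb 0), hα.conjOne_eq_sum (hb 1), hα.eq_sum_of_isOneZero (ha 0),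
        hα.eq_sum_of_isOneZero (ha 1), wedgeOnes_four_expand]
    refine Finset.sum_congr rfl fun i _ => ?_
    rw [wedgeOnes_four_swap, wedgeOnes_four_expand, Finset.smul_sum]
    refine Finset.sum_congr rfl fun j _ => ?_
    rw [wedgeOnes_four_swap, smul_smul, basis22]
    simp

theorem IsCoframe.coeff22_basis22 (hα : IsCoframe J α) (a b c d : Fin 3) :
    hα.coeff22 a b (basis22 α c d) = if a = c ∧ b = d then 1 else 0 := by
  rw [basis22, hα.coeff22_wedgeOnes _ _ (hα.comp_J _) (hα.comp_J _) (hα.comp_J _) (hα.comp_J _)]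
  simp only [hα.comp_frame]
  -- The 2 × 2 minor of the identity with rows j+1, j+2 and columns i+1, i+2, indices mod 3.
  have key : ∀ i j : Fin 3, ((if i + 1 = j + 1 then (1 : ℂ) else 0) *
      (if i + 2 = j + 2 then 1 else 0) - (if i + 1 = j + 2 then 1 else 0) *
      (if i + 2 = j + 1 then 1 else 0)) = if j = i then 1 else 0 := by
    intro i j
    fin_cases i <;> fin_cases j <;> simp +decide
  rw [key, key]
  by_cases h1 : a = c <;> by_cases h2 : b = d <;> simp [h1, h2]

end Coframe

end Coframes

/-! ### Signs and repeated factors in top-degree products -/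

section SixForms

variable {V : Type*} [AddCommGroup V] [Module ℝ V]

/-! ### Products of six `1`-forms -/

theorem wedgeOnes_comp_perm_of_even {k : ℕ} (c c' : Fin k → (V →ₗ[ℝ] ℂ))
    (σ : Equiv.Perm (Fin k)) (hσ : Equiv.Perm.sign σ = 1) (h : ∀ i, c' i = c (σ i)) :
    wedgeOnes c' = wedgeOnes c := by
  have h1 := (wedgeOnesAlt V k).map_perm c σ
  rw [hσ, one_smul] at h1
  rw [← wedgeOnesAlt_apply c, ← h1]
  congr 1
  exact funext h

theorem wedgeOnes_comp_perm_of_odd {k : ℕ} (c c' : Fin k → (V →ₗ[ℝ] ℂ))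
    (σ : Equiv.Perm (Fin k)) (hσ : Equiv.Perm.sign σ = -1) (h : ∀ i, c' i = c (σ i)) :
    wedgeOnes c' = -wedgeOnes c := by
  have h1 := (wedgeOnesAlt V k).map_perm c σ
  rw [hσ, Units.neg_smul, one_smul] at h1
  rw [← wedgeOnesAlt_apply c, ← h1]
  congr 1
  exact funext h

theorem wedgeOnes_eq_zero_of_eq {k : ℕ} (c : Fin k → (V →ₗ[ℝ] ℂ)) (i j : Fin k) (h : c i = c j)
    (hij : i ≠ j) : wedgeOnes c = 0 :=
  (wedgeOnesAlt V k).map_eq_zero_of_eq c h hij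

/-- The product `x₀ ∧ x₁ ∧ x₂ ∧ y₀ ∧ y₁ ∧ y₂`. -/
def sixForm (x y : Fin 3 → (V →ₗ[ℝ] ℂ)) : V [⋀^Fin 6]→ₗ[ℝ] ℂ :=
  wedgeOnes ![x 0, x 1, x 2, y 0, y 1, y 2]

theorem append_three_three {X : Type*} (a b : Fin 3 → X) :
    Fin.append a b = ![a 0, a 1, a 2, b 0, b 1, b 2] := by
  ext i
  fin_cases i <;> rfl

theorem sixForm_swap (x y : Fin 3 → (V →ₗ[ℝ] ℂ)) : sixForm y x = -sixForm x y :=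
  wedgeOnes_comp_perm_of_odd _ _
    ⟨![3, 4, 5, 0, 1, 2], ![3, 4, 5, 0, 1, 2], by decide, by decide⟩ (by decide)
    fun i => by fin_cases i <;> rfl

theorem sixForm_self (x : Fin 3 → (V →ₗ[ℝ] ℂ)) : sixForm x x = 0 :=
  wedgeOnes_eq_zero_of_eq _ 0 3 rfl (by decide)

/-- A cyclic shift of both triples is an even permutation. It lets an identity proved for index 0
serve for every index. -/
theorem sixForm_shift (x y : Fin 3 → (V →ₗ[ℝ] ℂ)) (a : Fin 3) :
    sixForm (fun i => x (i + a)) (fun i => y (i + a)) = sixForm x y := by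
  fin_cases a
  · exact congrArg wedgeOnes (by ext i; fin_cases i <;> rfl)
  · exact wedgeOnes_comp_perm_of_even _ _
      ⟨![1, 2, 0, 4, 5, 3], ![2, 0, 1, 5, 3, 4], by decide, by decide⟩ (by decide)
      fun i => by fin_cases i <;> rfl
  · exact wedgeOnes_comp_perm_of_even _ _
      ⟨![2, 0, 1, 5, 3, 4], ![1, 2, 0, 4, 5, 3], by decide, by decide⟩ (by decide)
      fun i => by fin_cases i <;> rfl

/-- Only the x₀-component of the last factor survives. Moving it past five factors gives the sign.
-/
theorem wedgeOnes_contraction_zero (x y : Fin 3 → (V →ₗ[ℝ] ℂ)) (p q : Fin 3 → ℂ) :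
    wedgeOnes ![x 1, x 2, y 0, y 1, y 2, ∑ k, p k • x k + ∑ k, q k • y k] =
      -p 0 • sixForm x y := by
  let C : Matrix (Fin 6) (Fin 6) ℂ := !![0, 1, 0, 0, 0, 0; 0, 0, 1, 0, 0, 0; 0, 0, 0, 1, 0, 0;
    0, 0, 0, 0, 1, 0; 0, 0, 0, 0, 0, 1; p 0, p 1, p 2, q 0, q 1, q 2]
  have h : ![x 1, x 2, y 0, y 1, y 2, ∑ k, p k • x k + ∑ k, q k • y k] =
      fun i => ∑ m : Fin 6, C i m • ![x 0, x 1, x 2, y 0, y 1, y 2] m := by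
    funext i
    fin_cases i <;> simp [C, Fin.sum_univ_succ, add_assoc]
  have hdet : C.det = -p 0 := by
    simp [C, Matrix.det_succ_row_zero, Fin.sum_univ_succ, Fin.succAbove]
  rw [h, wedgeOnes_sum_smul, hdet, sixForm]

theorem sum_shift {M : Type*} [AddCommMonoid M] (f : Fin 3 → M) (a : Fin 3) :
    ∑ k, f (k + a) = ∑ k, f k :=
  Fintype.sum_equiv (Equiv.addRight a) _ _ fun _ => rfl

theorem wedgeOnes_contraction (x y : Fin 3 → (V →ₗ[ℝ] ℂ)) (p q : Fin 3 → ℂ) (a : Fin 3) :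
    wedgeOnes ![x (a + 1), x (a + 2), y 0, y 1, y 2, ∑ k, p k • x k + ∑ k, q k • y k] =
      -p a • sixForm x y := by
  have h := wedgeOnes_contraction_zero (fun i => x (i + a)) (fun i => y (i + a))
    (fun i => p (i + a)) (fun i => q (i + a))
  rw [sixForm_shift, sum_shift (fun k => p k • x k), sum_shift (fun k => q k • y k), zero_add] at h
  rw [← h]
  generalize ∑ k, p k • x k + ∑ k, q k • y k = ζ
  fin_cases a
  · exact congrArg wedgeOnes (by ext i; fin_cases i <;> rfl)
  · exact wedgeOnes_comp_perm_of_even _ _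
      ⟨![0, 1, 4, 2, 3, 5], ![0, 1, 3, 4, 2, 5], by decide, by decide⟩ (by decide)
      fun i => by fin_cases i <;> rfl
  · exact wedgeOnes_comp_perm_of_even _ _
      ⟨![0, 1, 3, 4, 2, 5], ![0, 1, 4, 2, 3, 5], by decide, by decide⟩ (by decide)
      fun i => by fin_cases i <;> rfl

/-- If k ≠ a, then y_k already occurs among the last two factors. If k = a, the second factor can
only contribute its x_a-component. -/
theorem wedgeOnes_conj_pair (x y : Fin 3 → (V →ₗ[ℝ] ℂ)) (p q : Fin 3 → ℂ) (k a : Fin 3) :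
    wedgeOnes ![y k, ∑ k, p k • x k + ∑ k, q k • y k, x (a + 1), x (a + 2), y (a + 1), y (a + 2)] =
      if k = a then -p a • sixForm x y else 0 := by
  split_ifs with hka
  · subst hka
    have h := wedgeOnes_contraction_zero (fun i => x (i + k)) (fun i => y (i + k))
      (fun i => p (i + k)) (fun i => q (i + k))
    rw [sixForm_shift, sum_shift (fun k => p k • x k), sum_shift (fun k => q k • y k),
      zero_add] at h
    rw [← h]
    generalize ∑ k, p k • x k + ∑ k, q k • y k = ζ
    refine wedgeOnes_comp_perm_of_even _ _
      ⟨![2, 5, 0, 1, 3, 4], ![2, 3, 0, 4, 5, 1], by decide, by decide⟩ (by decide) fun i => ?_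
    fin_cases i
    · rfl
    · rfl
    · exact congrArg x (add_comm _ _)
    · exact congrArg x (add_comm _ _)
    · exact congrArg y (add_comm _ _)
    · exact congrArg y (add_comm _ _)
  · have : k = a + 1 ∨ k = a + 2 := by
      revert k a
      decide
    rcases this with rfl | rfl
    · exact wedgeOnes_eq_zero_of_eq _ 0 4 rfl (by decide)
    · exact wedgeOnes_eq_zero_of_eq _ 0 5 rfl (by decide)

/-- The previous identity with the two triples interchanged; the sign of `sixForm_swap` cancels the
minus sign. -/
theorem wedgeOnes_hol_pair (x y : Fin 3 → (V →ₗ[ℝ] ℂ)) (p q : Fin 3 → ℂ) (k a : Fin 3) :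
    wedgeOnes ![x k, ∑ k, p k • x k + ∑ k, q k • y k, x (a + 1), x (a + 2), y (a + 1), y (a + 2)] =
      if k = a then q a • sixForm x y else 0 := by
  have h := wedgeOnes_conj_pair y x q p k a
  rw [sixForm_swap, smul_neg, neg_smul, neg_neg, add_comm] at h
  rw [← h]
  exact wedgeOnes_comp_perm_of_even _ _
    ⟨![0, 1, 4, 5, 2, 3], ![0, 1, 4, 5, 2, 3], by decide, by decide⟩ (by decide)
    fun i => by fin_cases i <;> rfl

/-- A real-valued `1`-form as an alternating map. -/
def realOne (ζ : V →ₗ[ℝ] ℝ) : V [⋀^Fin 1]→ₗ[ℝ] ℝ :=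
  AlternatingMap.ofSubsingleton ℝ V ℝ (0 : Fin 1) ζ

theorem realOne_apply (ζ : V →ₗ[ℝ] ℝ) (u : Fin 1 → V) : realOne ζ u = ζ (u 0) := rfl

theorem complexify_realOne (ζ : V →ₗ[ℝ] ℝ) :
    complexify (realOne ζ) = wedgeOnes ![(Complex.ofRealCLM : ℝ →ₗ[ℝ] ℂ) ∘ₗ ζ] := by
  ext u
  simp [wedgeOnes_apply, complexify_apply, realOne_apply]

theorem complexify_curryLeft {k : ℕ} (ξ : V [⋀^Fin (k + 1)]→ₗ[ℝ] ℝ) (v : V) :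
    complexify (ξ.curryLeft v) = (complexify ξ).curryLeft v := rfl

theorem curryLeft_smul_complex {k : ℕ} (c : ℂ) (ξ : V [⋀^Fin (k + 1)]→ₗ[ℝ] ℂ) (v : V) :
    (c • ξ).curryLeft v = c • ξ.curryLeft v := rfl

theorem wedge_contraction (a b : Fin 3 → (V →ₗ[ℝ] ℂ)) (c : V →ₗ[ℝ] ℂ) (v : V) :
    (wedge (wedge ((wedgeOnes a).curryLeft v) (wedgeOnes b)) (wedgeOnes ![c]) :
        V [⋀^Fin 6]→ₗ[ℝ] ℂ) =
      ∑ i, a i v • wedgeOnes ![a (i + 1), a (i + 2), b 0, b 1, b 2, c] := by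
  rw [curryLeft_wedgeOnes_three, wedge_sum_left, wedge_sum_left]
  refine Finset.sum_congr rfl fun i _ => ?_
  rw [wedge_smul_left, wedge_smul_left, wedge_wedgeOnes, wedge_wedgeOnes]
  congr 2
  ext j
  fin_cases j <;> rfl

/-! ### Forms in the orbit `A³₊` -/

section Coframe

variable {J : V →ₗ[ℝ] V} {α : V →ₗ[ℝ] (Fin 3 → ℂ)}

/-- The conjugate coframe. -/
def conjComp (α : V →ₗ[ℝ] (Fin 3 → ℂ)) (i : Fin 3) : V →ₗ[ℝ] ℂ := conjOne (comp α i)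

theorem IsCoframe.exists_eq_sum (hα : IsCoframe J α) (c : V →ₗ[ℝ] ℂ) :
    ∃ p q : Fin 3 → ℂ, c = ∑ k, p k • comp α k + ∑ k, q k • conjComp α k := by
  refine ⟨_, _, (eq_parts J c).trans (congrArg₂ _
    (hα.eq_sum_of_isOneZero (isOneZero_partOneZero hα.J_J c))
    (hα.conjOne_eq_sum (isOneZero_partOneZero hα.J_J (conjOne c))))⟩

theorem IsCoframe.conjComp_J (hα : IsCoframe J α) (k : Fin 3) (v : V) :
    conjComp α k (J v) = -Complex.I * conjComp α k v := by
  rw [conjComp, conjOne_apply, hα.comp_J, map_mul, Complex.conj_I, conjOne_apply]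

/-- On the dual frame of (1,0)-vectors followed by their conjugates, the matrix of values is the
identity. -/
theorem IsCoframe.sixForm_ne_zero (hα : IsCoframe J α) :
    sixForm (comp α) (conjComp α) ≠ 0 := by
  intro h
  have h2 : typeEval J ![1, 1, 1, -1, -1, -1] ![hα.frame 0, hα.frame 1, hα.frame 2, hα.frame 0,
      hα.frame 1, hα.frame 2] (sixForm (comp α) (conjComp α)) = 1 := by
    rw [sixForm, typeEval_wedgeOnes]
    convert Matrix.det_one (n := Fin 6) (R := ℂ)
    ext i j
    have e1 := fun (a : Fin 3) (s : ℝ) (u : V) => (hα.comp_J a).typeEntry s u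
    have e2 := fun (a : Fin 3) (s : ℝ) (u : V) => (hα.comp_J a).typeEntry_conjOne s u
    rw [Matrix.of_apply]
    fin_cases i <;>
    · simp only [conjComp, Fin.mk_zero, Fin.mk_one, Fin.reduceFinMk,
        Matrix.cons_val, Matrix.cons_val_zero, Matrix.cons_val_one]
      simp only [e1, e2]
      fin_cases j <;> simp [hα.comp_frame]
  rw [h, map_zero] at h2
  exact zero_ne_one h2

end Coframe

end SixForms

/-! ### Identities recovering J and η from φ and dφ -/

section Associated

variable {V : Type*} [AddCommGroup V] [Module ℝ V] {J : V →ₗ[ℝ] V} {α : V →ₗ[ℝ] (Fin 3 → ℂ)}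
  {φ ψ : V [⋀^Fin 3]→ₗ[ℝ] ℝ} {c : ℂ}

theorem wedgeOnes_conjOne {k : ℕ} (c : Fin k → (V →ₗ[ℝ] ℂ)) (u : Fin k → V) :
    wedgeOnes (fun i => conjOne (c i)) u = conj (wedgeOnes c u) := by
  rw [wedgeOnes_apply, wedgeOnes_apply, RingHom.map_det]
  rfl

theorem complexify_re_part
    (h : complexify φ + Complex.I • complexify ψ = c • wedgeOnes (comp α)) :
    complexify φ = (1 / 2 : ℂ) • (c • wedgeOnes (comp α) + conj c • wedgeOnes (conjComp α)) := by
  ext u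
  have h1 := congrArg (fun F => F u) h
  have h2 := congrArg (starRingEnd ℂ) h1
  have h3 := wedgeOnes_conjOne (comp α) u
  simp only [AlternatingMap.add_apply, AlternatingMap.smul_apply, smul_eq_mul, map_add, map_mul,
    complexify_apply, Complex.conj_I, Complex.conj_ofReal, ← h3] at h1 h2 ⊢
  unfold conjComp
  rw [← h1, ← h2]
  ring

theorem complexify_im_part
    (h : complexify φ + Complex.I • complexify ψ = c • wedgeOnes (comp α)) :
    complexify ψ =
      (-Complex.I / 2 : ℂ) • (c • wedgeOnes (comp α) - conj c • wedgeOnes (conjComp α)) := by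
  ext u
  have h1 := congrArg (fun F => F u) h
  have h2 := congrArg (starRingEnd ℂ) h1
  have h3 := wedgeOnes_conjOne (comp α) u
  simp only [AlternatingMap.add_apply, AlternatingMap.sub_apply, AlternatingMap.smul_apply,
    smul_eq_mul, map_add, map_mul,
    complexify_apply, Complex.conj_I, Complex.conj_ofReal, ← h3] at h1 h2 ⊢
  unfold conjComp
  rw [← h1, ← h2]
  linear_combination (ψ u : ℂ) * Complex.I_sq

theorem wedge_eq_sixForm (x y : Fin 3 → (V →ₗ[ℝ] ℂ)) :
    wedge (wedgeOnes x) (wedgeOnes y) = sixForm x y := by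
  rw [wedge_wedgeOnes, append_three_three, sixForm]

/-- With Ω = c α¹ ∧ α² ∧ α³, both Ω ∧ Ω and its conjugate vanish, and the two mixed terms agree
because 3-forms anticommute. -/
theorem complexify_wedge_associated
    (h : complexify φ + Complex.I • complexify ψ = c • wedgeOnes (comp α)) :
    complexify (wedge φ ψ) =
      (Complex.I / 2 * (c * conj c)) • sixForm (comp α) (conjComp α) := by
  rw [complexify_wedge, complexify_re_part h, complexify_im_part h, sub_eq_add_neg, ← neg_smul]
  simp only [wedge_smul_left, wedge_smul_right, wedge_add_left, wedge_add_right, wedge_eq_sixForm,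
    sixForm_self, sixForm_swap (comp α) (conjComp α)]
  module

/-- The form `ζ ↦ ι_v φ ∧ φ ∧ ζ`, which determines the complex structure of `φ`. -/
def hitchinForm (φ : V [⋀^Fin 3]→ₗ[ℝ] ℝ) (v : V) (ζ : V →ₗ[ℝ] ℝ) : V [⋀^Fin 6]→ₗ[ℝ] ℝ :=
  wedge (wedge (φ.curryLeft v) φ) (realOne ζ)

/-- Each term of the contraction keeps two of the x_i, and these recur in the second factor. -/
theorem wedge_contraction_self (x y : Fin 3 → (V →ₗ[ℝ] ℂ)) (p q : Fin 3 → ℂ) (v : V) :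
    (wedge (wedge ((wedgeOnes x).curryLeft v) (wedgeOnes x))
      (wedgeOnes ![∑ k, p k • x k + ∑ k, q k • y k]) : V [⋀^Fin 6]→ₗ[ℝ] ℂ) = 0 := by
  rw [wedge_contraction]
  refine Finset.sum_eq_zero fun i _ => ?_
  have : wedgeOnes ![x (i + 1), x (i + 2), x 0, x 1, x 2,
      ∑ k, p k • x k + ∑ k, q k • y k] = 0 := by
    generalize ∑ k, p k • x k + ∑ k, q k • y k = ζ
    fin_cases i
    · exact wedgeOnes_eq_zero_of_eq _ 0 3 rfl (by decide)
    · exact wedgeOnes_eq_zero_of_eq _ 0 4 rfl (by decide)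
    · exact wedgeOnes_eq_zero_of_eq _ 0 2 rfl (by decide)
  rw [this, smul_zero]

theorem wedge_contraction_mixed (x y : Fin 3 → (V →ₗ[ℝ] ℂ)) (p q : Fin 3 → ℂ) (v : V) :
    (wedge (wedge ((wedgeOnes x).curryLeft v) (wedgeOnes y))
      (wedgeOnes ![∑ k, p k • x k + ∑ k, q k • y k]) : V [⋀^Fin 6]→ₗ[ℝ] ℂ) =
      -(∑ k, p k * x k v) • sixForm x y := by
  rw [wedge_contraction]
  simp only [wedgeOnes_contraction, smul_smul, ← Finset.sum_smul]
  congr 1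
  rw [← Finset.sum_neg_distrib]
  exact Finset.sum_congr rfl fun k _ => by ring

/-- Hitchin's identity: the left side depends on `φ` alone, so it determines J ⊗ (φ ∧ ψ). After
splitting φ into Ω and its conjugate, only the mixed products survive; these pick out the (1,0)- and
(0,1)-parts of ζ with opposite signs, which is ζ ∘ J up to a factor. -/
theorem IsCoframe.hitchinForm_eq (hα : IsCoframe J α)
    (h : complexify φ + Complex.I • complexify ψ = c • wedgeOnes (comp α))
    (v : V) (ζ : V →ₗ[ℝ] ℝ) : hitchinForm φ v ζ = (ζ (J v) / 2) • wedge φ ψ := by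
  apply complexify_injective
  obtain ⟨p, q, hpq⟩ := hα.exists_eq_sum ((Complex.ofRealCLM : ℝ →ₗ[ℝ] ℂ) ∘ₗ ζ)
  have hζ : (ζ (J v) : ℂ) = Complex.I * ∑ k, p k * comp α k v -
      Complex.I * ∑ k, q k * conjComp α k v := by
    have := congrArg (fun F => F (J v)) hpq
    simp only [LinearMap.add_apply, LinearMap.sum_apply, LinearMap.smul_apply, smul_eq_mul,
      hα.conjComp_J, (hα.comp_J _) v] at this
    refine this.trans ?_
    rw [sub_eq_add_neg, ← neg_mul, Finset.mul_sum, Finset.mul_sum]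
    congr 1 <;> exact Finset.sum_congr rfl fun k _ => by ring
  rw [complexify_smul, complexify_wedge_associated h, hitchinForm, complexify_wedge,
    complexify_wedge, complexify_curryLeft, complexify_realOne, complexify_re_part h]
  have e1 := wedge_contraction_self (comp α) (conjComp α) p q v
  have e2 := wedge_contraction_mixed (comp α) (conjComp α) p q v
  have e3 := wedge_contraction_self (conjComp α) (comp α) q p v
  have e4 := wedge_contraction_mixed (conjComp α) (comp α) q p v
  rw [← hpq.trans (add_comm _ _)] at e3 e4
  rw [← hpq] at e1 e2
  rw [curryLeft_smul_complex, AlternatingMap.curryLeft_add, LinearMap.add_apply,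
    curryLeft_smul_complex, curryLeft_smul_complex]
  simp only [wedge_smul_left, wedge_smul_right, wedge_add_left, wedge_add_right]
  rw [e1, e2, e3, e4, sixForm_swap (comp α) (conjComp α), Complex.ofReal_div, hζ]
  simp only [smul_neg, neg_smul, neg_neg, smul_zero, zero_add, add_zero, smul_add, smul_smul]
  rw [← neg_smul, ← add_smul]
  congr 1
  push_cast
  linear_combination (-(c * conj c) / 4 * (∑ k, p k * comp α k v) +
    (c * conj c) / 4 * (∑ k, q k * conjComp α k v)) * Complex.I_sq

/-! ### Squares of Hermitian forms -/

/-- The form `(i/2) ∑ ε_k x_k ∧ y_k`. -/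
def hermForm (x y : Fin 3 → (V →ₗ[ℝ] ℂ)) (ε : Fin 3 → ℂ) : V [⋀^Fin 2]→ₗ[ℝ] ℂ :=
  ∑ k, (Complex.I / 2 * ε k) • wedgeOnes ![x k, y k]

/-- The terms with equal indices vanish and the others occur in equal pairs. Each carries (i/2)² =
-1/4 and a further sign from moving x_k past y_j, so the factor 2 normalises the coefficients to the
cofactors of diag(ε). -/
theorem wedge_hermForm_self (x y : Fin 3 → (V →ₗ[ℝ] ℂ)) (ε : Fin 3 → ℂ) :
    (2 : ℂ) • (wedge (hermForm x y ε) (hermForm x y ε) : V [⋀^Fin 4]→ₗ[ℝ] ℂ) =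
      ∑ a, (ε (a + 1) * ε (a + 2)) •
        wedgeOnes ![x (a + 1), x (a + 2), y (a + 1), y (a + 2)] := by
  have h : (wedge (hermForm x y ε) (hermForm x y ε) : V [⋀^Fin 4]→ₗ[ℝ] ℂ) = ∑ j, ∑ k,
      (Complex.I / 2 * ε j * (Complex.I / 2 * ε k)) • wedgeOnes ![x j, y j, x k, y k] := by
    rw [hermForm]
    refine (wedge_sum_left _ _ _).trans (Finset.sum_congr rfl fun j _ => ?_)
    rw [wedge_sum_right]
    refine Finset.sum_congr rfl fun k _ => ?_
    rw [wedge_smul_left, wedge_smul_right, smul_smul]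
    congr 1
    exact (wedge_wedgeOnes _ _).trans (congrArg wedgeOnes (append_two_two _ _))
  have key : ∀ W : V [⋀^Fin 4]→ₗ[ℝ] ℂ, W = ∑ j, ∑ k,
      (Complex.I / 2 * ε j * (Complex.I / 2 * ε k)) • wedgeOnes ![x j, y j, x k, y k] →
      (2 : ℂ) • W = ∑ a, (ε (a + 1) * ε (a + 2)) •
        wedgeOnes ![x (a + 1), x (a + 2), y (a + 1), y (a + 2)] := by
    have hI : ∀ a b : ℂ, Complex.I / 2 * a * (Complex.I / 2 * b) = -(1 / 4) * (a * b) := fun a b => by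
      linear_combination (1 / 4 * (a * b)) * Complex.I_sq
    rintro _ rfl
    ext u
    simp only [AlternatingMap.add_apply, AlternatingMap.smul_apply, wedgeOnes_four_apply,
      smul_eq_mul, hI, Fin.sum_univ_three, show (1 : Fin 3) + 1 = 2 from rfl,
      show (1 : Fin 3) + 2 = 0 from rfl, show (2 : Fin 3) + 1 = 0 from rfl,
      show (2 : Fin 3) + 2 = 1 from rfl, zero_add]
    ring
  exact key _ h

/-- Each summand of ι_v η ∧ ζ meets exactly one summand of the 4-form, with coefficient ε_k δ_k = 1.
The weights therefore cancel and the rest adds up to ζ(v). -/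
theorem wedge_hermForm_contraction (x y : Fin 3 → (V →ₗ[ℝ] ℂ)) (ε : Fin 3 → ℂ)
    (p q : Fin 3 → ℂ) (ζ : V →ₗ[ℝ] ℂ) (hζ : ζ = ∑ k, p k • x k + ∑ k, q k • y k) (v : V)
    (δ : Fin 3 → ℂ) (hδ : ∀ k, ε k * δ k = 1) :
    (wedge (wedge ((hermForm x y ε).curryLeft v) (wedgeOnes ![ζ]))
      (∑ a, δ a • wedgeOnes ![x (a + 1), x (a + 2), y (a + 1), y (a + 2)]) :
        V [⋀^Fin 6]→ₗ[ℝ] ℂ) = (-(Complex.I / 2) * ζ v) • sixForm x y := by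
  have h1 : (hermForm x y ε).curryLeft v =
      ∑ k, (Complex.I / 2 * ε k) • (x k v • wedgeOnes ![y k] - y k v • wedgeOnes ![x k]) := by
    have : ∀ k, (wedgeOnes ![x k, y k]).curryLeft v =
      x k v • wedgeOnes ![y k] - y k v • wedgeOnes ![x k] := fun k =>
        curryLeft_wedgeOnes_two _ _ _
    simp only [← this]
    ext u
    simp [hermForm, alternatingMap_sum_apply]
  have hw : ∀ (b d e f g : V →ₗ[ℝ] ℂ),
      (wedge (wedge (wedgeOnes ![b]) (wedgeOnes ![ζ])) (wedgeOnes ![d, e, f, g]) :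
        V [⋀^Fin 6]→ₗ[ℝ] ℂ) = wedgeOnes ![b, ζ, d, e, f, g] := by
    intro b d e f g
    rw [wedge_wedgeOnes, wedge_wedgeOnes]
    congr 1
    ext i
    fin_cases i <;> rfl
  have h2 : ∀ k, (wedge (wedge ((Complex.I / 2 * ε k) • (x k v • wedgeOnes ![y k] -
      y k v • wedgeOnes ![x k])) (wedgeOnes ![ζ]))
      (∑ a, δ a • wedgeOnes ![x (a + 1), x (a + 2), y (a + 1), y (a + 2)]) :
        V [⋀^Fin 6]→ₗ[ℝ] ℂ) = (-(Complex.I / 2) * (p k * x k v + q k * y k v)) • sixForm x y := by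
    intro k
    rw [wedge_sum_right]
    have h3 : ∀ a, (wedge (wedge ((Complex.I / 2 * ε k) • (x k v • wedgeOnes ![y k] -
      y k v • wedgeOnes ![x k])) (wedgeOnes ![ζ]))
      (δ a • wedgeOnes ![x (a + 1), x (a + 2), y (a + 1), y (a + 2)]) :
        V [⋀^Fin 6]→ₗ[ℝ] ℂ) = if k = a then
          (-(Complex.I / 2) * (p k * x k v + q k * y k v)) • sixForm x y else 0 := by
      intro a
      rw [sub_eq_add_neg, ← neg_smul]
      rw [wedge_smul_left, wedge_smul_left, wedge_smul_right, wedge_add_left, wedge_add_left,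
        wedge_smul_left, wedge_smul_left, wedge_smul_left, wedge_smul_left, hw, hw, hζ,
        wedgeOnes_conj_pair, wedgeOnes_hol_pair]
      split_ifs with hka
      · subst hka
        simp only [smul_smul, ← add_smul]
        congr 1
        linear_combination (-(Complex.I / 2) * (p k * x k v + q k * y k v)) * hδ k
      · simp
    rw [Finset.sum_congr rfl fun a _ => h3 a, Finset.sum_ite_eq, if_pos (Finset.mem_univ k)]
  rw [h1, wedge_sum_left, wedge_sum_left, Finset.sum_congr rfl fun k _ => h2 k,
    ← Finset.sum_smul, ← Finset.mul_sum, hζ]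
  simp [Finset.sum_add_distrib]

theorem IsUnitaryCoframe.complexify_eq {ε : Fin 3 → ℝ} {η : V [⋀^Fin 2]→ₗ[ℝ] ℝ}
    (hα : IsUnitaryCoframe ε J η α) :
    complexify η = hermForm (comp α) (conjComp α) (fun k => (ε k : ℂ)) := hα.2

/-- The signs `ε_k` that are their own cofactors. -/
structure IsSelfCofactor (ε : Fin 3 → ℝ) : Prop where
  mul_succ : ∀ a, ε (a + 1) * ε (a + 2) = ε a
  sq : ∀ a, ε a * ε a = 1

theorem isSelfCofactor_sigDef : IsSelfCofactor sigDef :=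
  ⟨fun a => by fin_cases a <;> simp [sigDef], fun a => by fin_cases a <;> simp [sigDef]⟩

theorem isSelfCofactor_sigIndef : IsSelfCofactor sigIndef :=
  ⟨fun a => by fin_cases a <;> simp [sigIndef], fun a => by fin_cases a <;> simp [sigIndef]⟩

theorem IsUnitaryCoframe.complexify_two_smul_wedge {ε : Fin 3 → ℝ} (hε : IsSelfCofactor ε)
    {η : V [⋀^Fin 2]→ₗ[ℝ] ℝ} (hα : IsUnitaryCoframe ε J η α) :
    complexify ((2 : ℝ) • wedge η η) = ∑ a, (ε a : ℂ) • basis22 α a a := by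
  rw [complexify_smul, complexify_wedge, hα.complexify_eq, Complex.ofReal_ofNat,
    wedge_hermForm_self]
  refine Finset.sum_congr rfl fun a _ => ?_
  rw [← Complex.ofReal_mul, hε.mul_succ]
  rfl

/-- The form `ι_v η ∧ ζ ∧ π`. -/
def rootPairing (η : V [⋀^Fin 2]→ₗ[ℝ] ℝ) (π : V [⋀^Fin 4]→ₗ[ℝ] ℝ) (v : V) (ζ : V →ₗ[ℝ] ℝ) :
    V [⋀^Fin 6]→ₗ[ℝ] ℝ :=
  wedge (wedge (η.curryLeft v) (realOne ζ)) π

/-- The coefficients of 2η² are the ε_a, which are their own inverses, so the contraction identity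
applies with δ = ε. The factor |c|⁻² compares α¹ ∧ α² ∧ α³ and its conjugate with φ ∧ ψ. -/
theorem IsUnitaryCoframe.rootPairing_eq {ε : Fin 3 → ℝ} (hε : IsSelfCofactor ε)
    {η : V [⋀^Fin 2]→ₗ[ℝ] ℝ} (hα : IsUnitaryCoframe ε J η α) (hc : c ≠ 0)
    (h : complexify φ + Complex.I • complexify ψ = c • wedgeOnes (comp α)) (v : V)
    (ζ : V →ₗ[ℝ] ℝ) :
    rootPairing η ((2 : ℝ) • wedge η η) v ζ = (-(Complex.normSq c)⁻¹ * ζ v) • wedge φ ψ := by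
  apply complexify_injective
  obtain ⟨p, q, hpq⟩ := hα.1.exists_eq_sum ((Complex.ofRealCLM : ℝ →ₗ[ℝ] ℂ) ∘ₗ ζ)
  have e := wedge_hermForm_contraction (comp α) (conjComp α) (fun k => (ε k : ℂ)) p q _ hpq v
    (fun k => (ε k : ℂ)) (fun k => by rw [← Complex.ofReal_mul, hε.sq, Complex.ofReal_one])
  rw [complexify_smul, complexify_wedge_associated h, rootPairing, complexify_wedge,
    complexify_wedge, complexify_curryLeft, complexify_realOne,
    hα.complexify_two_smul_wedge hε, hα.complexify_eq]
  refine e.trans ?_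
  rw [smul_smul, Complex.mul_conj]
  congr 1
  have hc' : (Complex.normSq c : ℂ) ≠ 0 := by
    exact_mod_cast (Complex.normSq_pos.2 hc).ne'
  push_cast
  field_simp
  rfl

end Associated

/-! ### Matrices of Hermitian forms -/

section Matrices

open Matrix

open scoped ComplexOrder MatrixOrder Matrix.Norms.L2Operator in
/-- A matrix with positive Hermitian form is of the form `G Gᴴ`. -/
theorem exists_eq_mul_conjTranspose {P : Matrix (Fin 3) (Fin 3) ℂ}
    (hP : ∀ x : Fin 3 → ℂ, x ≠ 0 → ∃ r : ℝ, 0 < r ∧ ∑ a, ∑ b, P a b * x a * conj (x b) = r) :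
    ∃ G : Matrix (Fin 3) (Fin 3) ℂ, IsUnit G ∧ P = G * Gᴴ := by
  have hQ : ∀ x : Fin 3 → ℂ, (∑ a, ∑ b, P a b * x a * conj (x b)).im = 0 := by
    intro x
    by_cases hx : x = 0
    · simp [hx]
    · obtain ⟨r, -, hr⟩ := hP x hx
      rw [hr, Complex.ofReal_im]
  -- Polarization: the form is real on e_a + t e_b, and t = 0, 1, i then force P to be Hermitian.
  have hpol : ∀ (a b : Fin 3) (t : ℂ),
      (P a a + P a b * conj t + P b a * t + P b b * t * conj t).im = 0 := by
    intro a b t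
    rw [← hQ (Pi.single a 1 + Pi.single b t)]
    congr 1
    simp only [Pi.add_apply, Pi.single_apply, map_add, mul_add, add_mul, Finset.sum_add_distrib,
      apply_ite (starRingEnd ℂ), map_one, map_zero, mul_ite, ite_mul, mul_one, mul_zero, zero_mul,
      Finset.sum_ite_eq', Finset.mem_univ, if_true]
    simp [mul_assoc]
    ring
  have hherm : P.IsHermitian := by
    ext a b
    rw [conjTranspose_apply]
    have h1 := hpol a a 0
    have h2 := hpol b b 0
    have h3 := hpol a b 1
    have h4 := hpol a b Complex.I
    simp only [map_zero, map_one, mul_zero, add_zero, mul_one, Complex.conj_I, Complex.add_im,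
      Complex.mul_im, Complex.neg_im, Complex.neg_re, Complex.I_re, Complex.I_im, Complex.mul_re]
      at h1 h2 h3 h4
    refine Complex.ext ?_ ?_
    · simp only [Complex.star_def, Complex.conj_re]
      linarith
    · simp only [Complex.star_def, Complex.conj_im]
      linarith
  have hpos : P.PosDef := by
    refine PosDef.of_dotProduct_mulVec_pos hherm fun x hx => ?_
    -- The hypothesis concerns xᵀ P conj(x), while positive definiteness concerns conj(x)ᵀ P x.
    obtain ⟨r, hr, h⟩ := hP (star x) (by simpa using hx)
    have : star x ⬝ᵥ (P *ᵥ x) = r := by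
      rw [← h]
      simp only [dotProduct, mulVec, Finset.mul_sum]
      refine Finset.sum_congr rfl fun a _ => Finset.sum_congr rfl fun b _ => ?_
      simp only [Pi.star_apply, Complex.star_def, Complex.conj_conj]
      ring
    rw [this]
    exact_mod_cast hr
  obtain ⟨y, hy, rfl⟩ := CStarAlgebra.isStrictlyPositive_iff_eq_star_mul_self.mp
    hpos.isStrictlyPositive
  exact ⟨star y, hy.star, by rw [star_eq_conjTranspose, conjTranspose_conjTranspose]⟩

theorem adjugate_cyclic (h : Matrix (Fin 3) (Fin 3) ℂ) (a c : Fin 3) :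
    h.adjugate a c =
      h (c + 1) (a + 1) * h (c + 2) (a + 2) - h (c + 1) (a + 2) * h (c + 2) (a + 1) := by
  rw [adjugate_fin_three]
  fin_cases a <;> fin_cases c <;> simp <;> ring

/-- For 3 × 3 matrices adj(adj G) = det(G) G, and adj is homogeneous of degree 2; a square root of
det(G)⁻¹ corrects the scale. -/
theorem exists_adjugate_eq {G : Matrix (Fin 3) (Fin 3) ℂ} (hG : IsUnit G) :
    ∃ h : Matrix (Fin 3) (Fin 3) ℂ, IsUnit h ∧ h.adjugate = G := by
  have hdet : G.det ≠ 0 := ((isUnit_iff_isUnit_det G).1 hG).ne_zero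
  obtain ⟨r, hr⟩ := IsAlgClosed.exists_pow_nat_eq (G.det)⁻¹ (n := 2) two_pos
  have hadj : (r • G.adjugate).adjugate = G := by
    rw [adjugate_smul, adjugate_adjugate _ (by simp), smul_smul, Fintype.card_fin]
    norm_num
    rw [hr, inv_mul_cancel₀ hdet, one_smul]
  refine ⟨r • G.adjugate, ?_, hadj⟩
  rw [isUnit_iff_isUnit_det, isUnit_iff_ne_zero]
  intro h0
  have := congrArg det hadj
  rw [det_adjugate, h0] at this
  simp at this
  exact hdet this.symm

/-- A matrix proportional to one that is congruent to `diag(ε)` is in the `ρ`-orbit of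
`diag(ε)`. -/
theorem exists_rho_eq {h D N : Matrix (Fin 3) (Fin 3) ℂ} (hh : IsUnit h) {f : ℂ} (hf : f ≠ 0)
    (hN : f • N = h.adjugate * D * h.adjugateᴴ) : ∃ g : GL (Fin 3) ℂ, N = rho g D := by
  have hdet : h.det ≠ 0 := ((isUnit_iff_isUnit_det h).1 hh).ne_zero
  set k := h.adjugate with hk
  have hkdet : k.det ≠ 0 := by
    rw [hk, det_adjugate]
    exact pow_ne_zero _ hdet
  -- For g = t k, ρ(g)D is t conj(t)⁻² conj(det k)⁻¹ k D kᴴ, so t conj(t)⁻² must equal f⁻¹ conj(det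
  -- k). With t = (s conj(s)²)⁻¹ the left side is s³.
  obtain ⟨s, hs⟩ := IsAlgClosed.exists_pow_nat_eq (f⁻¹ * conj k.det) (n := 3) (by norm_num)
  have hs0 : s ≠ 0 := by
    rintro rfl
    have : f⁻¹ * conj k.det ≠ 0 := mul_ne_zero (inv_ne_zero hf) (by simpa using hkdet)
    exact this (by rw [← hs]; norm_num)
  have hcs : conj s ≠ 0 := by simpa using hs0
  let t : ℂ := (s * conj s ^ 2)⁻¹
  have ht : t ≠ 0 := inv_ne_zero (mul_ne_zero hs0 (pow_ne_zero _ hcs))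
  have htdet : (t • k).det ≠ 0 := by
    rw [det_smul]
    exact mul_ne_zero (pow_ne_zero _ ht) hkdet
  refine ⟨GeneralLinearGroup.mkOfDetNeZero (t • k) htdet, ?_⟩
  have hval : ((GeneralLinearGroup.mkOfDetNeZero (t • k) htdet : GL (Fin 3) ℂ) :
      Matrix (Fin 3) (Fin 3) ℂ) = t • k := rfl
  have hN' : N = f⁻¹ • (k * D * kᴴ) := by rw [← hN, smul_smul, inv_mul_cancel₀ hf, one_smul]
  rw [rho, hval, conjTranspose_smul, Matrix.smul_mul, Matrix.smul_mul, Matrix.mul_smul, smul_smul,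
    smul_smul, hN',
    det_smul, Fintype.card_fin]
  congr 1
  have hkc : conj k.det ≠ 0 := by simpa using hkdet
  have hs' : f⁻¹ = s ^ 3 * (conj k.det)⁻¹ := by rw [hs, mul_assoc, mul_inv_cancel₀ hkc, mul_one]
  rw [hs']
  simp only [t, map_mul, map_pow, map_inv₀, Complex.conj_conj, Complex.star_def]
  field_simp

end Matrices

/-! ### Pointwise existence of unitary coframes and square roots -/

section Pointwise

variable {V : Type*} [AddCommGroup V] [Module ℝ V] {J : V →ₗ[ℝ] V} {α : V →ₗ[ℝ] (Fin 3 → ℂ)}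

/-! ### Change of coframe -/

/-- The coframe `h α`. -/
def mulCoframe (h : Matrix (Fin 3) (Fin 3) ℂ) (α : V →ₗ[ℝ] (Fin 3 → ℂ)) :
    V →ₗ[ℝ] (Fin 3 → ℂ) :=
  (Matrix.toLin' h).restrictScalars ℝ ∘ₗ α

theorem mulCoframe_apply (h : Matrix (Fin 3) (Fin 3) ℂ) (v : V) (i : Fin 3) :
    mulCoframe h α v i = ∑ k, h i k * α v k := rfl

theorem IsCoframe.mulCoframe (hα : IsCoframe J α) {h : Matrix (Fin 3) (Fin 3) ℂ}
    (hh : IsUnit h) : IsCoframe J (mulCoframe h α) := by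
  refine ⟨?_, fun v => ?_⟩
  · exact Function.Bijective.comp (g := h.mulVec)
      ⟨Matrix.mulVec_injective_iff_isUnit.2 hh, Matrix.mulVec_surjective_iff_isUnit.2 hh⟩ hα.1
  · ext i
    simp only [mulCoframe_apply, hα.2, Pi.smul_apply, smul_eq_mul, Finset.mul_sum]
    exact Finset.sum_congr rfl fun k _ => by ring

theorem IsCoframe.exists_eq_mulCoframe (hα : IsCoframe J α) {β : V →ₗ[ℝ] (Fin 3 → ℂ)}
    (hβ : IsCoframe J β) : ∃ h : Matrix (Fin 3) (Fin 3) ℂ, IsUnit h ∧ β = QuasiInt.mulCoframe h α := by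
  have key : β = QuasiInt.mulCoframe (Matrix.of fun i k => comp β i (hα.frame k)) α := by
    ext v i
    have h1 := congrArg (fun F => F v) (hα.eq_sum_of_isOneZero (hβ.comp_J i))
    simpa [mulCoframe_apply, comp_apply] using h1
  refine ⟨_, ?_, key⟩
  rw [← Matrix.mulVec_surjective_iff_isUnit]
  intro z
  obtain ⟨v, hv⟩ := hβ.1.2 z
  refine ⟨α v, ?_⟩
  rw [← hv]
  conv_rhs => rw [key]
  rfl

/-- The 2 × 2 minors of the change of coframe are the entries of its adjugate, so (2,2)-coefficients
transform by congruence with adj(h). -/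
theorem IsCoframe.coeff22_sum_basis22 (hα : IsCoframe J α) {h : Matrix (Fin 3) (Fin 3) ℂ}
    (hβ : IsCoframe J (QuasiInt.mulCoframe h α)) (ε : Fin 3 → ℝ) (a b : Fin 3) :
    hα.coeff22 a b (∑ c, (ε c : ℂ) • basis22 (QuasiInt.mulCoframe h α) c c) =
      (h.adjugate * diagMat ε * h.adjugate.conjTranspose) a b := by
  have hf : ∀ i k, comp (QuasiInt.mulCoframe h α) i (hα.frame k) = h i k := by
    intro i k
    rw [comp_apply, mulCoframe_apply, hα.apply_frame]
    simp [Pi.single_apply]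
  rw [map_sum, Matrix.mul_apply]
  refine Finset.sum_congr rfl fun c _ => ?_
  rw [map_smul, basis22, hα.coeff22_wedgeOnes _ _ (hβ.comp_J _) (hβ.comp_J _) (hβ.comp_J _)
    (hβ.comp_J _), hf, hf, hf, hf, hf, hf, hf, hf, diagMat, Matrix.mul_diagonal,
    Matrix.conjTranspose_apply, adjugate_cyclic, adjugate_cyclic, smul_eq_mul, Complex.star_def]
  rw [mul_comm (h (c + 1) (a + 2)), mul_comm (h (c + 1) (b + 2))]
  ring

theorem IsCoframe.basis22_mem (hα : IsCoframe J α) (a b : Fin 3) :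
    basis22 α a b ∈ typeSpace J 2 2 :=
  Submodule.subset_span ⟨![comp α (a + 1), comp α (a + 2)], ![comp α (b + 1), comp α (b + 2)],
    fun i => by fin_cases i <;> exact hα.comp_J _, fun i => by fin_cases i <;> exact hα.comp_J _,
    by rw [append_two_two]; rfl⟩

theorem IsCoframe.eq_of_coeff22_eq (hα : IsCoframe J α) {ξ ζ : V [⋀^Fin 4]→ₗ[ℝ] ℂ}
    (hξ : ξ ∈ typeSpace J 2 2) (hζ : ζ ∈ typeSpace J 2 2)
    (h : ∀ a b, hα.coeff22 a b ξ = hα.coeff22 a b ζ) : ξ = ζ := by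
  rw [hα.eq_sum_coeff22 hξ, hα.eq_sum_coeff22 hζ]
  simp only [h]

theorem IsUnitaryCoframe.isReal11 {ε : Fin 3 → ℝ} {η : V [⋀^Fin 2]→ₗ[ℝ] ℝ}
    (hα : IsUnitaryCoframe ε J η α) : IsReal11 J η := by
  rw [IsReal11, hα.2]
  refine Submodule.sum_mem _ fun k _ => Submodule.smul_mem _ _ (Submodule.subset_span
    ⟨![comp α k], ![comp α k], fun i => ?_, fun i => ?_, by rw [append_one_one]; rfl⟩) <;>
  · fin_cases i
    exact hα.1.comp_J k

/-! ### Positive forms -/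

theorem wedgeOnes_two_apply_J {c d : V →ₗ[ℝ] ℂ} (hc : IsOneZero J c) (hd : IsOneZero J d) (u : V) :
    wedgeOnes ![c, conjOne d] ![u, J u] = -2 * Complex.I * (c u * conj (d u)) := by
  simp [wedgeOnes_apply, Matrix.det_fin_two, conjOne_apply, hc u, hd u]
  ring

/-- The form (i/2) ∑ ε_k β^k ∧ conj(β^k) equals its conjugate, so it is the complexification of its
real part. -/
theorem exists_unit_coefficients (hα : IsCoframe J α) {h : Matrix (Fin 3) (Fin 3) ℂ}
    (hh : IsUnit h) (ε : Fin 3 → ℝ) : ∃ η : V [⋀^Fin 2]→ₗ[ℝ] ℝ,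
      IsUnitaryCoframe ε J η (mulCoframe h α) := by
  have hβ := hα.mulCoframe hh
  set β := mulCoframe h α
  let H : V [⋀^Fin 2]→ₗ[ℝ] ℂ :=
    ∑ k, (Complex.I / 2 * (ε k : ℂ)) • wedgeOnes ![comp β k, conjOne (comp β k)]
  refine ⟨(Complex.reCLM : ℂ →ₗ[ℝ] ℝ).compAlternatingMap H, hβ, ?_⟩
  ext u
  have him : conj (H u) = H u := by
    simp only [H, alternatingMap_sum_apply, map_sum]
    refine Finset.sum_congr rfl fun k _ => ?_
    simp [wedgeOnes_apply, Matrix.det_fin_two, conjOne_apply, Complex.conj_ofNat]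
    ring
  exact Complex.conj_eq_iff_re.1 him

theorem IsUnitaryCoframe.isPos11 {η : V [⋀^Fin 2]→ₗ[ℝ] ℝ} (hα : IsUnitaryCoframe sigDef J η α) :
    IsPos11 J η := by
  refine ⟨hα.isReal11, fun u hu => ?_⟩
  have h1 := congrArg (fun F => F ![u, J u]) hα.2
  have h2 : ∀ k, wedgeOnes ![comp α k, conjOne (comp α k)] ![u, J u] =
      -2 * Complex.I * (Complex.normSq (comp α k u) : ℂ) := fun k => by
    rw [wedgeOnes_two_apply_J (hα.1.comp_J k) (hα.1.comp_J k), Complex.mul_conj]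
  have h3 : η ![u, J u] = ∑ k, Complex.normSq (comp α k u) := by
    have : (η ![u, J u] : ℂ) = ((∑ k, Complex.normSq (comp α k u) : ℝ) : ℂ) := by
      refine h1.trans ?_
      simp only [alternatingMap_sum_apply, AlternatingMap.smul_apply, h2, Complex.ofReal_sum]
      refine Finset.sum_congr rfl fun k _ => ?_
      have : sigDef k = 1 := by fin_cases k <;> rfl
      rw [this, smul_eq_mul, Complex.ofReal_one]
      linear_combination (-(Complex.normSq (comp α k u) : ℂ)) * Complex.I_sq
    exact_mod_cast this
  rw [h3]
  obtain ⟨k, hk⟩ : ∃ k, comp α k u ≠ 0 := by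
    by_contra! h
    exact hu (hα.1.1.1 ((funext h : α u = 0).trans (map_zero α).symm))
  exact Finset.sum_pos' (fun k _ => Complex.normSq_nonneg _)
    ⟨k, Finset.mem_univ k, Complex.normSq_pos.2 hk⟩

theorem IsCoframe.exists_unitary_of_isPos11 (hα : IsCoframe J α) {η : V [⋀^Fin 2]→ₗ[ℝ] ℝ}
    (hη : IsPos11 J η) : ∃ β, IsUnitaryCoframe sigDef J η β := by
  obtain ⟨Q, hQ⟩ := hα.exists_eq_sum_of_mem_typeSpace_one_one hη.1
  have hval : ∀ u, (η ![u, J u] : ℂ) =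
      ∑ a, ∑ b, ((-2 * Complex.I) • Q) a b * α u a * conj (α u b) := by
    intro u
    have h1 := congrArg (fun F => F ![u, J u]) hQ
    refine h1.trans ?_
    simp only [alternatingMap_sum_apply, AlternatingMap.smul_apply,
      wedgeOnes_two_apply_J (hα.comp_J _) (hα.comp_J _)]
    refine Finset.sum_congr rfl fun a _ => Finset.sum_congr rfl fun b _ => ?_
    simp only [comp_apply, smul_eq_mul, Matrix.smul_apply]
    ring
  obtain ⟨G, hG, hGQ⟩ := exists_eq_mul_conjTranspose (P := (-2 * Complex.I) • Q) fun x hx => by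
    obtain ⟨u, rfl⟩ := hα.1.2 x
    refine ⟨η ![u, J u], hη.2 u ?_, (hval u).symm⟩
    rintro rfl
    exact hx (map_zero α)
  -- Expanding the form with G Gᴴ groups it as ∑_l |∑_j G_{jl} α^j|², so the new coframe uses the
  -- transpose of G.
  have hGt : IsUnit G.transpose := by rwa [Matrix.isUnit_transpose]
  refine ⟨_, hα.mulCoframe hGt, ?_⟩
  rw [hQ]
  ext u
  simp only [alternatingMap_sum_apply, AlternatingMap.smul_apply]
  have hQ' : ∀ j k, Q j k = Complex.I / 2 * ∑ l, G j l * conj (G k l) := by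
    intro j k
    have := congrFun (congrFun hGQ j) k
    rw [Matrix.mul_apply] at this
    simp only [Matrix.conjTranspose_apply, Complex.star_def, Matrix.smul_apply, smul_eq_mul] at this
    rw [← this]
    linear_combination (Q j k) * Complex.I_sq
  have hs : ∀ k, sigDef k = 1 := fun k => by fin_cases k <;> rfl
  simp only [hQ', hs, wedgeOnes_apply, Matrix.det_fin_two, comp_apply, conjOne_apply,
    mulCoframe_apply, Matrix.of_apply, Matrix.cons_val_zero, Matrix.cons_val_one, smul_eq_mul,
    Fin.sum_univ_three, map_add, map_mul, Matrix.transpose_apply, Complex.ofReal_one]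
  ring

/-- The components of the cross product of two vectors of `ℂ³`. -/
def crossCoeff (z w : Fin 3 → ℂ) (a : Fin 3) : ℂ := z (a + 1) * w (a + 2) - z (a + 2) * w (a + 1)

/-- The values of a (2,2)-form on complex 2-planes involve only cross products. Since these exhaust
the nonzero vectors of ℂ³, positivity on planes is positivity of the whole coefficient matrix. -/
theorem exists_crossCoeff_eq {c : Fin 3 → ℂ} (hc : c ≠ 0) : ∃ z w, crossCoeff z w = c := by
  obtain ⟨k, hk⟩ := Function.ne_iff.1 hc
  rw [Pi.zero_apply] at hk
  fin_cases k
  · refine ⟨![-c 1, c 0, 0], ![-c 2 / c 0, 0, 1], ?_⟩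
    ext a
    fin_cases a <;> simp [crossCoeff] at hk ⊢
    field_simp
  · refine ⟨![0, -c 2, c 1], ![1, -c 0 / c 1, 0], ?_⟩
    ext a
    fin_cases a <;> simp [crossCoeff] at hk ⊢
    field_simp
  · refine ⟨![c 2, 0, -c 0], ![0, 1, -c 1 / c 2], ?_⟩
    ext a
    fin_cases a <;> simp [crossCoeff] at hk ⊢
    field_simp

theorem IsCoframe.linearIndependent_of_crossCoeff (hα : IsCoframe J α) {u v : V}
    (h : crossCoeff (α u) (α v) ≠ 0) : LinearIndependent ℝ ![u, J u, v, J v] := by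
  rw [Fintype.linearIndependent_iff]
  intro g hg
  simp only [Fin.sum_univ_four, Matrix.cons_val] at hg
  have h1 := congrArg α hg
  simp only [map_add, map_smul, hα.2, map_zero] at h1
  obtain ⟨a, ha⟩ := Function.ne_iff.1 h
  rw [Pi.zero_apply, crossCoeff] at ha
  have e1 := congrFun h1 (a + 1)
  have e2 := congrFun h1 (a + 2)
  simp only [Pi.add_apply, Pi.smul_apply, Complex.real_smul, smul_eq_mul, Pi.zero_apply] at e1 e2
  have hz : (g 0 + g 1 * Complex.I : ℂ) = 0 := by
    refine (mul_eq_zero.1 ?_).resolve_right ha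
    linear_combination α v (a + 2) * e1 - α v (a + 1) * e2
  have hw : (g 2 + g 3 * Complex.I : ℂ) = 0 := by
    refine (mul_eq_zero.1 ?_).resolve_right ha
    linear_combination α u (a + 1) * e2 - α u (a + 2) * e1
  have r0 := congrArg Complex.re hz
  have r1 := congrArg Complex.im hz
  have r2 := congrArg Complex.re hw
  have r3 := congrArg Complex.im hw
  simp at r0 r1 r2 r3
  intro i
  fin_cases i <;> assumption

theorem IsCoframe.basis22_apply_J (hα : IsCoframe J α) (a b : Fin 3) (u v : V) :
    basis22 α a b ![u, J u, v, J v] =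
      4 * (crossCoeff (α u) (α v) a * conj (crossCoeff (α u) (α v) b)) := by
  rw [basis22, wedgeOnes_four_apply]
  simp only [Matrix.cons_val, comp_apply, conjOne_apply, hα.2, crossCoeff, Pi.smul_apply,
    smul_eq_mul, map_mul, Complex.conj_I, map_sub]
  ring_nf
  simp only [Complex.I_sq]
  ring

/-- The coefficient matrix of π is positive definite, so it is G Gᴴ. Writing G = adj(h), the coframe
hα is unitary for a form whose doubled square has the same coefficients. -/
theorem IsCoframe.exists_unitary_of_isPos22 (hα : IsCoframe J α) {π : V [⋀^Fin 4]→ₗ[ℝ] ℝ}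
    (hπ : IsPos22 J π) : ∃ η β, IsUnitaryCoframe sigDef J η β ∧ π = (2 : ℝ) • wedge η η := by
  have hval : ∀ u v, (π ![u, J u, v, J v] : ℂ) = ∑ a, ∑ b,
      4 * hα.coeff22 a b (complexify π) * crossCoeff (α u) (α v) a *
        conj (crossCoeff (α u) (α v) b) := by
    intro u v
    have h1 := congrArg (fun F => F ![u, J u, v, J v]) (hα.eq_sum_coeff22 hπ.1)
    refine h1.trans ?_
    simp only [alternatingMap_sum_apply, AlternatingMap.smul_apply, hα.basis22_apply_J]
    refine Finset.sum_congr rfl fun a _ => Finset.sum_congr rfl fun b _ => ?_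
    rw [smul_eq_mul]
    ring
  obtain ⟨G, hG, hGP⟩ := exists_eq_mul_conjTranspose
    (P := Matrix.of fun a b => hα.coeff22 a b (complexify π)) fun x hx => by
      obtain ⟨z, w, hzw⟩ := exists_crossCoeff_eq hx
      obtain ⟨u, rfl⟩ := hα.1.2 z
      obtain ⟨v, rfl⟩ := hα.1.2 w
      refine ⟨π ![u, J u, v, J v] / 4, div_pos (hπ.2 u v (hα.linearIndependent_of_crossCoeff
        (by rwa [hzw]))) (by norm_num), ?_⟩
      rw [Complex.ofReal_div, hval, hzw, Finset.sum_div]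
      refine Finset.sum_congr rfl fun a _ => ?_
      rw [Finset.sum_div]
      refine Finset.sum_congr rfl fun b _ => ?_
      rw [Matrix.of_apply]
      push_cast
      ring
  obtain ⟨h, hh, hhG⟩ := exists_adjugate_eq hG
  obtain ⟨η, hη⟩ := exists_unit_coefficients hα hh sigDef
  refine ⟨η, _, hη, complexify_injective ?_⟩
  refine hα.eq_of_coeff22_eq hπ.1 ?_ fun a b => ?_
  · rw [hη.complexify_two_smul_wedge isSelfCofactor_sigDef]
    exact Submodule.sum_mem _ fun a _ => Submodule.smul_mem _ _ (hη.1.basis22_mem a a)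
  · have h1 : diagMat sigDef = 1 := by
      have hs : ∀ k, sigDef k = 1 := fun k => by fin_cases k <;> rfl
      simp [diagMat, hs]
    rw [hη.complexify_two_smul_wedge isSelfCofactor_sigDef, hα.coeff22_sum_basis22 hη.1, hhG, h1,
      Matrix.mul_one, ← hGP, Matrix.of_apply]

theorem IsHerm12Square.exists_unitary {π : V [⋀^Fin 4]→ₗ[ℝ] ℝ} (hπ : IsHerm12Square J π) :
    ∃ η β, IsUnitaryCoframe sigIndef J η β ∧ π = (2 : ℝ) • wedge η η := by
  obtain ⟨ξ, ⟨-, α, hα⟩, rfl⟩ := hπ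
  -- Scaling the coframe by 1/√2 replaces ξ by ξ/2, and 2 (ξ/2)² = ξ²/2.
  let r : ℝ := (Real.sqrt 2)⁻¹
  have hr : r * r = 1 / 2 := by
    simp only [r]
    rw [← mul_inv, Real.mul_self_sqrt (by norm_num)]
    norm_num
  have hr0 : r ≠ 0 := by
    rintro h
    rw [h] at hr
    norm_num at hr
  have hh : IsUnit ((r : ℂ) • (1 : Matrix (Fin 3) (Fin 3) ℂ)) := by
    rw [Matrix.isUnit_iff_isUnit_det, Matrix.det_smul, Matrix.det_one, mul_one]
    exact (isUnit_iff_ne_zero.2 (by exact_mod_cast hr0)).pow _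
  obtain ⟨β, hβ, hc⟩ : ∃ β, IsCoframe J β ∧ ∀ k, comp β k = (r : ℂ) • comp α k := by
    refine ⟨_, hα.1.mulCoframe hh, fun k => ?_⟩
    ext v
    simp [comp_apply, mulCoframe_apply, Matrix.one_apply]
  refine ⟨(1 / 2 : ℝ) • ξ, β, ⟨hβ, ?_⟩, ?_⟩
  · rw [complexify_smul, hα.2, Finset.smul_sum]
    refine Finset.sum_congr rfl fun k _ => ?_
    ext u
    have hr' : (r : ℂ) * r = 1 / 2 := by
      rw [← Complex.ofReal_mul, hr]
      norm_num
    simp [hc, wedgeOnes_apply, Matrix.det_fin_two, conjOne_apply]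
    linear_combination (-(Complex.I / 2 * (sigIndef k) * ((comp α k) (u 0) *
      conj (comp α k (u 1)) - comp α k (u 1) * conj (comp α k (u 0))))) * hr'
  · rw [wedge_smul_left, wedge_smul_right, smul_smul, smul_smul]
    norm_num

end Pointwise

/-! ### Existence of ∗φ and J; (2,2)-parts of derivatives -/

section AssociatedExistence

variable {V : Type*} [AddCommGroup V] [Module ℝ V] {J : V →ₗ[ℝ] V} {α : V →ₗ[ℝ] (Fin 3 → ℂ)}
  {φ ψ : V [⋀^Fin 3]→ₗ[ℝ] ℝ} {c : ℂ}

/-! ### The associated form and complex structure -/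

theorem isPlusForm_of_forall_eq_re (z : V ≃ₗ[ℝ] (Fin 3 → ℂ)) (w : ℂˣ)
    (h : ∀ u, φ u =
      ((w : ℂ) ^ 3 * wedgeOnes (comp (z : V →ₗ[ℝ] (Fin 3 → ℂ))) u).re) : IsPlusForm φ := by
  refine ⟨z.trans (DistribMulAction.toLinearEquiv ℝ (Fin 3 → ℂ) w), fun u => ?_⟩
  rw [h]
  congr 1
  have : (fun i => comp ((z.trans (DistribMulAction.toLinearEquiv ℝ (Fin 3 → ℂ) w) :
      V ≃ₗ[ℝ] (Fin 3 → ℂ)) : V →ₗ[ℝ] (Fin 3 → ℂ)) i) =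
      fun i => ∑ m, ((w : ℂ) • (1 : Matrix (Fin 3) (Fin 3) ℂ)) i m •
        comp (z : V →ₗ[ℝ] (Fin 3 → ℂ)) m := by
    funext i
    ext v
    simp [comp_apply, Matrix.one_apply, Units.smul_def]
  rw [this, wedgeOnes_sum_smul]
  simp

theorem wedge_ne_zero_of_coframe (hα : IsCoframe J α) (hc : c ≠ 0)
    (h : complexify φ + Complex.I • complexify ψ = c • wedgeOnes (comp α)) : wedge φ ψ ≠ 0 := by
  intro h0
  have h1 := complexify_wedge_associated h
  rw [h0] at h1
  have h2 : complexify (0 : V [⋀^Fin (3 + 3)]→ₗ[ℝ] ℝ) = 0 := by ext u; simp [complexify_apply]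
  rw [h2] at h1
  refine (smul_ne_zero ?_ hα.sixForm_ne_zero) h1.symm
  exact mul_ne_zero (by simp) (mul_ne_zero hc (by simpa using hc))

/-- The imaginary part of the model (3,0)-form and the standard complex structure satisfy everything
except perhaps the orientation. If the orientation is wrong, both are negated, which replaces the
coframe by its conjugate. -/
theorem exists_isAssociated (hV : Module.finrank ℝ V = 6) (o : Orientation ℝ V (Fin 6))
    (hφ : IsPlusForm φ) : ∃ ψ J, IsAssociated o φ ψ J := by
  have hfin : FiniteDimensional ℝ V := Module.finite_of_finrank_pos (by omega)
  obtain ⟨z, hz⟩ := hφ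
  let α : V →ₗ[ℝ] (Fin 3 → ℂ) := z
  let J : V →ₗ[ℝ] V := (z.symm : (Fin 3 → ℂ) →ₗ[ℝ] V) ∘ₗ
    (DistribMulAction.toLinearEquiv ℝ (Fin 3 → ℂ) (Units.mk0 Complex.I Complex.I_ne_zero) :
      (Fin 3 → ℂ) →ₗ[ℝ] (Fin 3 → ℂ)) ∘ₗ α
  have hα : IsCoframe J α := ⟨z.bijective, fun v => by simp [α, J, Units.smul_def]⟩
  let ψ : V [⋀^Fin 3]→ₗ[ℝ] ℝ :=
    (Complex.imCLM : ℂ →ₗ[ℝ] ℝ).compAlternatingMap (wedgeOnes (comp α))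
  have hψ : ∀ u, ψ u = (wedgeOnes (comp α) u).im := fun u => rfl
  have h : complexify φ + Complex.I • complexify ψ = (1 : ℂ) • wedgeOnes (comp α) := by
    ext u
    simp only [AlternatingMap.add_apply, AlternatingMap.smul_apply, complexify_apply, hz, hψ,
      smul_eq_mul, one_mul]
    rw [mul_comm]
    exact Complex.re_add_im _
  have hne := wedge_ne_zero_of_coframe hα one_ne_zero h
  rcases Orientation.eq_or_eq_neg (rayOfNeZero ℝ (wedge φ ψ) hne : Orientation ℝ V (Fin 6)) o
    (by simp [hV]) with ho | ho
  · refine ⟨ψ, J, ⟨?_, hα.J_J, ⟨hne, ho⟩, ?_⟩⟩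
    -- Since i³ = -i, multiplying the coframe by i turns the real part into the imaginary part.
    · refine isPlusForm_of_forall_eq_re z (Units.mk0 Complex.I Complex.I_ne_zero) fun u => ?_
      rw [hψ]
      simp [α, pow_succ]
    · rw [h]
      exact Submodule.smul_mem _ _ (Submodule.subset_span
        ⟨comp α, Fin.elim0, hα.comp_J, fun j => j.elim0, by rw [append_three_zero]⟩)
  · refine ⟨-ψ, -J, ⟨?_, fun v => by simp [hα.J_J], ?_, ?_⟩⟩
    · refine isPlusForm_of_forall_eq_re z (Units.mk0 (-Complex.I) (neg_ne_zero.2 Complex.I_ne_zero))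
        fun u => ?_
      rw [AlternatingMap.neg_apply, hψ]
      simp [α, pow_succ]
    · have hneg : wedge φ (-ψ) = -wedge φ ψ := by
        have := wedge_smul_right (-1 : ℝ) φ ψ
        exact (congrArg (wedge φ) (neg_one_smul ℝ ψ)).symm.trans
          (this.trans (neg_one_smul ℝ (wedge φ ψ)))
      have hne' : wedge φ (-ψ) ≠ 0 := by rw [hneg]; exact neg_ne_zero.2 hne
      refine ⟨hne', ?_⟩
      have h3 : rayOfNeZero ℝ (wedge φ (-ψ)) hne' =
          -(rayOfNeZero ℝ (wedge φ ψ) hne) := by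
        rw [neg_rayOfNeZero]
        congr 1
      rw [h3]
      exact (congrArg Neg.neg ho).trans (neg_neg o)
    · have h4 : complexify φ + Complex.I • complexify (-ψ) = wedgeOnes (conjComp α) := by
        ext u
        have h5 := congrArg (starRingEnd ℂ) (congrArg (fun F => F u) h)
        have h6 := wedgeOnes_conjOne (comp α) u
        simp only [AlternatingMap.add_apply, AlternatingMap.smul_apply, complexify_apply, one_mul,
          smul_eq_mul, map_add, map_mul, Complex.conj_ofReal, Complex.conj_I, ← h6,
          AlternatingMap.neg_apply, Complex.ofReal_neg] at h5 ⊢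
        rw [neg_mul] at h5
        rw [mul_neg]
        exact h5
      rw [h4]
      refine Submodule.subset_span
        ⟨conjComp α, Fin.elim0, fun i v => ?_, fun j => j.elim0, by rw [append_three_zero]⟩
      rw [LinearMap.neg_apply, map_neg, hα.conjComp_J]
      ring

theorem IsAssociated.exists_coframe (hV : Module.finrank ℝ V = 6) {o : Orientation ℝ V (Fin 6)}
    (h : IsAssociated o φ ψ J) : ∃ (α : V →ₗ[ℝ] (Fin 3 → ℂ)) (f : ℂ), IsCoframe J α ∧ f ≠ 0 ∧
      complexify φ + Complex.I • complexify ψ = f • wedgeOnes (comp α) := by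
  refine exists_coframe_of_mem_typeSpace hV h.type30 fun h0 => ?_
  obtain ⟨hne, -⟩ := h.pos
  apply hne
  have : φ = 0 := by
    ext u
    have h1 := congrArg Complex.re (congrArg (fun F => F u) h0)
    simpa [complexify_apply] using h1
  rw [this]
  have := wedge_smul_left (0 : ℝ) (0 : V [⋀^Fin 3]→ₗ[ℝ] ℝ) ψ
  rwa [zero_smul, zero_smul] at this

theorem IsCoframe.exists_eq_smul_of_associated (hα : IsCoframe J α) {o : Orientation ℝ V (Fin 6)}
    (h : IsAssociated o φ ψ J) : ∃ f : ℂ, f ≠ 0 ∧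
      complexify φ + Complex.I • complexify ψ = f • wedgeOnes (comp α) := by
  have hfr : Module.finrank ℝ V = 6 := by
    rw [(LinearEquiv.ofBijective α hα.1).finrank_eq, Module.finrank_pi_fintype]
    simp [Complex.finrank_real_complex]
  obtain ⟨β, g, -, hg, hβ⟩ := h.exists_coframe hfr
  obtain ⟨f, hf⟩ := hα.exists_eq_smul_of_mem_typeSpace h.type30
  refine ⟨f, ?_, hf⟩
  rintro rfl
  have h1 := complexify_wedge_associated hf
  obtain ⟨hne, -⟩ := h.pos
  apply hne
  apply complexify_injective
  rw [h1]
  ext u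
  simp [complexify_apply]

/-- `∗φ = -φ(J ·, ·, ·)`. -/
theorem IsCoframe.star_eq (hα : IsCoframe J α)
    (h : complexify φ + Complex.I • complexify ψ = c • wedgeOnes (comp α)) (u v w : V) :
    ψ ![u, v, w] = -φ ![J u, v, w] := by
  have h1 := congrArg (fun F => F ![u, v, w]) h
  have h2 := congrArg (fun F => F ![J u, v, w]) h
  have h3 : wedgeOnes (comp α) ![J u, v, w] =
      Complex.I * wedgeOnes (comp α) ![u, v, w] := by
    simp [wedgeOnes_apply, Matrix.det_fin_three, (hα.comp_J _) u]
    ring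
  simp only [AlternatingMap.add_apply, AlternatingMap.smul_apply, complexify_apply,
    smul_eq_mul, h3] at h1 h2
  have h4 : (φ ![J u, v, w] + Complex.I * ψ ![J u, v, w] : ℂ) =
      Complex.I * (φ ![u, v, w] + Complex.I * ψ ![u, v, w]) := by
    rw [h1, h2]
    ring
  have h5 := congrArg Complex.re h4
  simp at h5
  linarith

/-! ### The exterior derivative of a closed associated form -/

/-- The difference D - π is real but equals the (3,1)-form conj(β) ∧ Ω, so it must vanish. -/
theorem IsCoframe.eq_of_complexify_eq (hα : IsCoframe J α) {D π : V [⋀^Fin 4]→ₗ[ℝ] ℝ}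
    {β : V →ₗ[ℝ] ℂ} (hβ : IsOneZero J β) (hc : c ≠ 0)
    (h : complexify D = (wedge (wedgeOnes ![conjOne β]) (c • wedgeOnes (comp α)) :
      V [⋀^Fin 4]→ₗ[ℝ] ℂ) + complexify π) : D = π := by
  have hw : (wedge (wedgeOnes ![conjOne β]) (c • wedgeOnes (comp α)) : V [⋀^Fin 4]→ₗ[ℝ] ℂ) =
      c • wedgeOnes ![conjOne β, comp α 0, comp α 1, comp α 2] := by
    rw [wedge_smul_right, wedge_wedgeOnes]
    congr 2
    ext i
    fin_cases i <;> rfl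
  rw [hw, ← sub_eq_iff_eq_add, ← complexify_sub] at h
  have hβ0 : β = 0 := by
    rw [hα.eq_sum_of_isOneZero hβ]
    refine Finset.sum_eq_zero fun b _ => ?_
    -- Types (0,1),(1,0)³ read off c conj(β(e_b)). The conjugate types give 0, and reality makes the
    -- two values conjugate.
    have h1 := congrArg (typeEval J ![-1, 1, 1, 1] ![hα.frame b, hα.frame 0, hα.frame 1,
      hα.frame 2]) h
    have h2 := congrArg (typeEval J (-![-1, 1, 1, 1]) ![hα.frame b, hα.frame 0, hα.frame 1,
      hα.frame 2]) h
    have e1 : typeEval J ![-1, 1, 1, 1] ![hα.frame b, hα.frame 0, hα.frame 1, hα.frame 2]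
        (wedgeOnes ![conjOne β, comp α 0, comp α 1, comp α 2]) = conj (β (hα.frame b)) := by
      rw [typeEval_wedgeOnes_four J _ _ _ _ fun i j => rfl]
      simp only [Matrix.cons_val, hβ.typeEntry_conjOne, (hα.comp_J _).typeEntry]
      simp [hα.comp_frame]
    have e2 : typeEval J (-![-1, 1, 1, 1]) ![hα.frame b, hα.frame 0, hα.frame 1, hα.frame 2]
        (wedgeOnes ![conjOne β, comp α 0, comp α 1, comp α 2]) = 0 := by
      rw [typeEval_wedgeOnes_four J _ _ _ _ fun i j => rfl]
      simp only [Matrix.cons_val, Pi.neg_apply, hβ.typeEntry_conjOne, (hα.comp_J _).typeEntry]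
      simp [hα.comp_frame]
    rw [← conj_typeEval_complexify, h1, LinearMap.map_smul, LinearMap.map_smul, e1, e2] at h2
    have h3 : β (hα.frame b) = 0 := by
      simpa [hc] using h2
    rw [h3, zero_smul]
  rw [hβ0] at h
  have h5 : D - π = 0 := by
    apply complexify_injective
    rw [h]
    ext u
    simp [complexify_apply, wedgeOnes_four_apply, conjOne_apply]
  exact sub_eq_zero.1 h5

/-- The `(2,2)`-part of `d(f α¹ ∧ α² ∧ α³)`, where `df = f'` and `dα^i = ∑ p_m ∧ q_{mi}`. -/
theorem IsCoframe.coeff22_deriv (hα : IsCoframe J α) {ι : Type*} [Fintype ι] (f : ℂ)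
    (f' : V →ₗ[ℝ] ℂ) (p : ι → (V →ₗ[ℝ] ℂ)) (q : ι → Fin 3 → (V →ₗ[ℝ] ℂ)) (a b : Fin 3) :
    hα.coeff22 a b (wedgeOnes ![f', comp α 0, comp α 1, comp α 2] + f • ∑ m,
      (wedgeOnes ![p m, q m 0, comp α 1, comp α 2] + wedgeOnes ![p m, comp α 0, q m 1, comp α 2] +
        wedgeOnes ![p m, comp α 0, comp α 1, q m 2])) =
      f * hα.coeff02 b (∑ m, wedgeOnes ![p m, q m a]) := by
  -- The term df ∧ α¹ ∧ α² ∧ α³ has three factors of type (1,0), hence no (2,2)-part.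
  have h0 : hα.coeff22 a b (wedgeOnes ![f', comp α 0, comp α 1, comp α 2]) = 0 := by
    rw [IsCoframe.coeff22, typeEval_wedgeOnes_four J _ _ _ _ fun i j => rfl]
    simp only [Matrix.cons_val, (hα.comp_J _).typeEntry]
    simp [hα.comp_frame]
  rw [map_add, h0, zero_add, map_smul, smul_eq_mul, map_sum, map_sum]
  congr 1
  refine Finset.sum_congr rfl fun m _ => ?_
  rw [map_add, map_add, IsCoframe.coeff22, IsCoframe.coeff02, typeEval_wedgeOnes_two,
    typeEval_wedgeOnes_four J _ _ _ _ fun i j => rfl,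
    typeEval_wedgeOnes_four J _ _ _ _ fun i j => rfl,
    typeEval_wedgeOnes_four J _ _ _ _ fun i j => rfl]
  simp only [Matrix.cons_val, (hα.comp_J _).typeEntry]
  fin_cases a <;> simp [hα.comp_frame] <;> ring

end AssociatedExistence

/-! ### Smoothness of the induced structures in a chart -/

section Calculus

/-- The standard basis. -/
def stdBasis : Module.Basis (Fin 6) ℝ E6 := (EuclideanSpace.basisFun (Fin 6) ℝ).toBasis

variable {E G : Type*} [NormedAddCommGroup E] [NormedSpace ℝ E] [NormedAddCommGroup G]
  [NormedSpace ℝ G] {n : WithTop ℕ∞} {y₀ : E} {k : ℕ}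

theorem contDiffAt_apply {ξ : E → E6 [⋀^Fin k]→L[ℝ] G} (h : ContDiffAt ℝ n ξ y₀)
    (u : Fin k → E6) : ContDiffAt ℝ n (fun y => ξ y u) y₀ :=
  (ContinuousAlternatingMap.apply ℝ E6 G u).contDiff.contDiffAt.comp y₀ h

/-- A form depends linearly on its values at tuples of basis vectors: the evaluation map is
injective and so has a linear left inverse, continuous in finite dimension. -/
theorem contDiffAt_of_apply [FiniteDimensional ℝ G] {ξ : E → E6 [⋀^Fin k]→L[ℝ] G}
    (h : ∀ v : Fin k → Fin 6, ContDiffAt ℝ n (fun y => ξ y fun i => stdBasis (v i)) y₀) :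
    ContDiffAt ℝ n ξ y₀ := by
  let T : (E6 [⋀^Fin k]→L[ℝ] G) →ₗ[ℝ] ((Fin k → Fin 6) → G) :=
    LinearMap.pi fun v => (ContinuousAlternatingMap.apply ℝ E6 G fun i => stdBasis (v i) :
      (E6 [⋀^Fin k]→L[ℝ] G) →ₗ[ℝ] G)
  have hT : T.ker = ⊥ := by
    refine LinearMap.ker_eq_bot.2 fun a b hab => ?_
    refine ContinuousAlternatingMap.toAlternatingMap_injective ?_
    exact Module.Basis.ext_alternating stdBasis fun v _ => congrFun hab v
  obtain ⟨L, hL⟩ := LinearMap.exists_leftInverse_of_injective T hT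
  have h1 : ContDiffAt ℝ n (fun y => T (ξ y)) y₀ := contDiffAt_pi.2 h
  have h2 : ξ = fun y => L.toContinuousLinearMap (T (ξ y)) := by
    ext1 y
    exact (congrArg (fun F => F (ξ y)) hL).symm
  rw [h2]
  exact L.toContinuousLinearMap.contDiff.contDiffAt.comp y₀ h1

theorem contDiffAt_clm_of_apply [FiniteDimensional ℝ G] {A : E → E6 →L[ℝ] G}
    (h : ∀ i, ContDiffAt ℝ n (fun y => A y (stdBasis i)) y₀) : ContDiffAt ℝ n A y₀ := by
  let T : (E6 →L[ℝ] G) →ₗ[ℝ] (Fin 6 → G) :=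
    LinearMap.pi fun i => (ContinuousLinearMap.apply ℝ G (stdBasis i) :
      (E6 →L[ℝ] G) →ₗ[ℝ] G)
  have hT : T.ker = ⊥ := by
    refine LinearMap.ker_eq_bot.2 fun a b hab => ?_
    refine ContinuousLinearMap.coe_injective ?_
    exact Module.Basis.ext stdBasis fun v => congrFun hab v
  obtain ⟨L, hL⟩ := LinearMap.exists_leftInverse_of_injective T hT
  have h1 : ContDiffAt ℝ n (fun y => T (A y)) y₀ := contDiffAt_pi.2 h
  have h2 : A = fun y => L.toContinuousLinearMap (T (A y)) := by
    ext1 y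
    exact (congrArg (fun F => F (A y)) hL).symm
  rw [h2]
  exact L.toContinuousLinearMap.contDiff.contDiffAt.comp y₀ h1

theorem contDiffAt_wedge {p q : ℕ} {a : E → E6 [⋀^Fin p]→ₗ[ℝ] ℝ} {b : E → E6 [⋀^Fin q]→ₗ[ℝ] ℝ}
    (ha : ∀ u, ContDiffAt ℝ n (fun y => a y u) y₀) (hb : ∀ u, ContDiffAt ℝ n (fun y => b y u) y₀)
    (u : Fin (p + q) → E6) : ContDiffAt ℝ n (fun y => wedge (a y) (b y) u) y₀ := by
  have h : (fun y => wedge (a y) (b y) u) = fun y => ((p.factorial * q.factorial : ℕ) : ℝ)⁻¹ *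
      ∑ s : Equiv.Perm (Fin (p + q)), ((Equiv.Perm.sign s : ℤ) : ℝ) *
        (a y (fun i => u (s (Fin.castAdd q i))) * b y (fun j => u (s (Fin.natAdd p j)))) := by
    ext1 y
    have h1 := wedge_apply (a y) (b y) u
    rw [nsmul_eq_mul] at h1
    rw [eq_inv_mul_iff_mul_eq₀ (by positivity), h1]
    refine Finset.sum_congr rfl fun s _ => ?_
    rw [Units.smul_def, zsmul_eq_mul]
  rw [h]
  exact contDiffAt_const.mul (ContDiffAt.sum fun s _ =>
    contDiffAt_const.mul ((ha _).mul (hb _)))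

theorem contDiffAt_det {m : ℕ} {A : E → Matrix (Fin m) (Fin m) ℝ}
    (h : ∀ i j, ContDiffAt ℝ n (fun y => A y i j) y₀) :
    ContDiffAt ℝ n (fun y => (A y).det) y₀ := by
  simp only [Matrix.det_apply, Units.smul_def, zsmul_eq_mul]
  exact ContDiffAt.sum fun s _ => contDiffAt_const.mul (contDiffAt_prod fun i _ => h _ _)

theorem contDiffAt_matrix_inv {m : ℕ} {A : E → Matrix (Fin m) (Fin m) ℝ}
    (h : ∀ i j, ContDiffAt ℝ n (fun y => A y i j) y₀) (h0 : (A y₀).det ≠ 0) (i j : Fin m) :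
    ContDiffAt ℝ n (fun y => (A y)⁻¹ i j) y₀ := by
  simp only [Matrix.inv_def, Matrix.smul_apply, Matrix.adjugate_apply, Ring.inverse_eq_inv',
    smul_eq_mul]
  refine ((contDiffAt_det h).inv h0).mul (contDiffAt_det fun a b => ?_)
  simp only [Matrix.updateRow_apply]
  split_ifs
  · exact contDiffAt_const
  · exact h a b

/-- Here s = ±1 is the constant sign of m, so m = s √(m²) with m² nonzero. -/
theorem contDiffAt_of_sq {m : E → ℝ} {s : ℝ} (hs : s * s = 1)
    (h : ContDiffAt ℝ n (fun y => m y * m y) y₀) (hm : ∀ᶠ y in 𝓝 y₀, 0 < s * m y) :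
    ContDiffAt ℝ n m y₀ := by
  have h0 : m y₀ * m y₀ ≠ 0 := by
    have := hm.self_of_nhds
    intro h0
    rw [mul_self_eq_zero.1 h0, mul_zero] at this
    exact lt_irrefl _ this
  refine (contDiffAt_const.mul (h.sqrt h0) : ContDiffAt ℝ n (fun y => s * √(m y * m y)) y₀)
    |>.congr_of_eventuallyEq ?_
  filter_upwards [hm] with y hy
  have : m y * m y = (s * m y) * (s * m y) := by
    rw [mul_mul_mul_comm, hs, one_mul]
  rw [this, Real.sqrt_mul_self hy.le, ← mul_assoc, hs, one_mul]

end Calculus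

/-! ### Smoothness of J and ∗φ -/

section Calculus

variable {E : Type*} [NormedAddCommGroup E] [NormedSpace ℝ E] {n : WithTop ℕ∞} {y₀ : E}
  {φ ψ : E → E6 [⋀^Fin 3]→L[ℝ] ℝ} {J : E → E6 →L[ℝ] E6} {s : ℝ}

theorem contDiffAt_curryLeft {k : ℕ} {ξ : E → E6 [⋀^Fin (k + 1)]→L[ℝ] ℝ}
    (h : ContDiffAt ℝ n ξ y₀) (v : E6) (u : Fin k → E6) :
    ContDiffAt ℝ n (fun y => (ξ y).toAlternatingMap.curryLeft v u) y₀ :=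
  contDiffAt_apply h (Matrix.vecCons v u)

set_option maxRecDepth 4000 in
theorem contDiffAt_hitchinForm (hφ : ContDiffAt ℝ n φ y₀) (v : E6) (ζ : E6 →ₗ[ℝ] ℝ)
    (u : Fin 6 → E6) :
    ContDiffAt ℝ n (fun y => hitchinForm (φ y).toAlternatingMap v ζ u) y₀ := by
  have h1 := fun u => contDiffAt_wedge (p := 2) (q := 3)
    (b := fun y => (φ y).toAlternatingMap) (contDiffAt_curryLeft hφ v) (contDiffAt_apply hφ) u
  have h2 := contDiffAt_wedge (p := 5) (q := 1) (b := fun _ => realOne ζ) h1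
    (fun u => contDiffAt_const)
  have h3 : (fun y => hitchinForm (φ y).toAlternatingMap v ζ u) = fun y =>
      wedge (p := 5) (q := 1) (wedge (p := 2) (q := 3) ((φ y).toAlternatingMap.curryLeft v)
        (φ y).toAlternatingMap) (realOne ζ) u := by
    ext1 y
    rfl
  rw [h3]
  exact h2 u

theorem map_eq_sum_coord {W : Type*} [AddCommGroup W] [Module ℝ W] (A : E6 →ₗ[ℝ] W) (v : E6) :
    A v = ∑ j, stdBasis.coord j v • A (stdBasis j) := by
  conv_lhs => rw [← stdBasis.sum_repr v]
  rw [map_sum]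
  exact Finset.sum_congr rfl fun j _ => map_smul _ _ _

/-- The value of `φ ∧ ψ` at the standard basis. -/
def wedgeVol (φ ψ : E6 [⋀^Fin 3]→L[ℝ] ℝ) : ℝ :=
  wedge φ.toAlternatingMap ψ.toAlternatingMap stdBasis

/-- The Hitchin form gives the products ζ(Jv)·vol as smooth functions. First vol² is isolated using
J² = -1, then vol by its sign, and finally J by division. -/
theorem contDiffAt_wedgeVol (hs : s * s = 1) (hφ : ContDiffAt ℝ n φ y₀)
    (h : ∀ᶠ y in 𝓝 y₀, ∃ (α : E6 →ₗ[ℝ] (Fin 3 → ℂ)) (c : ℂ), IsCoframe (J y : E6 →ₗ[ℝ] E6) α ∧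
      complexify (φ y).toAlternatingMap + Complex.I • complexify (ψ y).toAlternatingMap =
        c • wedgeOnes (comp α))
    (hpos : ∀ᶠ y in 𝓝 y₀, 0 < s * wedgeVol (φ y) (ψ y)) :
    ContDiffAt ℝ n (fun y => wedgeVol (φ y) (ψ y)) y₀ ∧
      ∀ v (ζ : E6 →ₗ[ℝ] ℝ), ContDiffAt ℝ n (fun y => ζ (J y v)) y₀ := by
  let K : E → E6 → (E6 →ₗ[ℝ] ℝ) → ℝ := fun y v ζ =>
    2 * hitchinForm (φ y).toAlternatingMap v ζ stdBasis
  have hK : ∀ v ζ, ContDiffAt ℝ n (fun y => K y v ζ) y₀ := fun v ζ =>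
    contDiffAt_const.mul (contDiffAt_hitchinForm hφ v ζ stdBasis)
  have hKJ : ∀ᶠ y in 𝓝 y₀, ∀ v ζ, K y v ζ = ζ (J y v) * wedgeVol (φ y) (ψ y) := by
    filter_upwards [h] with y ⟨α, c, hα, hc⟩ v ζ
    have := congrArg (fun F => F stdBasis) (hα.hitchinForm_eq hc v ζ)
    simp only [AlternatingMap.smul_apply, smul_eq_mul] at this
    change 2 * hitchinForm (φ y).toAlternatingMap v ζ stdBasis = _
    rw [this]
    change 2 * (ζ (J y v) / 2 * wedgeVol (φ y) (ψ y)) = _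
    ring
  -- The (0,0)-entry of J² = -1, multiplied by vol².
  have hsq : ContDiffAt ℝ n (fun y => wedgeVol (φ y) (ψ y) * wedgeVol (φ y) (ψ y)) y₀ := by
    refine ContDiffAt.congr_of_eventuallyEq (f := fun y => -∑ j,
      K y (stdBasis 0) (stdBasis.coord j) * K y (stdBasis j) (stdBasis.coord 0))
      (ContDiffAt.sum fun j _ => (hK _ _).mul (hK _ _)).neg ?_
    filter_upwards [h, hKJ] with y ⟨α, c, hα, _⟩ hy
    have h1 := map_eq_sum_coord (stdBasis.coord 0 ∘ₗ (J y : E6 →ₗ[ℝ] E6)) (J y (stdBasis 0))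
    have h2 : J y (J y (stdBasis 0)) = -stdBasis 0 := hα.J_J _
    have h3 : stdBasis.coord 0 (stdBasis 0) = 1 := by simp
    simp only [LinearMap.comp_apply, ContinuousLinearMap.coe_coe, h2, map_neg, h3,
      smul_eq_mul] at h1
    simp only [hy]
    simp only [mul_mul_mul_comm _ (wedgeVol (φ y) (ψ y)) _ (wedgeVol (φ y) (ψ y))]
    rw [← Finset.sum_mul, ← h1]
    ring
  have hm := contDiffAt_of_sq hs hsq hpos
  have hne : ∀ᶠ y in 𝓝 y₀, wedgeVol (φ y) (ψ y) ≠ 0 := hpos.mono fun y hy h0 => by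
    rw [h0, mul_zero] at hy
    exact lt_irrefl _ hy
  refine ⟨hm, fun v ζ => ?_⟩
  refine ((hK v ζ).div hm hne.self_of_nhds).congr_of_eventuallyEq ?_
  filter_upwards [hKJ, hne] with y hy hy0
  rw [Pi.div_apply, hy, mul_div_cancel_right₀ _ hy0]

/-- The entries of `J` are smooth by the preceding lemma, and ψ = -φ(J·,·,·) then expresses `ψ`
smoothly. -/
theorem contDiffAt_associated (hs : s * s = 1) (hφ : ContDiffAt ℝ n φ y₀)
    (h : ∀ᶠ y in 𝓝 y₀, ∃ (α : E6 →ₗ[ℝ] (Fin 3 → ℂ)) (c : ℂ), IsCoframe (J y : E6 →ₗ[ℝ] E6) α ∧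
      complexify (φ y).toAlternatingMap + Complex.I • complexify (ψ y).toAlternatingMap =
        c • wedgeOnes (comp α))
    (hpos : ∀ᶠ y in 𝓝 y₀, 0 < s * wedgeVol (φ y) (ψ y)) :
    ContDiffAt ℝ n J y₀ ∧ ContDiffAt ℝ n ψ y₀ := by
  obtain ⟨-, hJ⟩ := contDiffAt_wedgeVol hs hφ h hpos
  constructor
  · refine contDiffAt_clm_of_apply fun i => ?_
    have h1 : (fun y => J y (stdBasis i)) =
        fun y => ∑ j, stdBasis.coord j (J y (stdBasis i)) • stdBasis j := by
      ext1 y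
      exact map_eq_sum_coord LinearMap.id _
    rw [h1]
    exact ContDiffAt.sum fun j _ => (hJ _ _).smul contDiffAt_const
  · refine contDiffAt_of_apply fun v => ?_
    refine ContDiffAt.congr_of_eventuallyEq (f := fun y => -∑ j,
      stdBasis.coord j (J y (stdBasis (v 0))) *
        φ y ![stdBasis j, stdBasis (v 1), stdBasis (v 2)])
      (ContDiffAt.sum fun j _ => (hJ _ _).mul (contDiffAt_apply hφ _)).neg ?_
    filter_upwards [h] with y ⟨α, c, hα, hc⟩
    have h1 : (fun i => stdBasis (v i)) = ![stdBasis (v 0), stdBasis (v 1), stdBasis (v 2)] := by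
      ext1 i
      fin_cases i <;> rfl
    rw [h1]
    refine (hα.star_eq hc _ _ _).trans (congrArg Neg.neg ?_)
    let A : E6 →ₗ[ℝ] ℝ :=
      { toFun := fun v' => (φ y).toAlternatingMap.curryLeft v' ![stdBasis (v 1), stdBasis (v 2)]
        map_add' := fun a b => by rw [map_add]; rfl
        map_smul' := fun a b => by rw [map_smul]; rfl }
    exact map_eq_sum_coord A (J y (stdBasis (v 0)))

end Calculus

/-! ### Smoothness of the square root η -/

section Calculus

variable {E : Type*} [NormedAddCommGroup E] [NormedSpace ℝ E] {n : WithTop ℕ∞} {y₀ : E}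

/-- The matrix of the bilinear form `(ζ, ξ) ↦ ζ ∧ ξ ∧ D`. -/
def pairingMatrix (D : E6 [⋀^Fin 4]→ₗ[ℝ] ℝ) : Matrix (Fin 6) (Fin 6) ℝ := fun j k =>
  (wedge (wedge (realOne (stdBasis.coord j)) (realOne (stdBasis.coord k))) D :
    E6 [⋀^Fin 6]→ₗ[ℝ] ℝ) stdBasis

set_option maxRecDepth 4000 in
theorem contDiffAt_pairingMatrix {D : E → E6 [⋀^Fin 4]→L[ℝ] ℝ} (hD : ContDiffAt ℝ n D y₀)
    (j k : Fin 6) : ContDiffAt ℝ n (fun y => pairingMatrix (D y).toAlternatingMap j k) y₀ := by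
  have h1 := contDiffAt_wedge (p := 2) (q := 4) (n := n) (y₀ := y₀)
    (a := fun _ => wedge (realOne (stdBasis.coord j)) (realOne (stdBasis.coord k)))
    (b := fun y => (D y).toAlternatingMap) (fun u => contDiffAt_const) (contDiffAt_apply hD)
  unfold pairingMatrix
  exact h1 stdBasis

/-- The value at the standard basis of the pairing of `e₀` with `e⁰`. -/
def rootScale (η : E6 [⋀^Fin 2]→ₗ[ℝ] ℝ) (D : E6 [⋀^Fin 4]→ₗ[ℝ] ℝ) : ℝ :=
  rootPairing η D (stdBasis 0) (stdBasis.coord 0) stdBasis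

theorem curryLeft_eq_sum (η : E6 [⋀^Fin 2]→ₗ[ℝ] ℝ) (v : E6) :
    η.curryLeft v = ∑ j, η ![v, stdBasis j] • realOne (stdBasis.coord j) := by
  ext u
  let A : E6 →ₗ[ℝ] ℝ :=
    { toFun := fun w => (η.curryLeft v) ![w]
      map_add' := fun a b => by simpa using (η.curryLeft v).map_vecCons_add ![] a b
      map_smul' := fun a b => by simpa using (η.curryLeft v).map_vecCons_smul ![] a b }
  have h := map_eq_sum_coord A (u 0)
  have hu : u = ![u 0] := by
    ext1 i
    fin_cases i
    rfl
  rw [alternatingMap_sum_apply]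
  refine (congrArg (η.curryLeft v) hu).trans (h.trans (Finset.sum_congr rfl fun j _ => ?_))
  rw [AlternatingMap.smul_apply, realOne_apply, smul_eq_mul, smul_eq_mul, mul_comm]
  rfl

/-- The left side is a product of the matrices of η and of the pairing. By
`IsUnitaryCoframe.rootPairing_eq` it is scalar when D = 2η², so η is proportional to the inverse of
a matrix linear in D. -/
theorem sum_mul_pairingMatrix (η : E6 [⋀^Fin 2]→ₗ[ℝ] ℝ) (D : E6 [⋀^Fin 4]→ₗ[ℝ] ℝ) (i k : Fin 6) :
    ∑ j, η ![stdBasis i, stdBasis j] * pairingMatrix D j k =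
      rootPairing η D (stdBasis i) (stdBasis.coord k) stdBasis := by
  rw [rootPairing, curryLeft_eq_sum, wedge_sum_left, wedge_sum_left, alternatingMap_sum_apply]
  refine Finset.sum_congr rfl fun j _ => ?_
  rw [wedge_smul_left, wedge_smul_left, AlternatingMap.smul_apply, smul_eq_mul]
  rfl

-- With κ the scalar in η·P(D) = κ·1, the form B = η/κ is the inverse matrix of P(D), hence smooth.
-- Since D = κ² (2 B ∧ B), κ² is smooth too, and κ has the constant sign -s.
set_option maxRecDepth 4000 in
theorem contDiffAt_root {ε : Fin 3 → ℝ} (hε : IsSelfCofactor ε) {s : ℝ} (hs : s * s = 1)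
    {φ ψ : E → E6 [⋀^Fin 3]→L[ℝ] ℝ} {J : E → E6 →L[ℝ] E6} {η : E → E6 [⋀^Fin 2]→L[ℝ] ℝ}
    {D : E → E6 [⋀^Fin 4]→L[ℝ] ℝ} (hD : ContDiffAt ℝ n D y₀)
    (h : ∀ᶠ y in 𝓝 y₀, ∃ (α : E6 →ₗ[ℝ] (Fin 3 → ℂ)) (c : ℂ), c ≠ 0 ∧
      IsUnitaryCoframe ε (J y : E6 →ₗ[ℝ] E6) (η y).toAlternatingMap α ∧
      complexify (φ y).toAlternatingMap + Complex.I • complexify (ψ y).toAlternatingMap =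
        c • wedgeOnes (comp α))
    (hη : ∀ᶠ y in 𝓝 y₀, (D y).toAlternatingMap =
      (2 : ℝ) • wedge (η y).toAlternatingMap (η y).toAlternatingMap)
    (hpos : ∀ᶠ y in 𝓝 y₀, 0 < s * wedgeVol (φ y) (ψ y)) :
    ContDiffAt ℝ n η y₀ := by
  let κ : E → ℝ := fun y => rootScale (η y).toAlternatingMap (D y).toAlternatingMap
  have hpair : ∀ᶠ y in 𝓝 y₀, 0 < (-s) * κ y ∧ ∀ i k,
      rootPairing (η y).toAlternatingMap (D y).toAlternatingMap (stdBasis i) (stdBasis.coord k)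
        stdBasis = κ y * (1 : Matrix (Fin 6) (Fin 6) ℝ) i k := by
    filter_upwards [h, hη, hpos] with y ⟨α, c, hc, hα, hαc⟩ hy hpy
    have h1 : ∀ i k, rootPairing (η y).toAlternatingMap (D y).toAlternatingMap (stdBasis i)
        (stdBasis.coord k) stdBasis = (-(Complex.normSq c)⁻¹ * wedgeVol (φ y) (ψ y)) *
          (1 : Matrix (Fin 6) (Fin 6) ℝ) i k := by
      intro i k
      rw [hy, hα.rootPairing_eq hε hc hαc, AlternatingMap.smul_apply, smul_eq_mul,
        stdBasis.coord_apply, stdBasis.repr_self, Finsupp.single_apply, Matrix.one_apply]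
      rw [mul_right_comm]
      rfl
    have h2 : κ y = -(Complex.normSq c)⁻¹ * wedgeVol (φ y) (ψ y) := by
      refine (h1 0 0).trans ?_
      rw [Matrix.one_apply_eq, mul_one]
    refine ⟨?_, fun i k => by rw [h1, h2]⟩
    rw [h2]
    have := mul_pos (inv_pos.2 (Complex.normSq_pos.2 hc)) hpy
    linarith
  have hκ0 : ∀ᶠ y in 𝓝 y₀, κ y ≠ 0 := hpair.mono fun y hy h0 => by
    rw [h0, mul_zero] at hy
    exact lt_irrefl _ hy.1
  let B : E → E6 [⋀^Fin 2]→L[ℝ] ℝ := fun y => (κ y)⁻¹ • η y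
  have hinv : ∀ᶠ y in 𝓝 y₀,
      (Matrix.of fun i j => B y ![stdBasis i, stdBasis j]) *
        pairingMatrix (D y).toAlternatingMap = 1 := by
    filter_upwards [hpair, hκ0] with y hy h0
    ext i k
    have h1 := hy.2 i k
    rw [← sum_mul_pairingMatrix] at h1
    rw [Matrix.mul_apply, ← inv_mul_cancel_left₀ h0 ((1 : Matrix (Fin 6) (Fin 6) ℝ) i k), ← h1,
      Finset.mul_sum]
    exact Finset.sum_congr rfl fun j _ => mul_assoc _ _ _
  have hdet : (pairingMatrix (D y₀).toAlternatingMap).det ≠ 0 := by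
    intro h0
    have := congrArg Matrix.det hinv.self_of_nhds
    rw [Matrix.det_mul, h0, mul_zero, Matrix.det_one] at this
    exact zero_ne_one this
  have hB : ContDiffAt ℝ n B y₀ := by
    refine contDiffAt_of_apply fun v => ?_
    refine (contDiffAt_matrix_inv (contDiffAt_pairingMatrix hD) hdet (v 0) (v 1))
      |>.congr_of_eventuallyEq ?_
    filter_upwards [hinv] with y hy
    rw [Matrix.inv_eq_left_inv hy, Matrix.of_apply]
    congr 1
    ext1 i
    fin_cases i <;> rfl
  have hηB : ∀ᶠ y in 𝓝 y₀, η y = κ y • B y :=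
    hκ0.mono fun y hy => (smul_inv_smul₀ hy _).symm
  have hDB : ∀ᶠ y in 𝓝 y₀, ∀ u, D y u = (κ y * κ y) *
      (2 * wedge (B y).toAlternatingMap (B y).toAlternatingMap u) := by
    filter_upwards [hη, hηB] with y hy hyB u
    have h1 : (η y).toAlternatingMap = κ y • (B y).toAlternatingMap :=
      congrArg ContinuousAlternatingMap.toAlternatingMap hyB
    have h2 := congrArg (fun F => F u) hy
    rw [h1, wedge_smul_left, wedge_smul_right] at h2
    refine h2.trans ?_
    simp only [AlternatingMap.smul_apply, smul_eq_mul]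
    ring
  have hκ : ContDiffAt ℝ n κ y₀ := by
    -- A tuple on which D does not vanish exists because κ ≠ 0; dividing by 2 B ∧ B at that tuple
    -- isolates κ².
    obtain ⟨u, hu⟩ : ∃ u, D y₀ u ≠ 0 := by
      by_contra! hD0
      have h1 : (D y₀).toAlternatingMap = 0 := AlternatingMap.ext hD0
      refine hκ0.self_of_nhds ?_
      have h2 := wedge_smul_right (0 : ℝ) (wedge ((η y₀).toAlternatingMap.curryLeft (stdBasis 0))
        (realOne (stdBasis.coord 0))) (0 : E6 [⋀^Fin 4]→ₗ[ℝ] ℝ)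
      rw [zero_smul, zero_smul] at h2
      change rootPairing _ _ _ _ _ = 0
      rw [h1]
      exact congrArg (fun F => F stdBasis) h2
    let q : E → ℝ := fun y => 2 * wedge (B y).toAlternatingMap (B y).toAlternatingMap u
    have hq : ContDiffAt ℝ n q y₀ := contDiffAt_const.mul
      (contDiffAt_wedge (a := fun y => (B y).toAlternatingMap)
        (b := fun y => (B y).toAlternatingMap) (contDiffAt_apply hB) (contDiffAt_apply hB) u)
    have hq0 : q y₀ ≠ 0 := fun h0 => hu (by
      rw [hDB.self_of_nhds u]
      exact mul_eq_zero_of_right _ h0)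
    refine contDiffAt_of_sq (s := -s) (by rw [neg_mul_neg, hs]) ?_ (hpair.mono fun y hy => hy.1)
    refine ((contDiffAt_apply hD u).div hq hq0).congr_of_eventuallyEq ?_
    filter_upwards [hDB, hq.continuousAt.eventually_ne hq0] with y hy hqy
    rw [Pi.div_apply, hy, mul_div_cancel_right₀ _ hqy]
  exact (hκ.smul hB).congr_of_eventuallyEq hηB

end Calculus

/-! ### The exterior derivative of `f α¹ ∧ α² ∧ α³` -/

theorem wedgeOnes_four_laplace {V : Type*} [AddCommGroup V] [Module ℝ V]
    (p a b c : V →ₗ[ℝ] ℂ) (v : Fin 4 → V) :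
    wedgeOnes ![p, a, b, c] v =
      ∑ i : Fin 4, (-1) ^ (i : ℕ) * (p (v i) * wedgeOnes ![a, b, c] (i.removeNth v)) := by
  rw [wedgeOnes_apply, Matrix.det_succ_row_zero]
  refine Finset.sum_congr rfl fun i _ => ?_
  rw [wedgeOnes_apply, mul_assoc]
  congr 3

section Calculus

variable {y₀ : E6} {α : E6 → E6 →L[ℝ] (Fin 3 → ℂ)}

/-- The components of a `ℂ³`-valued continuous linear map. -/
abbrev compL {V : Type*} [AddCommGroup V] [Module ℝ V] [TopologicalSpace V]
    (a : V →L[ℝ] (Fin 3 → ℂ)) (i : Fin 3) : V →ₗ[ℝ] ℂ :=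
  comp (a : V →ₗ[ℝ] (Fin 3 → ℂ)) i

/-- The coordinates of `E6` as complex-valued `1`-forms. -/
def coordOne (m : Fin 6) : E6 →ₗ[ℝ] ℂ := (Complex.ofRealCLM : ℝ →ₗ[ℝ] ℂ) ∘ₗ stdBasis.coord m

/-- The partial derivative `∂_m α^a`. -/
def partialOne (α : E6 → E6 →L[ℝ] (Fin 3 → ℂ)) (y₀ : E6) (m : Fin 6) (a : Fin 3) : E6 →ₗ[ℝ] ℂ :=
  compL (fderiv ℝ α y₀ (stdBasis m)) a

theorem compL_fderiv_eq_sum (v : E6) (a : Fin 3) :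
    compL (fderiv ℝ α y₀ v) a = ∑ m, coordOne m v • partialOne α y₀ m a := by
  ext w
  have h := map_eq_sum_coord (fderiv ℝ α y₀ : E6 →ₗ[ℝ] E6 →L[ℝ] (Fin 3 → ℂ)) v
  have h2 := congrArg (fun F => F w a) h
  simp only [ContinuousLinearMap.coe_coe, sum_apply, Finset.sum_apply, smul_apply,
    Pi.smul_apply] at h2
  refine h2.trans ?_
  rw [LinearMap.sum_apply]
  refine Finset.sum_congr rfl fun m _ => ?_
  rw [LinearMap.smul_apply, smul_eq_mul]
  exact Complex.real_smul

theorem hasFDerivAt_entry (hα : DifferentiableAt ℝ α y₀) (w : E6) (i : Fin 3) :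
    HasFDerivAt (fun y => α y w i)
      ((ContinuousLinearMap.proj i : (Fin 3 → ℂ) →L[ℝ] ℂ).comp ((fderiv ℝ α y₀).flip w)) y₀ := by
  have h1 : HasFDerivAt (fun y => α y w) ((fderiv ℝ α y₀).flip w) y₀ := by
    simpa using hα.hasFDerivAt.clm_apply (hasFDerivAt_const w y₀)
  exact (hasFDerivAt_pi'.1 h1) i

theorem hasFDerivAt_wedgeOnes (hα : DifferentiableAt ℝ α y₀) (w : Fin 3 → E6) :
    ∃ L : E6 →L[ℝ] ℂ, HasFDerivAt (fun y => wedgeOnes (compL (α y)) w) L y₀ ∧ ∀ v, L v =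
      wedgeOnes ![compL (fderiv ℝ α y₀ v) 0, compL (α y₀) 1, compL (α y₀) 2] w +
      wedgeOnes ![compL (α y₀) 0, compL (fderiv ℝ α y₀ v) 1, compL (α y₀) 2] w +
      wedgeOnes ![compL (α y₀) 0, compL (α y₀) 1, compL (fderiv ℝ α y₀ v) 2] w := by
  have g := fun i j => hasFDerivAt_entry hα (w j) i
  have t := fun j k l => ((g 0 j).mul (g 1 k)).mul (g 2 l)
  refine ⟨_, (((((t 0 1 2).sub (t 0 2 1)).sub (t 1 0 2)).add (t 2 0 1)).add (t 1 2 0)).sub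
    (t 2 1 0) |>.congr_of_eventuallyEq (Filter.Eventually.of_forall fun y => ?_), fun v => ?_⟩
  · simp [wedgeOnes_apply, Matrix.det_fin_three, comp_apply]
    ring
  · simp [wedgeOnes_apply, Matrix.det_fin_three, comp_apply]
    ring

theorem update_three_zero {X : Type*} (a b c d : X) :
    Function.update ![a, b, c] 0 d = ![d, b, c] := by
  ext i
  fin_cases i <;> rfl

theorem update_three_one {X : Type*} (a b c d : X) :
    Function.update ![a, b, c] 1 d = ![a, d, c] := by
  ext i
  fin_cases i <;> rfl

theorem update_three_two {X : Type*} (a b c d : X) :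
    Function.update ![a, b, c] 2 d = ![a, b, d] := by
  ext i
  fin_cases i <;> rfl

theorem wedgeOnes_sum_smul_left {V : Type*} [AddCommGroup V] [Module ℝ V] {k : ℕ} {ι : Type*}
    [Fintype ι] (c : Fin k → (V →ₗ[ℝ] ℂ)) (i : Fin k) (r : ι → ℂ) (θ : ι → (V →ₗ[ℝ] ℂ)) :
    wedgeOnes (Function.update c i (∑ m, r m • θ m)) =
      ∑ m, r m • wedgeOnes (Function.update c i (θ m)) := by
  have h := map_sum ((wedgeOnesAlt V k).toMultilinearMap.toLinearMap c i) (fun m => r m • θ m)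
    Finset.univ
  simp only [map_smul] at h
  exact h

/-- This is dα^a = ∑ dx^m ∧ ∂_m α^a, the decomposition into products that `IsCoframe.coeff22_deriv`
expects. -/
theorem toAlternatingMap_extDeriv_oneForm (hα : DifferentiableAt ℝ α y₀)
    (hd : DifferentiableAt ℝ (fun y => ContinuousAlternatingMap.ofSubsingleton ℝ E6
      (Fin 3 → ℂ) (0 : Fin 1) (α y)) y₀) (a : Fin 3) :
    (LinearMap.proj a : (Fin 3 → ℂ) →ₗ[ℝ] ℂ).compAlternatingMap
      (extDeriv (fun y => ContinuousAlternatingMap.ofSubsingleton ℝ E6 (Fin 3 → ℂ) (0 : Fin 1)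
        (α y)) y₀).toAlternatingMap =
      ∑ m, wedgeOnes ![coordOne m, partialOne α y₀ m a] := by
  ext v
  have key : ∀ w v, fderiv ℝ (fun y => α y w) y₀ v a = compL (fderiv ℝ α y₀ v) a w := by
    intro w v
    have h1 : HasFDerivAt (fun y => α y w) ((fderiv ℝ α y₀).flip w) y₀ := by
      simpa using hα.hasFDerivAt.clm_apply (hasFDerivAt_const w y₀)
    rw [h1.fderiv]
    rfl
  change (extDeriv (fun y => ContinuousAlternatingMap.ofSubsingleton ℝ E6
      (Fin 3 → ℂ) (0 : Fin 1) (α y)) y₀ v) a = _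
  rw [extDeriv_apply hd, Fin.sum_univ_two]
  change (((-1 : ℤ) ^ 0 • fderiv ℝ (fun y => α y (v 1)) y₀ (v 0)) +
    ((-1 : ℤ) ^ 1 • fderiv ℝ (fun y => α y (v 0)) y₀ (v 1))) a = _
  simp only [pow_zero, pow_one, one_smul, neg_smul, Pi.add_apply, Pi.neg_apply, key,
    compL_fderiv_eq_sum, alternatingMap_sum_apply, wedgeOnes_apply, Matrix.det_fin_two,
    LinearMap.sum_apply, LinearMap.smul_apply, smul_eq_mul]
  rw [← sub_eq_add_neg, ← Finset.sum_sub_distrib]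
  refine Finset.sum_congr rfl fun m _ => ?_
  simp

/-- The Leibniz rule in coordinates. The factor dx^m stays in front in each term, so the alternating
sum defining `extDeriv` is the Laplace expansion along the first row. -/
theorem toAlternatingMap_extDeriv_smul {ξ : E6 → E6 [⋀^Fin 3]→L[ℝ] ℂ} {f : E6 → ℂ}
    (hα : DifferentiableAt ℝ α y₀) (hξ : DifferentiableAt ℝ ξ y₀) (hf : DifferentiableAt ℝ f y₀)
    (h : ∀ᶠ y in 𝓝 y₀, (ξ y).toAlternatingMap = f y • wedgeOnes (compL (α y))) :
    (extDeriv ξ y₀).toAlternatingMap =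
      wedgeOnes ![(fderiv ℝ f y₀ : E6 →ₗ[ℝ] ℂ), compL (α y₀) 0, compL (α y₀) 1, compL (α y₀) 2] +
      f y₀ • ∑ m,
        (wedgeOnes ![coordOne m, partialOne α y₀ m 0, compL (α y₀) 1, compL (α y₀) 2] +
          wedgeOnes ![coordOne m, compL (α y₀) 0, partialOne α y₀ m 1, compL (α y₀) 2] +
          wedgeOnes ![coordOne m, compL (α y₀) 0, compL (α y₀) 1, partialOne α y₀ m 2]) := by
  ext v
  have hw : compL (α y₀) = ![compL (α y₀) 0, compL (α y₀) 1, compL (α y₀) 2] := by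
    ext1 i
    fin_cases i <;> rfl
  have key : ∀ w v, fderiv ℝ (fun y => ξ y w) y₀ v =
      fderiv ℝ f y₀ v * wedgeOnes ![compL (α y₀) 0, compL (α y₀) 1, compL (α y₀) 2] w + f y₀ * ∑ m,
        coordOne m v * (wedgeOnes ![partialOne α y₀ m 0, compL (α y₀) 1, compL (α y₀) 2] w +
          wedgeOnes ![compL (α y₀) 0, partialOne α y₀ m 1, compL (α y₀) 2] w +
          wedgeOnes ![compL (α y₀) 0, compL (α y₀) 1, partialOne α y₀ m 2] w) := by
    intro w v
    obtain ⟨L, hL, hLv⟩ := hasFDerivAt_wedgeOnes hα w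
    have h1 : (fun y => ξ y w) =ᶠ[𝓝 y₀] fun y => f y * wedgeOnes (compL (α y)) w := by
      filter_upwards [h] with y hy
      exact congrArg (fun F => F w) hy
    have h2 : HasFDerivAt (fun y => f y * wedgeOnes (compL (α y)) w) _ y₀ := hf.hasFDerivAt.mul hL
    rw [h1.fderiv_eq, h2.fderiv]
    have s0 := wedgeOnes_sum_smul_left ![compL (α y₀) 0, compL (α y₀) 1, compL (α y₀) 2] 0
      (fun m => coordOne m v) (fun m => partialOne α y₀ m 0)
    have s1 := wedgeOnes_sum_smul_left ![compL (α y₀) 0, compL (α y₀) 1, compL (α y₀) 2] 1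
      (fun m => coordOne m v) (fun m => partialOne α y₀ m 1)
    have s2 := wedgeOnes_sum_smul_left ![compL (α y₀) 0, compL (α y₀) 1, compL (α y₀) 2] 2
      (fun m => coordOne m v) (fun m => partialOne α y₀ m 2)
    rw [← compL_fderiv_eq_sum] at s0 s1 s2
    have s0' := congrArg (fun F => F w) s0
    have s1' := congrArg (fun F => F w) s1
    have s2' := congrArg (fun F => F w) s2
    simp only [alternatingMap_sum_apply, AlternatingMap.smul_apply, smul_eq_mul,
      update_three_zero, update_three_one, update_three_two] at s0' s1' s2'
    simp only [add_apply, smul_apply, smul_eq_mul, hLv, s0', s1', s2', mul_add,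
      Finset.sum_add_distrib, ← hw]
    ring
  change extDeriv _ y₀ v = _
  rw [extDeriv_apply hξ]
  simp only [key, AlternatingMap.add_apply, AlternatingMap.smul_apply, alternatingMap_sum_apply,
    wedgeOnes_four_laplace, smul_eq_mul, Finset.mul_sum, ← Finset.sum_add_distrib, smul_add,
    Finset.smul_sum, zsmul_eq_mul]
  rw [Finset.sum_add_distrib, Finset.sum_comm (s := (Finset.univ : Finset (Fin 6)))]
  push_cast
  congr 1
  refine Finset.sum_congr rfl fun m _ => Finset.sum_congr rfl fun i _ => ?_
  ring

end Calculus

/-! ### The Nijenhuis matrix in a chart -/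

section Calculus

variable {y₀ : E6} {α : E6 → E6 →L[ℝ] (Fin 3 → ℂ)}

/-- Evaluated at a fixed triple where α¹ ∧ α² ∧ α³ is nonzero, the coefficient is a quotient of
differentiable functions. -/
theorem exists_differentiableAt_coeff {ξ : E6 → E6 [⋀^Fin 3]→L[ℝ] ℂ}
    (hα : DifferentiableAt ℝ α y₀) (hξ : DifferentiableAt ℝ ξ y₀)
    (h : ∀ᶠ y in 𝓝 y₀, ∃ f : ℂ, (ξ y).toAlternatingMap = f • wedgeOnes (compL (α y)))
    (h0 : wedgeOnes (compL (α y₀)) ≠ 0) :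
    ∃ f : E6 → ℂ, DifferentiableAt ℝ f y₀ ∧
      ∀ᶠ y in 𝓝 y₀, (ξ y).toAlternatingMap = f y • wedgeOnes (compL (α y)) := by
  obtain ⟨u, hu⟩ : ∃ u, wedgeOnes (compL (α y₀)) u ≠ 0 := by
    by_contra! hz
    exact h0 (AlternatingMap.ext hz)
  obtain ⟨L, hL, -⟩ := hasFDerivAt_wedgeOnes hα u
  have hξu : DifferentiableAt ℝ (fun y => ξ y u) y₀ :=
    (ContinuousAlternatingMap.apply ℝ E6 ℂ u).differentiableAt.comp y₀ hξ
  have hdiv : DifferentiableAt ℝ (fun y => ξ y u / wedgeOnes (compL (α y)) u) y₀ := by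
    simp only [div_eq_mul_inv]
    exact hξu.mul (hL.differentiableAt.inv hu)
  refine ⟨_, hdiv, ?_⟩
  filter_upwards [h, hL.continuousAt.eventually_ne hu] with y ⟨f, hf⟩ hy
  have h1 : ξ y u = f * wedgeOnes (compL (α y)) u := congrArg (fun F => F u) hf
  rw [hf, h1, mul_div_cancel_right₀ _ hy]

/-- If `d(f α¹ ∧ α² ∧ α³) = 2 η²`, then the Nijenhuis matrix of `α` lies in the orbit of
`diag(ε)`, and it is a multiple of `diag(ε)` if `α` is unitary. -/
theorem exists_nijenhuis_matrix {ε : Fin 3 → ℝ} (hε : IsSelfCofactor ε)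
    {J : E6 →ₗ[ℝ] E6} (hJ : IsCoframe J (α y₀ : E6 →ₗ[ℝ] (Fin 3 → ℂ)))
    {ξ : E6 → E6 [⋀^Fin 3]→L[ℝ] ℂ}
    (hd : DifferentiableAt ℝ (fun y => ContinuousAlternatingMap.ofSubsingleton ℝ E6
      (Fin 3 → ℂ) (0 : Fin 1) (α y)) y₀)
    (hα : DifferentiableAt ℝ α y₀) (hξ : DifferentiableAt ℝ ξ y₀)
    (h : ∀ᶠ y in 𝓝 y₀, ∃ f : ℂ, (ξ y).toAlternatingMap = f • wedgeOnes (compL (α y)))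
    (hξ0 : ξ y₀ ≠ 0) {η : E6 [⋀^Fin 2]→ₗ[ℝ] ℝ} {β : E6 →ₗ[ℝ] (Fin 3 → ℂ)}
    (hβ : IsUnitaryCoframe ε J η β)
    (hη : (extDeriv ξ y₀).toAlternatingMap = complexify ((2 : ℝ) • wedge η η)) :
    ∃ N : Matrix (Fin 3) (Fin 3) ℂ,
      (∀ i : Fin 3, ∃ τ ∈ typeSpace J 2 0 ⊔ typeSpace J 1 1,
        (LinearMap.proj i : (Fin 3 → ℂ) →ₗ[ℝ] ℂ).compAlternatingMap
          (extDeriv (fun y => ContinuousAlternatingMap.ofSubsingleton ℝ E6 (Fin 3 → ℂ) (0 : Fin 1)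
            (α y)) y₀).toAlternatingMap =
          τ + ∑ j : Fin 3, N i j • wedgeOnes
            ![conjOne (compL (α y₀) (j + 1)), conjOne (compL (α y₀) (j + 2))]) ∧
      (IsUnitaryCoframe ε J η (α y₀ : E6 →ₗ[ℝ] (Fin 3 → ℂ)) → ∃ l : ℂ, N = l • diagMat ε) ∧
      ∃ g : GL (Fin 3) ℂ, N = rho g (diagMat ε) := by
  have h0 : wedgeOnes (compL (α y₀)) ≠ 0 := by
    intro h0
    obtain ⟨f, hf⟩ := h.self_of_nhds
    rw [h0, smul_zero] at hf
    exact hξ0 (ContinuousAlternatingMap.toAlternatingMap_injective hf)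
  obtain ⟨f, hf, hfξ⟩ := exists_differentiableAt_coeff hα hξ h h0
  have hf0 : f y₀ ≠ 0 := by
    intro h1
    have h2 := hfξ.self_of_nhds
    rw [h1, zero_smul] at h2
    exact hξ0 (ContinuousAlternatingMap.toAlternatingMap_injective h2)
  let N : Matrix (Fin 3) (Fin 3) ℂ := fun i j =>
    hJ.coeff02 j (∑ m, wedgeOnes ![coordOne m, partialOne α y₀ m i])
  -- Both sides are the (a,b) coefficient of the (2,2)-part of dΩ, computed by the Leibniz rule and
  -- as 2η².
  have hN : ∀ a b, f y₀ * N a b = hJ.coeff22 a b (complexify ((2 : ℝ) • wedge η η)) := by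
    intro a b
    rw [← hη, toAlternatingMap_extDeriv_smul hα hξ hf hfξ]
    exact (hJ.coeff22_deriv (f y₀) (fderiv ℝ f y₀ : E6 →ₗ[ℝ] ℂ) coordOne
      (partialOne α y₀) a b).symm
  refine ⟨N, fun i => ⟨_, hJ.sub_sum_coeff02_mem
    (∑ m, wedgeOnes ![coordOne m, partialOne α y₀ m i]), ?_⟩, fun hu => ⟨(f y₀)⁻¹, ?_⟩, ?_⟩
  · rw [toAlternatingMap_extDeriv_oneForm hα hd]
    exact (sub_add_cancel _ _).symm
  · ext a b
    rw [Matrix.smul_apply, smul_eq_mul, eq_inv_mul_iff_mul_eq₀ hf0, hN,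
      hu.complexify_two_smul_wedge hε, map_sum]
    simp only [map_smul, hJ.coeff22_basis22, diagMat, Matrix.diagonal_apply]
    by_cases hab : a = b
    · subst hab
      simp
    · rw [if_neg hab]
      refine Finset.sum_eq_zero fun c _ => ?_
      rw [if_neg fun hc => hab (hc.1.trans hc.2.symm), smul_zero]
  -- Only a unitary coframe at this single point is needed; it need not extend to a smooth
  -- coframing.
  · obtain ⟨k, hk, rfl⟩ := hJ.exists_eq_mulCoframe hβ.1
    refine exists_rho_eq hk hf0 ?_
    ext a b
    rw [← hJ.coeff22_sum_basis22 hβ.1, ← hβ.complexify_two_smul_wedge hε, ← hN]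
    rfl

end Calculus

/-! ### Charts -/

section Charts

variable {M : Type*} [TopologicalSpace M] [ChartedSpace E6 M]
  {F : Type*} [NormedAddCommGroup F] [NormedSpace ℝ F] {k : ℕ}

/-- The form `ξ` in terms of the model space of the tangent spaces. -/
def modelForm (ξ : DForm M F k) : M → E6 [⋀^Fin k]→L[ℝ] F := ξ

/-- The field of endomorphisms `J` in terms of the model space of the tangent spaces. -/
def modelEnd (J : EndField M) : M → E6 →L[ℝ] E6 := J

/-- The derivative of the inverse of the chart at `x₀`. -/
def chartLift (x₀ : M) (y : E6) : E6 →L[ℝ] E6 :=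
  mfderiv 𝓘(ℝ, E6) (𝓡 6) (extChartAt (𝓡 6) x₀).symm y

/-- The derivative of the chart at `x₀`. -/
def chartDeriv (x₀ x : M) : E6 →L[ℝ] E6 :=
  mfderiv (𝓡 6) 𝓘(ℝ, E6) (extChartAt (𝓡 6) x₀) x

theorem inChart_eq (ξ : DForm M F k) (x₀ : M) (y : E6) :
    inChart ξ x₀ y = (modelForm ξ ((extChartAt (𝓡 6) x₀).symm y)).compContinuousLinearMap
      (chartLift x₀ y) := rfl

theorem modelForm_extD_eq (ξ : DForm M F k) (x : M) :
    modelForm (extD ξ) x = (extDeriv (inChart ξ x) (extChartAt (𝓡 6) x x)).compContinuousLinearMap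
      (chartDeriv x x) := rfl

variable [IsManifold (𝓡 6) ∞ M]

theorem isManifold_one : IsManifold (𝓡 6) 1 M := IsManifold.of_le (n := ∞) (by norm_cast)

theorem chartDeriv_comp_chartLift {x₀ : M} {y : E6} (hy : y ∈ (extChartAt (𝓡 6) x₀).target) :
    (chartDeriv x₀ ((extChartAt (𝓡 6) x₀).symm y)).comp (chartLift x₀ y) =
      ContinuousLinearMap.id ℝ E6 := by
  have : IsManifold (𝓡 6) 1 M := isManifold_one
  have h := mfderiv_extChartAt_comp_mfderivWithin_extChartAt_symm hy
  rw [ModelWithCorners.range_eq_univ, mfderivWithin_univ] at h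
  exact h

theorem chartLift_comp_chartDeriv {x₀ : M} {y : E6} (hy : y ∈ (extChartAt (𝓡 6) x₀).target) :
    (chartLift x₀ y).comp (chartDeriv x₀ ((extChartAt (𝓡 6) x₀).symm y)) =
      ContinuousLinearMap.id ℝ E6 := by
  have : IsManifold (𝓡 6) 1 M := isManifold_one
  have h := mfderivWithin_extChartAt_symm_comp_mfderiv_extChartAt hy
  rw [ModelWithCorners.range_eq_univ, mfderivWithin_univ] at h
  exact h

theorem chartDeriv_self (x : M) : chartDeriv x x = ContinuousLinearMap.id ℝ E6 := by
  have : IsManifold (𝓡 6) 1 M := isManifold_one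
  exact mfderiv_extChartAt_self

theorem chartLift_self (x : M) :
    chartLift x (extChartAt (𝓡 6) x x) = ContinuousLinearMap.id ℝ E6 := by
  have : IsManifold (𝓡 6) 1 M := isManifold_one
  have h := mfderivWithin_range_extChartAt_symm (I := 𝓡 6) (x := x)
  rw [ModelWithCorners.range_eq_univ, mfderivWithin_univ] at h
  exact h

theorem compContinuousLinearMap_id_form (ξ : E6 [⋀^Fin k]→L[ℝ] F) :
    ξ.compContinuousLinearMap (ContinuousLinearMap.id ℝ E6) = ξ := by
  ext u
  rfl

theorem inChart_self (ξ : DForm M F k) (x : M) :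
    inChart ξ x (extChartAt (𝓡 6) x x) = modelForm ξ x := by
  rw [inChart_eq, chartLift_self, extChartAt_to_inv, compContinuousLinearMap_id_form]

theorem modelForm_extD (ξ : DForm M F k) (x : M) :
    modelForm (extD ξ) x = extDeriv (inChart ξ x) (extChartAt (𝓡 6) x x) := by
  rw [modelForm_extD_eq, chartDeriv_self, compContinuousLinearMap_id_form]

theorem contDiffAt_transition {x₀ x : M} {y : E6} (hy : y ∈ (extChartAt (𝓡 6) x₀).target)
    (hx : (extChartAt (𝓡 6) x₀).symm y ∈ (extChartAt (𝓡 6) x).source) :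
    ContDiffAt ℝ ∞ (extChartAt (𝓡 6) x ∘ (extChartAt (𝓡 6) x₀).symm) y := by
  have h := contDiffWithinAt_ext_coord_change (I := 𝓡 6) (n := ∞) x x₀ (y := y) ⟨hy, hx⟩
  rwa [ModelWithCorners.range_eq_univ, contDiffWithinAt_univ] at h

theorem fderiv_transition {x₀ x : M} {y : E6} (hy : y ∈ (extChartAt (𝓡 6) x₀).target)
    (hx : (extChartAt (𝓡 6) x₀).symm y ∈ (extChartAt (𝓡 6) x).source) :
    fderiv ℝ (extChartAt (𝓡 6) x ∘ (extChartAt (𝓡 6) x₀).symm) y =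
      (chartDeriv x ((extChartAt (𝓡 6) x₀).symm y)).comp (chartLift x₀ y) := by
  have : IsManifold (𝓡 6) 1 M := isManifold_one
  have h1 : MDifferentiableAt 𝓘(ℝ, E6) (𝓡 6) (extChartAt (𝓡 6) x₀).symm y := by
    have := mdifferentiableWithinAt_extChartAt_symm hy
    rwa [ModelWithCorners.range_eq_univ, mdifferentiableWithinAt_univ] at this
  have h2 : MDifferentiableAt (𝓡 6) 𝓘(ℝ, E6) (extChartAt (𝓡 6) x)
      ((extChartAt (𝓡 6) x₀).symm y) :=
    mdifferentiableAt_extChartAt (by rwa [extChartAt_source] at hx)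
  have h := mfderiv_comp y h2 h1
  rw [mfderiv_eq_fderiv] at h
  exact h

theorem chartLift_comp_fderiv_transition {x₀ x : M} {y : E6}
    (hy : y ∈ (extChartAt (𝓡 6) x₀).target)
    (hx : (extChartAt (𝓡 6) x₀).symm y ∈ (extChartAt (𝓡 6) x).source) :
    (chartLift x (extChartAt (𝓡 6) x ((extChartAt (𝓡 6) x₀).symm y))).comp
      (fderiv ℝ (extChartAt (𝓡 6) x ∘ (extChartAt (𝓡 6) x₀).symm) y) = chartLift x₀ y := by
  have h := chartLift_comp_chartDeriv ((extChartAt (𝓡 6) x).map_source hx)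
  rw [(extChartAt (𝓡 6) x).left_inv hx] at h
  rw [fderiv_transition hy hx, ← ContinuousLinearMap.comp_assoc, h, ContinuousLinearMap.id_comp]

/-- The exterior derivative does not depend on the chart. -/
theorem inChart_extD (ξ : DForm M F k) (x₀ : M) {y : E6}
    (hy : y ∈ (extChartAt (𝓡 6) x₀).target)
    (hξ : SmoothFormAt ξ ((extChartAt (𝓡 6) x₀).symm y)) :
    inChart (extD ξ) x₀ y = extDeriv (inChart ξ x₀) y := by
  set x := (extChartAt (𝓡 6) x₀).symm y with hx
  have hxs : x ∈ (extChartAt (𝓡 6) x).source := mem_extChartAt_source x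
  let τ : E6 → E6 := extChartAt (𝓡 6) x ∘ (extChartAt (𝓡 6) x₀).symm
  have hcont : ContinuousAt (extChartAt (𝓡 6) x₀).symm y := continuousAt_extChartAt_symm'' hy
  -- Near y the form in the chart at x₀ is the pullback, by the transition map, of the form in the
  -- chart at x, so naturality of `extDeriv` applies.
  have hev : inChart ξ x₀ =ᶠ[𝓝 y] fun z =>
      (inChart ξ x (τ z)).compContinuousLinearMap (fderiv ℝ τ z) := by
    filter_upwards [(isOpen_extChartAt_target x₀).mem_nhds hy,
      hcont.preimage_mem_nhds ((isOpen_extChartAt_source x).mem_nhds hxs)] with z hz hzs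
    rw [inChart_eq, inChart_eq, ← chartLift_comp_fderiv_transition hz hzs]
    change _ = ((modelForm ξ ((extChartAt (𝓡 6) x).symm (extChartAt (𝓡 6) x
      ((extChartAt (𝓡 6) x₀).symm z)))).compContinuousLinearMap _).compContinuousLinearMap _
    rw [(extChartAt (𝓡 6) x).left_inv hzs]
    rfl
  have hτ : ContDiffAt ℝ ∞ τ y := contDiffAt_transition hy hxs
  have hd : DifferentiableAt ℝ (inChart ξ x) (τ y) :=
    ContDiffAt.differentiableAt (n := ∞) hξ (by simp)
  have hpb := extDeriv_pullback hd hτ (by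
    rw [minSmoothness_of_isRCLikeNormedField]
    exact WithTop.coe_le_coe.2 (le_top : (2 : ℕ∞) ≤ ⊤))
  rw [hev.extDeriv_eq, hpb, inChart_eq, ← hx, modelForm_extD_eq, fderiv_transition hy hxs]
  rfl

end Charts

/-! ### Pullback of coframes -/

section Pullback

variable {V W : Type*} [AddCommGroup V] [Module ℝ V] [AddCommGroup W] [Module ℝ W]
  {J : V →ₗ[ℝ] V} {α : V →ₗ[ℝ] (Fin 3 → ℂ)} {A : W →ₗ[ℝ] V} {B : V →ₗ[ℝ] W}

theorem IsCoframe.pullback (hα : IsCoframe J α) (hBA : B ∘ₗ A = LinearMap.id)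
    (hAB : A ∘ₗ B = LinearMap.id) : IsCoframe (B ∘ₗ J ∘ₗ A) (α ∘ₗ A) := by
  have hA : Function.Bijective A := Function.bijective_iff_has_inverse.2
    ⟨B, fun x => LinearMap.congr_fun hBA x, fun x => LinearMap.congr_fun hAB x⟩
  refine ⟨hα.1.comp hA, fun v => ?_⟩
  have h1 : A (B (J (A v))) = J (A v) := LinearMap.congr_fun hAB _
  change α (A (B (J (A v)))) = _
  rw [h1, hα.2]
  rfl

theorem complexify_add_compLinearMap {φ ψ : V [⋀^Fin 3]→ₗ[ℝ] ℝ} {c : ℂ}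
    (h : complexify φ + Complex.I • complexify ψ = c • wedgeOnes (comp α)) :
    complexify (φ.compLinearMap A) + Complex.I • complexify (ψ.compLinearMap A) =
      c • wedgeOnes (comp (α ∘ₗ A)) := by
  have h1 := congrArg (fun F => F.compLinearMap A) h
  have h2 : (c • wedgeOnes (comp α)).compLinearMap A =
      c • (wedgeOnes (comp α)).compLinearMap A := rfl
  rw [wedgeOnes_compLinearMap] at h2
  exact h1.trans h2

theorem IsUnitaryCoframe.pullback {ε : Fin 3 → ℝ} {η : V [⋀^Fin 2]→ₗ[ℝ] ℝ}
    (hα : IsUnitaryCoframe ε J η α) (hBA : B ∘ₗ A = LinearMap.id)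
    (hAB : A ∘ₗ B = LinearMap.id) :
    IsUnitaryCoframe ε (B ∘ₗ J ∘ₗ A) (η.compLinearMap A) (α ∘ₗ A) := by
  refine ⟨hα.1.pullback hBA hAB, ?_⟩
  ext u
  have h1 := congrArg (fun F => F (A ∘ u)) hα.2
  simp only [alternatingMap_sum_apply, AlternatingMap.smul_apply] at h1 ⊢
  refine h1.trans (Finset.sum_congr rfl fun k _ => ?_)
  congr 1

end Pullback

/-! ### The form `∗φ` and the almost complex structure -/

/-- Alternating maps on a finite-dimensional space are continuous. The choices `starPair` and
`rootForm` range over continuous forms, whereas the existence results are purely algebraic. -/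
theorem exists_toAlternatingMap_eq {k : ℕ} (ξ : E6 [⋀^Fin k]→ₗ[ℝ] ℝ) :
    ∃ ζ : E6 [⋀^Fin k]→L[ℝ] ℝ, ζ.toAlternatingMap = ξ := by
  have hc : Continuous fun u => ξ u := by
    have h : (fun u => ξ u) = fun u : Fin k → E6 => ∑ r : Fin k → Fin 6,
        (∏ i, stdBasis.coord (r i) (u i)) * ξ fun i => stdBasis (r i) := by
      ext1 u
      have h1 := ξ.toMultilinearMap.map_sum (fun i j => stdBasis.coord j (u i) • stdBasis j)
      have h2 : u = fun i => ∑ j, stdBasis.coord j (u i) • stdBasis j := by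
        ext1 i
        exact map_eq_sum_coord LinearMap.id (u i)
      refine (congrArg ξ h2).trans (h1.trans (Finset.sum_congr rfl fun r _ => ?_))
      exact ξ.toMultilinearMap.map_smul_univ _ _
    rw [h]
    refine continuous_finsetSum _ fun r _ => (continuous_finsetProd _ fun i _ => ?_).mul
      continuous_const
    exact (LinearMap.continuous_of_finiteDimensional (stdBasis.coord (r i))).comp
      (continuous_apply i)
  exact ⟨⟨⟨ξ.toMultilinearMap, hc⟩, ξ.map_eq_zero_of_eq'⟩, rfl⟩

theorem finrank_E6 : Module.finrank ℝ E6 = 6 := finrank_euclideanSpace_fin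

theorem isAssociated_starPair (o : Orientation ℝ E6 (Fin 6)) {φ : E6 [⋀^Fin 3]→L[ℝ] ℝ}
    (hφ : IsPlusForm φ.toAlternatingMap) :
    IsAssociated o φ.toAlternatingMap (starPair o φ).1.toAlternatingMap
      ((starPair o φ).2 : E6 →ₗ[ℝ] E6) := by
  obtain ⟨ψ, J, h⟩ := exists_isAssociated finrank_E6 o hφ
  obtain ⟨ψ', rfl⟩ := exists_toAlternatingMap_eq ψ
  exact Classical.epsilon_spec (p := fun p : (E6 [⋀^Fin 3]→L[ℝ] ℝ) × (E6 →L[ℝ] E6) =>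
    IsAssociated o φ.toAlternatingMap p.1.toAlternatingMap (p.2 : E6 →ₗ[ℝ] E6))
    ⟨(ψ', J.toContinuousLinearMap), h⟩

theorem rootForm_spec {C : (E6 [⋀^Fin 2]→ₗ[ℝ] ℝ) → Prop} {π : E6 [⋀^Fin 4]→ₗ[ℝ] ℝ}
    {η : E6 [⋀^Fin 2]→ₗ[ℝ] ℝ} (hC : C η) (hη : π = (2 : ℝ) • wedge η η) :
    C (rootForm C π).toAlternatingMap ∧
      π = (2 : ℝ) • wedge (rootForm C π).toAlternatingMap (rootForm C π).toAlternatingMap := by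
  obtain ⟨η', rfl⟩ := exists_toAlternatingMap_eq η
  exact Classical.epsilon_spec (p := fun η : E6 [⋀^Fin 2]→L[ℝ] ℝ =>
    C η.toAlternatingMap ∧ π = (2 : ℝ) • wedge η.toAlternatingMap η.toAlternatingMap) ⟨η', hC, hη⟩

/-! ### ∗φ and J on the manifold -/

section Induced

variable {M : Type*} [TopologicalSpace M] [ChartedSpace E6 M]
  {o : ManifoldOrientation M} {φ : DForm M ℝ 3}

/-- The orientation in terms of the model space of the tangent spaces. -/
def modelOrientation (o : ManifoldOrientation M) : M → Orientation ℝ E6 (Fin 6) := o.at_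

theorem IsPlus.isAssociated (hφ : IsPlus φ) (o : ManifoldOrientation M) (x : M) :
    IsAssociated (modelOrientation o x) (modelForm φ x).toAlternatingMap
      (modelForm (starForm o φ) x).toAlternatingMap
      (modelEnd (inducedJ o φ) x : E6 →ₗ[ℝ] E6) :=
  isAssociated_starPair (modelOrientation o x) (hφ x).2

theorem eventually_mem_target (x₀ : M) :
    ∀ᶠ y in 𝓝 (extChartAt (𝓡 6) x₀ x₀), y ∈ (extChartAt (𝓡 6) x₀).target :=
  extChartAt_target_mem_nhds x₀

variable [IsManifold (𝓡 6) ∞ M]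

theorem chart_inverse_left {x₀ : M} {y : E6} (hy : y ∈ (extChartAt (𝓡 6) x₀).target) :
    (chartDeriv x₀ ((extChartAt (𝓡 6) x₀).symm y) : E6 →ₗ[ℝ] E6) ∘ₗ
      (chartLift x₀ y : E6 →ₗ[ℝ] E6) = LinearMap.id :=
  congrArg (fun F : E6 →L[ℝ] E6 => (F : E6 →ₗ[ℝ] E6)) (chartDeriv_comp_chartLift hy)

theorem chart_inverse_right {x₀ : M} {y : E6} (hy : y ∈ (extChartAt (𝓡 6) x₀).target) :
    (chartLift x₀ y : E6 →ₗ[ℝ] E6) ∘ₗ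
      (chartDeriv x₀ ((extChartAt (𝓡 6) x₀).symm y) : E6 →ₗ[ℝ] E6) = LinearMap.id :=
  congrArg (fun F : E6 →L[ℝ] E6 => (F : E6 →ₗ[ℝ] E6)) (chartLift_comp_chartDeriv hy)

theorem IsPlus.eventually_exists_coframe (hφ : IsPlus φ) (o : ManifoldOrientation M) (x₀ : M) :
    ∀ᶠ y in 𝓝 (extChartAt (𝓡 6) x₀ x₀), ∃ (α : E6 →ₗ[ℝ] (Fin 3 → ℂ)) (c : ℂ),
      IsCoframe (endInChart (inducedJ o φ) x₀ y : E6 →ₗ[ℝ] E6) α ∧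
      complexify (inChart φ x₀ y).toAlternatingMap +
        Complex.I • complexify (inChart (starForm o φ) x₀ y).toAlternatingMap =
        c • wedgeOnes (comp α) := by
  filter_upwards [eventually_mem_target x₀] with y hy
  obtain ⟨α, c, hα, -, h⟩ := (hφ.isAssociated o ((extChartAt (𝓡 6) x₀).symm y)).exists_coframe
    finrank_E6
  exact ⟨_, c, hα.pullback (chart_inverse_left hy) (chart_inverse_right hy),
    complexify_add_compLinearMap h⟩

-- Locally the orientation is the ray of a smooth volume form μ, and φ ∧ ∗φ is a positive multiple
-- of μ. The value of μ on the standard basis in the chart is continuous and nonzero, so its sign is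
-- locally constant.
set_option maxRecDepth 4000 in
theorem IsPlus.eventually_pos (hφ : IsPlus φ) (o : ManifoldOrientation M) (x₀ : M) :
    ∃ s : ℝ, s * s = 1 ∧ ∀ᶠ y in 𝓝 (extChartAt (𝓡 6) x₀ x₀),
      0 < s * wedgeVol (inChart φ x₀ y) (inChart (starForm o φ) x₀ y) := by
  obtain ⟨μ, hμ⟩ := o.smooth' x₀
  let m : E6 → ℝ := fun y => inChart μ x₀ y stdBasis
  have hm : ContinuousAt m (extChartAt (𝓡 6) x₀ x₀) :=
    (contDiffAt_apply hμ.self_of_nhds.1 stdBasis).continuousAt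
  have hm0 : m (extChartAt (𝓡 6) x₀ x₀) ≠ 0 := by
    obtain ⟨-, h0, -⟩ := hμ.self_of_nhds
    change inChart μ x₀ _ stdBasis ≠ 0
    rw [inChart_self]
    exact (AlternatingMap.map_basis_ne_zero_iff stdBasis
      (modelForm μ x₀).toAlternatingMap).2 h0
  have hev : ∀ᶠ y in 𝓝 (extChartAt (𝓡 6) x₀ x₀), ∃ r : ℝ, 0 < r ∧
      wedgeVol (inChart φ x₀ y) (inChart (starForm o φ) x₀ y) = r * m y := by
    have hc := (continuousAt_extChartAt_symm (I := 𝓡 6) x₀).tendsto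
    rw [extChartAt_to_inv] at hc
    filter_upwards [hc.eventually hμ] with y hy
    obtain ⟨-, h0, hray⟩ := hy
    obtain ⟨hne, hray'⟩ := (hφ.isAssociated o ((extChartAt (𝓡 6) x₀).symm y)).pos
    have hsr := (ray_eq_iff hne h0).1 (hray'.trans hray.symm)
    obtain ⟨r, hr, hreq⟩ := hsr.exists_pos_right hne h0
    refine ⟨r, hr, ?_⟩
    have h1 := congrArg (fun F => F.compLinearMap (chartLift x₀ y : E6 →ₗ[ℝ] E6)) hreq
    have h2 := wedge_compLinearMap (chartLift x₀ y : E6 →ₗ[ℝ] E6)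
      (modelForm φ ((extChartAt (𝓡 6) x₀).symm y)).toAlternatingMap
      (modelForm (starForm o φ) ((extChartAt (𝓡 6) x₀).symm y)).toAlternatingMap
    exact congrArg (fun F => F stdBasis) (h2.trans h1)
  rcases lt_or_gt_of_ne hm0 with h | h
  · refine ⟨-1, by norm_num, ?_⟩
    filter_upwards [hev, hm.eventually_lt continuousAt_const h] with y ⟨r, hr, hy⟩ hmy
    rw [hy]
    have := mul_pos_of_neg_of_neg hmy (neg_lt_zero.2 hr)
    linarith
  · refine ⟨1, by norm_num, ?_⟩
    filter_upwards [hev, continuousAt_const.eventually_lt hm h] with y ⟨r, hr, hy⟩ hmy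
    rw [hy, one_mul]
    exact mul_pos hr hmy

theorem IsPlus.smooth_induced (hφ : IsPlus φ) (o : ManifoldOrientation M) (x : M) :
    SmoothEndAt (inducedJ o φ) x ∧ SmoothFormAt (starForm o φ) x := by
  obtain ⟨s, hs, hpos⟩ := hφ.eventually_pos o x
  exact contDiffAt_associated hs (hφ x).1 (hφ.eventually_exists_coframe o x) hpos

theorem IsPlus.isAlmostComplex (hφ : IsPlus φ) (o : ManifoldOrientation M) :
    IsAlmostComplex (inducedJ o φ) :=
  fun x => ⟨(hφ.smooth_induced o x).1, (hφ.isAssociated o x).sq⟩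

end Induced

/-! ### The exterior derivative of `φ + i ∗φ` -/

theorem toAlternatingMap_complexForm {k : ℕ} (φ ψ : E6 [⋀^Fin k]→L[ℝ] ℝ) :
    (complexForm φ ψ).toAlternatingMap =
      complexify φ.toAlternatingMap + Complex.I • complexify ψ.toAlternatingMap := rfl

theorem contDiffAt_complexForm {k : ℕ} {n : WithTop ℕ∞} {φ ψ : E6 → E6 [⋀^Fin k]→L[ℝ] ℝ} {y₀ : E6}
    (hφ : ContDiffAt ℝ n φ y₀) (hψ : ContDiffAt ℝ n ψ y₀) :
    ContDiffAt ℝ n (fun y => complexForm (φ y) (ψ y)) y₀ := by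
  refine contDiffAt_of_apply fun v => ?_
  exact (Complex.ofRealCLM.contDiff.contDiffAt.comp y₀ (contDiffAt_apply hφ _)).add
    (contDiffAt_const.mul (Complex.ofRealCLM.contDiff.contDiffAt.comp y₀ (contDiffAt_apply hψ _)))

theorem extDeriv_complexForm {k : ℕ} {φ ψ : E6 → E6 [⋀^Fin k]→L[ℝ] ℝ} {y₀ : E6}
    (hφ : ContDiffAt ℝ ∞ φ y₀) (hψ : ContDiffAt ℝ ∞ ψ y₀) :
    extDeriv (fun y => complexForm (φ y) (ψ y)) y₀ =
      complexForm (extDeriv φ y₀) (extDeriv ψ y₀) := by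
  ext v
  have hd := (contDiffAt_complexForm hφ hψ).differentiableAt (by simp)
  have key : ∀ w v, fderiv ℝ (fun y => complexForm (φ y) (ψ y) w) y₀ v =
      (fderiv ℝ (fun y => φ y w) y₀ v : ℂ) +
        Complex.I * (fderiv ℝ (fun y => ψ y w) y₀ v : ℂ) := by
    intro w v
    have h1 := ((contDiffAt_apply hφ w).differentiableAt (by simp)).hasFDerivAt
    have h2 := ((contDiffAt_apply hψ w).differentiableAt (by simp)).hasFDerivAt
    have h3 : HasFDerivAt (fun y => complexForm (φ y) (ψ y) w) _ y₀ :=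
      (Complex.ofRealCLM.hasFDerivAt.comp y₀ h1).add
        ((Complex.ofRealCLM.hasFDerivAt.comp y₀ h2).const_mul Complex.I)
    rw [h3.fderiv]
    rfl
  change _ = ((extDeriv φ y₀ v : ℝ) : ℂ) + Complex.I * ((extDeriv ψ y₀ v : ℝ) : ℂ)
  rw [extDeriv_apply hd, extDeriv_apply (hφ.differentiableAt (by simp)),
    extDeriv_apply (hψ.differentiableAt (by simp))]
  simp only [key, Complex.ofReal_sum, Finset.mul_sum, ← Finset.sum_add_distrib]
  refine Finset.sum_congr rfl fun i _ => ?_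
  simp only [zsmul_eq_mul]
  push_cast
  ring

theorem contDiffAt_extDeriv {k : ℕ} {ξ : E6 → E6 [⋀^Fin k]→L[ℝ] ℝ} {y₀ : E6}
    (h : ContDiffAt ℝ ∞ ξ y₀) : ContDiffAt ℝ ∞ (extDeriv ξ) y₀ := by
  have h1 : ContDiffAt ℝ ∞ (fderiv ℝ ξ) y₀ := h.fderiv_right (by simp)
  have h2 := h1.continuousLinearMap_comp
    (ContinuousAlternatingMap.alternatizeUncurryFinCLM ℝ E6 ℝ (n := k))
  refine h2.congr_of_eventuallyEq (Filter.Eventually.of_forall fun y => ?_)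
  exact (ContinuousAlternatingMap.alternatizeUncurryFinCLM_apply _).symm

/-! ### Coframings, dΩ and η on the manifold -/

section Induced

variable {M : Type*} [TopologicalSpace M] [ChartedSpace E6 M]
  {o : ManifoldOrientation M} {φ : DForm M ℝ 3}

theorem inChart_holForm (x : M) : inChart (holForm o φ) x =
    fun y => complexForm (inChart φ x y) (inChart (starForm o φ) x y) := rfl

theorem modelForm_holForm (x : M) :
    modelForm (holForm o φ) x = complexForm (modelForm φ x) (modelForm (starForm o φ) x) := rfl

/-- A `ℂ³`-valued `1`-form in terms of the model space of the tangent spaces. -/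
def modelOne (α : ∀ x : M, TangentSpace (𝓡 6) x →L[ℝ] (Fin 3 → ℂ)) : M → E6 →L[ℝ] (Fin 3 → ℂ) := α

/-- A `ℂ³`-valued `1`-form in the chart at `x`. -/
def chartOne (α : M → E6 →L[ℝ] (Fin 3 → ℂ)) (x : M) (y : E6) : E6 →L[ℝ] (Fin 3 → ℂ) :=
  (α ((extChartAt (𝓡 6) x).symm y)).comp (chartLift x y)

theorem inChart_oneForm (α : ∀ x : M, TangentSpace (𝓡 6) x →L[ℝ] (Fin 3 → ℂ)) (x : M) :
    inChart (oneForm α) x = fun y => ContinuousAlternatingMap.ofSubsingleton ℝ E6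
      (Fin 3 → ℂ) (0 : Fin 1) (chartOne (modelOne α) x y) := rfl

theorem IsCoframing.isCoframe {J : EndField M} {U : Set M}
    {α : ∀ x : M, TangentSpace (𝓡 6) x →L[ℝ] (Fin 3 → ℂ)} (hα : IsCoframing J U α) {x : M}
    (hx : x ∈ U) : IsCoframe (modelEnd J x : E6 →ₗ[ℝ] E6)
      (modelOne α x : E6 →ₗ[ℝ] (Fin 3 → ℂ)) := (hα.2 x hx).2

theorem IsCoframing.contDiffAt {J : EndField M} {U : Set M}
    {α : ∀ x : M, TangentSpace (𝓡 6) x →L[ℝ] (Fin 3 → ℂ)} (hα : IsCoframing J U α) {x : M}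
    (hx : x ∈ U) :
    ContDiffAt ℝ ∞ (inChart (oneForm α) x) (extChartAt (𝓡 6) x x) ∧
      ContDiffAt ℝ ∞ (chartOne (modelOne α) x) (extChartAt (𝓡 6) x x) := by
  have h : ContDiffAt ℝ ∞ (inChart (oneForm α) x) (extChartAt (𝓡 6) x x) := (hα.2 x hx).1
  refine ⟨h, contDiffAt_clm_of_apply fun i => ?_⟩
  rw [inChart_oneForm] at h
  exact contDiffAt_apply h fun _ => stdBasis i

theorem IsCoframing.eventually_holForm_eq (hφ : IsPlus φ) {U : Set M}
    {α : ∀ x : M, TangentSpace (𝓡 6) x →L[ℝ] (Fin 3 → ℂ)} (hα : IsCoframing (inducedJ o φ) U α)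
    {x : M} (hx : x ∈ U) :
    ∀ᶠ y in 𝓝 (extChartAt (𝓡 6) x x), ∃ f : ℂ, (inChart (holForm o φ) x y).toAlternatingMap =
      f • wedgeOnes (compL (chartOne (modelOne α) x y)) := by
  have hc := (continuousAt_extChartAt_symm (I := 𝓡 6) x).tendsto
  rw [extChartAt_to_inv] at hc
  filter_upwards [hc.eventually (hα.1.mem_nhds hx)] with y hyU
  obtain ⟨f, -, hf⟩ := (hα.isCoframe hyU).exists_eq_smul_of_associated
    (hφ.isAssociated o ((extChartAt (𝓡 6) x).symm y))
  exact ⟨f, complexify_add_compLinearMap (A := (chartLift x y : E6 →ₗ[ℝ] E6)) hf⟩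

variable [IsManifold (𝓡 6) ∞ M]

theorem IsPlus.extD_holForm (hφ : IsPlus φ) (hclosed : ∀ x, extD (starForm o φ) x = 0) (x : M) :
    (modelForm (extD (holForm o φ)) x).toAlternatingMap =
      complexify (modelForm (extD φ) x).toAlternatingMap := by
  have h1 : extDeriv (inChart (starForm o φ) x) (extChartAt (𝓡 6) x x) = 0 :=
    (modelForm_extD _ _).symm.trans (hclosed x)
  rw [modelForm_extD, inChart_holForm,
    extDeriv_complexForm (hφ x).1 (hφ.smooth_induced o x).2, h1, ← modelForm_extD,
    toAlternatingMap_complexForm]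
  ext u
  simp [complexify_apply]

/-- Closedness of ∗φ makes dΩ real, and the reality argument then removes the β-term. -/
theorem IsPlus.extD_eq_of_isPiAt (hφ : IsPlus φ) (hclosed : ∀ x, extD (starForm o φ) x = 0) {x : M}
    {π : E6 [⋀^Fin 4]→ₗ[ℝ] ℝ} (hπ : IsPiAt o φ x π) :
    (modelForm (extD φ) x).toAlternatingMap = π := by
  obtain ⟨-, β, hβ, h⟩ := hπ
  obtain ⟨α, f, hα, hf, hαf⟩ := (hφ.isAssociated o x).exists_coframe finrank_E6
  have h1 := (hφ.extD_holForm hclosed x).symm.trans h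
  have h2 : (holForm o φ x).toAlternatingMap = f • wedgeOnes (comp α) := hαf
  rw [h2] at h1
  exact hα.eq_of_complexify_eq hβ hf h1

/-- `η` is at each point of the signature `ε`, and `dφ = 2 η²`. -/
structure IsUnitaryRoot (ε : Fin 3 → ℝ) (o : ManifoldOrientation M) (φ : DForm M ℝ 3)
    (η : DForm M ℝ 2) : Prop where
  unitary : ∀ x, ∃ β, IsUnitaryCoframe ε (modelEnd (inducedJ o φ) x : E6 →ₗ[ℝ] E6)
    (modelForm η x).toAlternatingMap β
  extD_eq : ∀ x, (modelForm (extD φ) x).toAlternatingMap =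
    (2 : ℝ) • wedge (modelForm η x).toAlternatingMap (modelForm η x).toAlternatingMap

/-- The chart expression of dφ is smooth because `extD`, defined with a different chart at each
point, agrees with `extDeriv` throughout a single chart. The root argument then applies in that
chart. -/
theorem IsUnitaryRoot.smoothFormAt {ε : Fin 3 → ℝ} (hε : IsSelfCofactor ε) {η : DForm M ℝ 2}
    (h : IsUnitaryRoot ε o φ η) (hφ : IsPlus φ) (x : M) : SmoothFormAt η x := by
  obtain ⟨s, hs, hpos⟩ := hφ.eventually_pos o x
  have hD : ContDiffAt ℝ ∞ (inChart (extD φ) x) (extChartAt (𝓡 6) x x) := by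
    refine (contDiffAt_extDeriv (hφ x).1).congr_of_eventuallyEq ?_
    filter_upwards [eventually_mem_target x] with y hy
    exact inChart_extD φ x hy (hφ _).1
  refine contDiffAt_root hε hs hD (J := endInChart (inducedJ o φ) x) ?_ ?_ hpos
  · filter_upwards [eventually_mem_target x] with y hy
    obtain ⟨β, hβ⟩ := h.unitary ((extChartAt (𝓡 6) x).symm y)
    obtain ⟨f, hf, hβf⟩ := hβ.1.exists_eq_smul_of_associated
      (hφ.isAssociated o ((extChartAt (𝓡 6) x).symm y))
    exact ⟨_, f, hf, hβ.pullback (chart_inverse_left hy) (chart_inverse_right hy),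
      complexify_add_compLinearMap hβf⟩
  · refine Filter.Eventually.of_forall fun y => ?_
    have h1 := congrArg (fun F => F.compLinearMap (chartLift x y : E6 →ₗ[ℝ] E6))
      (h.extD_eq ((extChartAt (𝓡 6) x).symm y))
    have h2 := wedge_compLinearMap (chartLift x y : E6 →ₗ[ℝ] E6)
      (modelForm η ((extChartAt (𝓡 6) x).symm y)).toAlternatingMap
      (modelForm η ((extChartAt (𝓡 6) x).symm y)).toAlternatingMap
    exact h1.trans (congrArg (fun F => (2 : ℝ) • F) h2.symm)

/-! ### Quasi-integrability -/

set_option maxHeartbeats 1000000 in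
theorem IsPlus.inChart_holForm_ne_zero (hφ : IsPlus φ) (o : ManifoldOrientation M) (x : M) :
    inChart (holForm o φ) x (extChartAt (𝓡 6) x x) ≠ 0 := by
  intro h0
  rw [inChart_self, modelForm_holForm] at h0
  have h1 := congrArg ContinuousAlternatingMap.toAlternatingMap h0
  rw [toAlternatingMap_complexForm] at h1
  obtain ⟨β, f, hβ, hf, hβf⟩ := (hφ.isAssociated o x).exists_coframe finrank_E6
  have h2 := congrArg (fun F => F hβ.frame) (hβf.symm.trans h1)
  have h3 : wedgeOnes (comp β) hβ.frame = 1 := by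
    rw [wedgeOnes_apply]
    convert Matrix.det_one (n := Fin 3) (R := ℂ)
    ext i j
    exact hβ.comp_frame i j
  have h4 : f * wedgeOnes (comp β) hβ.frame = 0 := h2
  rw [h3, mul_one] at h4
  exact hf h4

theorem chartOne_self (α : M → E6 →L[ℝ] (Fin 3 → ℂ)) (x : M) :
    chartOne α x (extChartAt (𝓡 6) x x) = α x := by
  rw [chartOne, chartLift_self, extChartAt_to_inv, ContinuousLinearMap.comp_id]

theorem IsUnitaryRoot.exists_model_nijenhuisMatrix {ε : Fin 3 → ℝ} (hε : IsSelfCofactor ε)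
    {η : DForm M ℝ 2} (h : IsUnitaryRoot ε o φ η) (hφ : IsPlus φ)
    (hclosed : ∀ x, extD (starForm o φ) x = 0) {U : Set M}
    {α : ∀ x : M, TangentSpace (𝓡 6) x →L[ℝ] (Fin 3 → ℂ)} (hα : IsCoframing (inducedJ o φ) U α)
    {x : M} (hx : x ∈ U) :
    ∃ N : Matrix (Fin 3) (Fin 3) ℂ,
      (∀ i : Fin 3, ∃ τ ∈ typeSpace (modelEnd (inducedJ o φ) x : E6 →ₗ[ℝ] E6) 2 0 ⊔
          typeSpace (modelEnd (inducedJ o φ) x : E6 →ₗ[ℝ] E6) 1 1,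
        (LinearMap.proj i : (Fin 3 → ℂ) →ₗ[ℝ] ℂ).compAlternatingMap
            (modelForm (extD (oneForm α)) x).toAlternatingMap =
          τ + ∑ j : Fin 3, N i j • wedgeOnes
            ![conjOne (compL (modelOne α x) (j + 1)), conjOne (compL (modelOne α x) (j + 2))]) ∧
      (IsUnitaryCoframe ε (modelEnd (inducedJ o φ) x : E6 →ₗ[ℝ] E6)
        (modelForm η x).toAlternatingMap (modelOne α x : E6 →ₗ[ℝ] (Fin 3 → ℂ)) →
        ∃ l : ℂ, N = l • diagMat ε) ∧
      ∃ g : GL (Fin 3) ℂ, N = rho g (diagMat ε) := by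
  have hξ : ContDiffAt ℝ ∞ (inChart (holForm o φ) x) (extChartAt (𝓡 6) x x) := by
    rw [inChart_holForm]
    exact contDiffAt_complexForm (hφ x).1 (hφ.smooth_induced o x).2
  have hJ := hα.isCoframe hx
  rw [← chartOne_self (modelOne α) x] at hJ
  obtain ⟨hsm, had⟩ := hα.contDiffAt hx
  rw [inChart_oneForm] at hsm
  obtain ⟨β, hβ⟩ := h.unitary x
  have hη : (extDeriv (inChart (holForm o φ) x) (extChartAt (𝓡 6) x x)).toAlternatingMap =
      complexify ((2 : ℝ) • wedge (modelForm η x).toAlternatingMap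
        (modelForm η x).toAlternatingMap) := by
    rw [← modelForm_extD, hφ.extD_holForm hclosed, h.extD_eq]
  have key := exists_nijenhuis_matrix hε hJ (hsm.differentiableAt (by simp))
    (had.differentiableAt (by simp)) (hξ.differentiableAt (by simp))
    (hα.eventually_holForm_eq hφ hx) (hφ.inChart_holForm_ne_zero o x) hβ hη
  rw [← inChart_oneForm, ← modelForm_extD, chartOne_self] at key
  exact key

/-- The previous statement with the tangent spaces restored; they are definitionally the model
space. -/
theorem IsUnitaryRoot.exists_nijenhuisMatrix {ε : Fin 3 → ℝ} (hε : IsSelfCofactor ε)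
    {η : DForm M ℝ 2} (h : IsUnitaryRoot ε o φ η) (hφ : IsPlus φ)
    (hclosed : ∀ x, extD (starForm o φ) x = 0) {U : Set M}
    {α : ∀ x : M, TangentSpace (𝓡 6) x →L[ℝ] (Fin 3 → ℂ)} (hα : IsCoframing (inducedJ o φ) U α)
    {x : M} (hx : x ∈ U) :
    ∃ N, IsNijenhuisMatrix (inducedJ o φ) α x N ∧
      (IsUnitaryCoframe ε (inducedJ o φ x : TangentSpace (𝓡 6) x →ₗ[ℝ] TangentSpace (𝓡 6) x)
        (η x).toAlternatingMap (α x : TangentSpace (𝓡 6) x →ₗ[ℝ] (Fin 3 → ℂ)) →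
        ∃ l : ℂ, N = l • diagMat ε) ∧
      ∃ g : GL (Fin 3) ℂ, N = rho g (diagMat ε) :=
  h.exists_model_nijenhuisMatrix hε hφ hclosed hα hx

theorem IsUnitaryRoot.isStrictlyQIUnitary {ε : Fin 3 → ℝ} (hε : IsSelfCofactor ε)
    {η : DForm M ℝ 2} (h : IsUnitaryRoot ε o φ η) (hφ : IsPlus φ)
    (hclosed : ∀ x, extD (starForm o φ) x = 0) :
    IsStrictlyQIUnitary ε (inducedJ o φ) η := by
  refine ⟨fun U α hα => ?_, fun U α hα x hx => ?_⟩
  · have h1 : ∀ x : M, ∃ l : ℂ, x ∈ U → IsNijenhuisMatrix (inducedJ o φ) α x (l • diagMat ε) := by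
      intro x
      by_cases hx : x ∈ U
      · obtain ⟨N, hN, hN1, -⟩ := h.exists_nijenhuisMatrix hε hφ hclosed hα.1 hx
        obtain ⟨l, rfl⟩ := hN1 (hα.2 x hx)
        exact ⟨l, fun _ => hN⟩
      -- The value of λ outside U is irrelevant.
      · exact ⟨0, fun h => absurd h hx⟩
    choose l hl using h1
    exact ⟨l, hl⟩
  · obtain ⟨N, hN, -, g, rfl⟩ := h.exists_nijenhuisMatrix hε hφ hclosed hα hx
    exact ⟨g, hN⟩

theorem IsPositiveDefinite.isUnitaryRoot (h : IsPositiveDefinite o φ) (hφ : IsPlus φ)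
    (hclosed : ∀ x, extD (starForm o φ) x = 0) : IsUnitaryRoot sigDef o φ (etaDef o φ) := by
  have h1 : ∀ x, IsPos11 (modelEnd (inducedJ o φ) x : E6 →ₗ[ℝ] E6)
      (modelForm (etaDef o φ) x).toAlternatingMap ∧ (modelForm (extD φ) x).toAlternatingMap =
      (2 : ℝ) • wedge (modelForm (etaDef o φ) x).toAlternatingMap
        (modelForm (etaDef o φ) x).toAlternatingMap := by
    intro x
    obtain ⟨π, hπ, hpos⟩ := h x
    obtain ⟨α, f, hα, -, -⟩ := (hφ.isAssociated o x).exists_coframe finrank_E6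
    obtain ⟨η, β, hβ, hη⟩ := hα.exists_unitary_of_isPos22 hpos
    -- The chosen root may differ from the one just constructed; only its defining properties are
    -- kept, and they supply a unitary coframe afresh.
    exact rootForm_spec hβ.isPos11 ((hφ.extD_eq_of_isPiAt hclosed hπ).trans hη)
  refine ⟨fun x => ?_, fun x => (h1 x).2⟩
  obtain ⟨α, f, hα, -, -⟩ := (hφ.isAssociated o x).exists_coframe finrank_E6
  exact hα.exists_unitary_of_isPos11 (h1 x).1

theorem IsPositiveIndefinite.isUnitaryRoot (h : IsPositiveIndefinite o φ) (hφ : IsPlus φ)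
    (hclosed : ∀ x, extD (starForm o φ) x = 0) : IsUnitaryRoot sigIndef o φ (etaIndef o φ) := by
  have h1 : ∀ x, IsHerm12 (modelEnd (inducedJ o φ) x : E6 →ₗ[ℝ] E6)
      (modelForm (etaIndef o φ) x).toAlternatingMap ∧ (modelForm (extD φ) x).toAlternatingMap =
      (2 : ℝ) • wedge (modelForm (etaIndef o φ) x).toAlternatingMap
        (modelForm (etaIndef o φ) x).toAlternatingMap := by
    intro x
    obtain ⟨π, hπ, hpos⟩ := h x
    obtain ⟨η, β, hβ, hη⟩ := hpos.exists_unitary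
    have hC : IsHerm12 _ η := ⟨hβ.isReal11, β, hβ⟩
    exact rootForm_spec hC ((hφ.extD_eq_of_isPiAt hclosed hπ).trans hη)
  exact ⟨fun x => (h1 x).1.2, fun x => (h1 x).2⟩

end Induced

end QuasiInt

end

theorem mainTheorem11 {M : Type*} [TopologicalSpace M] [ChartedSpace QuasiInt.E6 M]
    [IsManifold (𝓡 6) ∞ M] (o : QuasiInt.ManifoldOrientation M)
    (φ : QuasiInt.DForm M ℝ 3) (hφ : QuasiInt.IsPlus φ)
    (hclosed : ∀ x, QuasiInt.extD (QuasiInt.starForm o φ) x = 0) :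
    (QuasiInt.IsPositiveDefinite o φ →
      QuasiInt.IsU3Structure (QuasiInt.inducedJ o φ) (QuasiInt.etaDef o φ) ∧
      (∀ x, (QuasiInt.extD φ x).toAlternatingMap =
        (2 : ℝ) • QuasiInt.wedge (QuasiInt.etaDef o φ x).toAlternatingMap
          (QuasiInt.etaDef o φ x).toAlternatingMap) ∧
      QuasiInt.IsStrictlyQIUnitary QuasiInt.sigDef
        (QuasiInt.inducedJ o φ) (QuasiInt.etaDef o φ)) ∧
    (QuasiInt.IsPositiveIndefinite o φ →
      QuasiInt.IsU12Structure (QuasiInt.inducedJ o φ) (QuasiInt.etaIndef o φ) ∧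
      (∀ x, (QuasiInt.extD φ x).toAlternatingMap =
        (2 : ℝ) • QuasiInt.wedge (QuasiInt.etaIndef o φ x).toAlternatingMap
          (QuasiInt.etaIndef o φ x).toAlternatingMap) ∧
      QuasiInt.IsStrictlyQIUnitary QuasiInt.sigIndef
        (QuasiInt.inducedJ o φ) (QuasiInt.etaIndef o φ)) := by
  constructor
  · intro h
    have hr := h.isUnitaryRoot hφ hclosed
    refine ⟨⟨hφ.isAlmostComplex o, fun x => ⟨hr.smoothFormAt QuasiInt.isSelfCofactor_sigDef hφ x, ?_⟩⟩,
      hr.extD_eq, hr.isStrictlyQIUnitary QuasiInt.isSelfCofactor_sigDef hφ hclosed⟩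
    obtain ⟨β, hβ⟩ := hr.unitary x
    exact hβ.isPos11
  · intro h
    have hr := h.isUnitaryRoot hφ hclosed
    refine ⟨⟨hφ.isAlmostComplex o, fun x =>
      ⟨hr.smoothFormAt QuasiInt.isSelfCofactor_sigIndef hφ x, ?_⟩⟩,
      hr.extD_eq, hr.isStrictlyQIUnitary QuasiInt.isSelfCofactor_sigIndef hφ hclosed⟩
    obtain ⟨β, hβ⟩ := hr.unitary x
    exact ⟨hβ.isReal11, β, hβ⟩
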